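/- Let $k$ be $\mathbb{R}$ or $\mathbb{C}$ and let $(\mathcal{M},Q)$ be an $NQ$-manifold, i.e. a non-negatively graded smooth manifold over $k$ with a degree one derivation $Q$ of its graded algebra of functions $\mathsf{A}=C^\infty(\mathcal{M})$ with $Q^2=0$. Below, signs $(-1)^{f}$ mean $(-1)^{\deg f}$. *Bar complex.* Let $B=\bigoplus_{q\ge 0}B^{-q}$, $B^{-q}=\mathsf{A}\otimes_k\mathsf{A}^{\otimes q}\otimes_k\mathsf{A}$, with elements $f_0[f_1|\cdots|f_q]f_{q+1}$. For homogeneous $f_i$ put $s_i=(-1)^{f_0+(f_1+1)+\cdots+(f_{i-1}+1)}$ for $i\ge 1$, and $$b_0\big(f_0[f_1|\cdots|f_q]f_{q+1}\big)=(Qf_0)[f_1|\cdots|f_q]f_{q+1}-\sum_{i=1}^q s_i\,f_0[f_1|\cdots|Qf_i|\cdots|f_q]f_{q+1}+s_{q+1}\,f_0[f_1|\cdots|f_q]Qf_{q+1},$$ $$b_1\big(f_0[f_1|\cdots|f_q]f_{q+1}\big)=(-1)^{f_0}f_0f_1[f_2|\cdots|f_q]f_{q+1}+\sum_{i=1}^{q-1}s_{i+1}\,f_0[f_1|\cdots|f_if_{i+1}|\cdots|f_q]f_{q+1}-s_q\,f_0[f_1|\cdots|f_{q-1}]f_qf_{q+1}$$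 for $q\ge 1$, and $b_1=0$ on $B^0$. For $f\in\mathsf{A}^0$ let $S_i(f)$ ($1\le i\le q+1$) insert $f$ between the bars: $$S_i(f)\big(f_0[f_1|\cdots|f_q]f_{q+1}\big)=f_0[f_1|\cdots|f_{i-1}|f|f_i|\cdots|f_q]f_{q+1}.$$ The normalized bar complex $\bar B(\mathsf{A},\mathsf{A},\mathsf{A})$ is the quotient of $B$ by the span of the images of all $S_i(f)$ and all $S_i(f)b+bS_i(f)$, where $b=b_0+b_1$. *Super-curves.* Let $\bar{\mathcal{S}}$ be the (infinite dimensional) $NQ$-manifold of super-curves, which represents the presheaf $\mathcal{L}\mapsto\mathrm{Hom}_{NQ}(T[1][0,1]\times\mathcal{L},\mathcal{M})$ on $NQ$-manifolds. Thus a function of degree $n$ on $\bar{\mathcal{S}}$ is a natural transformation from this presheaf to $\mathcal{L}\mapsto C^\infty(\mathcal{L})^n$, $C^\infty(\bar{\mathcal{S}})=\bigoplus_n C^\infty(\bar{\mathcal{S}})^n$, and $\delta_B$ is the differential given on every $\mathcal{L}$ by the differential of $C^\infty(\mathcal{L})$. For a super-curve $\varphi$, let $\boldsymbol{f}(t,\theta)=f(t)+\theta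 f_\theta(t)$ be the pull-back of $f\in\mathsf{A}$, with $f(t),f_\theta(t)\in C^\infty(\mathcal{L})$. The iterated integral of $f_0[f_1|\cdots|f_q]f_{q+1}$ is the function $$\varphi\ \longmapsto\ f_0(1)\int_0^1dt_1\,f_{1,\theta}(t_1)\int_0^{t_1}dt_2\,f_{2,\theta}(t_2)\cdots\int_0^{t_{q-1}}dt_q\,f_{q,\theta}(t_q)\cdot f_{q+1}(0).$$ **Lemma.** The operator $b=b_0+b_1$ descends to $\bar B(\mathsf{A},\mathsf{A},\mathsf{A})$, and there $b^2=0$; also $\delta_B^2=0$. The iterated integral is a well-defined linear map $$\Phi:\ \bar B(\mathsf{A},\mathsf{A},\mathsf{A})\longrightarrow C^\infty(\bar{\mathcal{S}}),$$ it takes $f_0[f_1|\cdots|f_q]f_{q+1}$ with homogeneous $f_i$ to a function of degree $\sum_{i=0}^{q+1}\deg f_i-q$, and it is a chain map: $\Phi\circ b=\delta_B\circ\Phi$. -/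

import Mathlib

open scoped Manifold ContDiff DirectSum TensorProduct

noncomputable section

/-! ## Free graded commutative algebras -/

/-- The relations `ξ i * ξ j = (-1) ^ (d i * d j) ξ j * ξ i`. -/
inductive GSymRel (𝕜 : Type) [RCLike 𝕜] {r : ℕ} (d : Fin r → ℕ) :
    FreeAlgebra 𝕜 (Fin r) → FreeAlgebra 𝕜 (Fin r) → Prop
  | comm (i j : Fin r) : GSymRel 𝕜 d (FreeAlgebra.ι 𝕜 i * FreeAlgebra.ι 𝕜 j)
      ((-1) ^ (d i * d j) * (FreeAlgebra.ι 𝕜 j * FreeAlgebra.ι 𝕜 i))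

/-- The free graded commutative `𝕜`-algebra `Sym V`, where `V` has a basis `ξ i` with `ξ i` of
degree `d i`. -/
abbrev GSym (𝕜 : Type) [RCLike 𝕜] {r : ℕ} (d : Fin r → ℕ) : Type := RingQuot (GSymRel 𝕜 d)

/-- The generator `ξ i`. -/
def GSym.gen (𝕜 : Type) [RCLike 𝕜] {r : ℕ} (d : Fin r → ℕ) (i : Fin r) : GSym 𝕜 d :=
  RingQuot.mkAlgHom 𝕜 (GSymRel 𝕜 d) (FreeAlgebra.ι 𝕜 i)

/-- The homogeneous part of degree `n`, spanned by the monomials of degree `n`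
(it is zero for `n < 0`). -/
def GSym.homog (𝕜 : Type) [RCLike 𝕜] {r : ℕ} (d : Fin r → ℕ) (n : ℤ) :
    Submodule 𝕜 (GSym 𝕜 d) :=
  Submodule.span 𝕜 {w | ∃ l : List (Fin r), ((l.map d).sum : ℤ) = n ∧
    w = (l.map (GSym.gen 𝕜 d)).prod}

theorem GSym.one_mem (𝕜 : Type) [RCLike 𝕜] {r : ℕ} (d : Fin r → ℕ) :
    (1 : GSym 𝕜 d) ∈ GSym.homog 𝕜 d 0 :=
  Submodule.subset_span ⟨[], by simp, by simp⟩

theorem GSym.mul_mem (𝕜 : Type) [RCLike 𝕜] {r : ℕ} (d : Fin r → ℕ) {m n : ℤ} {a b : GSym 𝕜 d}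
    (ha : a ∈ GSym.homog 𝕜 d m) (hb : b ∈ GSym.homog 𝕜 d n) :
    a * b ∈ GSym.homog 𝕜 d (m + n) := by
  have h := Submodule.mul_mem_mul ha hb
  rw [GSym.homog, GSym.homog, Submodule.span_mul_span] at h
  refine Submodule.span_mono ?_ h
  rintro _ ⟨_, ⟨l, hl, rfl⟩, _, ⟨l', hl', rfl⟩, rfl⟩
  refine ⟨l ++ l', ?_, by simp⟩
  rw [List.map_append, List.sum_append, ← hl, ← hl']
  push_cast
  rfl

/-! ## Graded manifolds -/

/-- `g ∈ C^∞(U) ⊗ S`: on `U`, the `S`-valued function `g` is a finite sum of products of smooth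
`𝕜`-valued functions with constant elements of `S`. -/
def SmoothInto (𝕜 : Type) [RCLike 𝕜] {E H Y : Type} [NormedAddCommGroup E] [NormedSpace ℝ E]
    [TopologicalSpace H] (J : ModelWithCorners ℝ E H) [TopologicalSpace Y] [ChartedSpace H Y]
    {S : Type} [Ring S] [Algebra 𝕜 S] (U : Set Y) (g : Y → S) : Prop :=
  ∃ (κ : Type) (_ : Fintype κ) (c : κ → Y → 𝕜) (s : κ → S),
    (∀ k, ContMDiffOn J 𝓘(ℝ, 𝕜) ∞ (c k) U) ∧ ∀ y ∈ U, g y = ∑ k, c k y • s k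

section SmoothInto

variable {𝕜 : Type} [RCLike 𝕜] {E H Y : Type} [NormedAddCommGroup E] [NormedSpace ℝ E]
    [TopologicalSpace H] {J : ModelWithCorners ℝ E H} [TopologicalSpace Y] [ChartedSpace H Y]
    {S : Type} [Ring S] [Algebra 𝕜 S] {U : Set Y} {g g' : Y → S}

theorem SmoothInto.const (v : S) : SmoothInto 𝕜 J U (fun _ => v) :=
  ⟨Unit, inferInstance, fun _ _ => 1, fun _ => v, fun _ => contMDiffOn_const, by simp⟩

theorem SmoothInto.add (h : SmoothInto 𝕜 J U g) (h' : SmoothInto 𝕜 J U g') :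
    SmoothInto 𝕜 J U (fun y => g y + g' y) := by
  obtain ⟨κ, _, c, s, hc, hg⟩ := h
  obtain ⟨κ', _, c', s', hc', hg'⟩ := h'
  refine ⟨κ ⊕ κ', inferInstance, Sum.elim c c', Sum.elim s s', ?_, ?_⟩
  · rintro (k | k)
    · exact hc k
    · exact hc' k
  · intro y hy
    simp [hg y hy, hg' y hy]

theorem SmoothInto.mul (h : SmoothInto 𝕜 J U g) (h' : SmoothInto 𝕜 J U g') :
    SmoothInto 𝕜 J U (fun y => g y * g' y) := by
  obtain ⟨κ, _, c, s, hc, hg⟩ := h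
  obtain ⟨κ', _, c', s', hc', hg'⟩ := h'
  refine ⟨κ × κ', inferInstance, fun k y => c k.1 y * c' k.2 y, fun k => s k.1 * s' k.2, ?_, ?_⟩
  · exact fun k => (contDiff_mul (𝕜 := ℝ) (𝔸 := 𝕜)).contMDiff.comp_contMDiffOn
      ((hc k.1).prodMk_space (hc' k.2))
  · intro y hy
    simp only [hg y hy, hg' y hy, Finset.sum_mul_sum, Fintype.sum_prod_type, smul_mul_smul_comm]

end SmoothInto

/-- A non-negatively graded manifold over `𝕜` (`ℝ` or `ℂ`): a smooth manifold `X` with a sheaf of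
graded commutative algebras that is locally isomorphic to `C^∞(U) ⊗ Sym V`, for a graded vector
space `V` with finite basis in positive degrees `d`.

Since the generators have positive degree, the degree zero part of the sheaf consists of the smooth
functions on `X`, and its local isomorphisms are linear over smooth functions. Hence the sheaf is
given as the sheaf of smooth sections of a bundle of graded algebras `fib x`, `x ∈ X`, with local
trivializations `coord i x : fib x ≃ Sym V` for `x ∈ dom i`. -/
structure NManifold (𝕜 : Type) [RCLike 𝕜] where
  /-- the dimension of the reduced manifold -/
  dim : ℕ
  /-- the reduced manifold -/
  X : Type
  [top : TopologicalSpace X]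
  [t2 : T2Space X]
  [secondCountable : SecondCountableTopology X]
  [charted : ChartedSpace (EuclideanSpace ℝ (Fin dim)) X]
  [manifold : IsManifold (𝓡 dim) ∞ X]
  /-- the number of coordinates of positive degree -/
  r : ℕ
  /-- the degrees of these coordinates -/
  d : Fin r → ℕ
  d_pos : ∀ i, 0 < d i
  /-- the fibres of the structure sheaf over the points of `X` -/
  fib : X → Type
  [fibRing : ∀ x, Ring (fib x)]
  [fibAlgebra : ∀ x, Algebra 𝕜 (fib x)]
  /-- the grading of the fibres -/
  gr : ∀ x, ℤ → Submodule 𝕜 (fib x)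
  /-- the index set of the local trivializations -/
  ι : Type
  dom : ι → Set X
  isOpen_dom : ∀ i, IsOpen (dom i)
  cover : ∀ x, ∃ i, x ∈ dom i
  coord : ι → ∀ x, fib x ≃ₐ[𝕜] GSym 𝕜 d
  coord_gr : ∀ i, ∀ x ∈ dom i, ∀ n v, v ∈ gr x n ↔ coord i x v ∈ GSym.homog 𝕜 d n
  smooth_transition : ∀ i j s, SmoothInto 𝕜 (𝓡 dim) (dom i ∩ dom j)
    (fun x => coord j x ((coord i x).symm s))

attribute [instance] NManifold.top NManifold.t2 NManifold.secondCountable NManifold.charted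
  NManifold.manifold NManifold.fibRing NManifold.fibAlgebra

namespace NManifold

variable {𝕜 : Type} [RCLike 𝕜]

/-- All (not necessarily smooth) sections of the bundle of algebras of `L`. -/
abbrev Sec (L : NManifold 𝕜) : Type := ∀ x, L.fib x

theorem one_mem_gr (L : NManifold 𝕜) (x : L.X) : (1 : L.fib x) ∈ L.gr x 0 := by
  obtain ⟨i, hi⟩ := L.cover x
  rw [L.coord_gr i x hi, map_one]
  exact GSym.one_mem 𝕜 L.d

theorem mul_mem_gr (L : NManifold 𝕜) (x : L.X) {m n : ℤ} {a b : L.fib x}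
    (ha : a ∈ L.gr x m) (hb : b ∈ L.gr x n) : a * b ∈ L.gr x (m + n) := by
  obtain ⟨i, hi⟩ := L.cover x
  rw [L.coord_gr i x hi] at ha hb ⊢
  rw [map_mul]
  exact GSym.mul_mem 𝕜 L.d ha hb

/-- The functions of degree `n` on the graded manifold `L`. -/
def Fun (L : NManifold 𝕜) (n : ℤ) : Submodule 𝕜 L.Sec where
  carrier := {f | (∀ x, f x ∈ L.gr x n) ∧
    ∀ i, SmoothInto 𝕜 (𝓡 L.dim) (L.dom i) (fun x => L.coord i x (f x))}
  add_mem' := by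
    rintro f g ⟨hf, hf'⟩ ⟨hg, hg'⟩
    refine ⟨fun x => add_mem (hf x) (hg x), fun i => ?_⟩
    simpa using (hf' i).add (hg' i)
  zero_mem' := by
    refine ⟨fun x => zero_mem _, fun i => ?_⟩
    simpa using SmoothInto.const (0 : GSym 𝕜 L.d)
  smul_mem' := by
    rintro a f ⟨hf, hf'⟩
    refine ⟨fun x => Submodule.smul_mem _ a (hf x), fun i => ?_⟩
    simpa [Algebra.smul_def] using
      (SmoothInto.const (algebraMap 𝕜 (GSym 𝕜 L.d) a)).mul (hf' i)

instance gradedMonoid (L : NManifold 𝕜) : SetLike.GradedMonoid L.Fun where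
  one_mem := by
    refine ⟨L.one_mem_gr, fun i => ?_⟩
    simpa using SmoothInto.const (1 : GSym 𝕜 L.d)
  mul_mem := by
    rintro m n f g ⟨hf, hf'⟩ ⟨hg, hg'⟩
    refine ⟨fun x => L.mul_mem_gr x (hf x) (hg x), fun i => ?_⟩
    simpa using (hf' i).mul (hg' i)

/-- The constant function `1`. -/
def one (L : NManifold 𝕜) : L.Fun 0 := ⟨1, SetLike.GradedOne.one_mem⟩

/-- The product of homogeneous functions. -/
def mul (L : NManifold 𝕜) {m n : ℤ} (f : L.Fun m) (g : L.Fun n) : L.Fun (m + n) :=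
  ⟨(f : L.Sec) * (g : L.Sec), SetLike.GradedMul.mul_mem f.2 g.2⟩

/-- The graded algebra `C^∞(L) = ⨁ n, C^∞(L)^n` of functions on `L`. -/
def Functions (L : NManifold 𝕜) : Type := ⨁ n, L.Fun n

instance (L : NManifold 𝕜) : Ring L.Functions := inferInstanceAs (Ring (⨁ n, L.Fun n))

instance (L : NManifold 𝕜) : Algebra 𝕜 L.Functions := inferInstanceAs (Algebra 𝕜 (⨁ n, L.Fun n))

/-- The inclusion `C^∞(L)^n → C^∞(L)`. -/
def of (L : NManifold 𝕜) (n : ℤ) : L.Fun n →ₗ[𝕜] L.Functions :=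
  DirectSum.lof 𝕜 ℤ (fun n => L.Fun n) n

/-- The linear map on `C^∞(L)` with the given restrictions to the homogeneous parts. -/
def lift (L : NManifold 𝕜) {V : Type} [AddCommMonoid V] [Module 𝕜 V]
    (g : ∀ n, L.Fun n →ₗ[𝕜] V) : L.Functions →ₗ[𝕜] V :=
  DirectSum.toModule 𝕜 ℤ V g

/-- A family `F : [0,1] → C^∞(L)^n` is a smooth function on `[0,1] × L`, that is, the restriction
of a smooth function on `ℝ × L`. -/
def IsSmoothFamily {L : NManifold 𝕜} {n : ℤ} (F : unitInterval → L.Fun n) : Prop :=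
  ∃ G : ℝ → L.Fun n,
    (∀ i, SmoothInto 𝕜 (𝓘(ℝ, ℝ).prod (𝓡 L.dim)) (Set.univ ×ˢ L.dom i)
      (fun p : ℝ × L.X => L.coord i p.2 ((G p.1 : L.Sec) p.2))) ∧
    ∀ t : unitInterval, G t = F t

/-- `G = ∂F/∂t` for families of sections over `[0,1]`. The fibres are vector spaces, in each degree
of finite dimension, and the derivative in a fibre is tested with the linear functionals. -/
def HasTimeDeriv {L : NManifold 𝕜} (F G : unitInterval → L.Sec) : Prop :=
  ∀ (x : L.X) (l : Module.Dual 𝕜 (L.fib x)) (t : unitInterval),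
    HasDerivWithinAt (fun s : ℝ => l (F (Set.projIcc 0 1 zero_le_one s) x)) (l (G t x))
      (Set.Icc 0 1) (t : ℝ)

open Classical in
/-- The integral `∫ g(s) ds` over `[0,t]` in a vector space `V`: the vector whose image under each
linear functional `l` is the integral of `l(g(s))` over `[0,t]`. (It is unique, and `0` stands for
it in case that it does not exist.) -/
def fiberIntegral (𝕜 : Type) [RCLike 𝕜] {V : Type} [AddCommGroup V] [Module 𝕜 V]
    (g : unitInterval → V) (t : unitInterval) : V :=
  if h : ∃ v : V, ∀ l : Module.Dual 𝕜 V,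
      l v = ∫ s in (0 : ℝ)..t, l (g (Set.projIcc 0 1 zero_le_one s))
  then h.choose else 0

/-- The nested integral of `g₁, …, g_q`, as a function of the upper limit `t`:
`∫_0^t dt₁ g₁(t₁) ∫_0^{t₁} dt₂ g₂(t₂) ⋯ ∫_0^{t_{q-1}} dt_q g_q(t_q)`. -/
def nestedIntegral (L : NManifold 𝕜) : List (unitInterval → L.Sec) → unitInterval → L.Sec
  | [], _ => 1
  | g :: l, t => fun x => fiberIntegral 𝕜 (fun s => g s x * nestedIntegral L l s x) t

end NManifold

/-- An NQ-manifold: a non-negatively graded manifold with a homological vector field `Q`, that is,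
a derivation of degree one of its functions with `Q² = 0`. -/
structure NQManifold (𝕜 : Type) [RCLike 𝕜] extends NManifold 𝕜 where
  Q : ∀ n, toNManifold.Fun n →ₗ[𝕜] toNManifold.Fun (n + 1)
  Q_mul : ∀ {m n : ℤ} (f : toNManifold.Fun m) (g : toNManifold.Fun n),
    (Q (m + n) (toNManifold.mul f g) : toNManifold.Sec) =
      (Q m f : toNManifold.Sec) * (g : toNManifold.Sec) +
        (m.negOnePow : ℤ) • ((f : toNManifold.Sec) * (Q n g : toNManifold.Sec))
  Q_Q : ∀ {n : ℤ} (f : toNManifold.Fun n), Q (n + 1) (Q n f) = 0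

/-- A morphism of NQ-manifolds `L' → L`: a morphism `C^∞(L) → C^∞(L')` of graded algebras that
commutes with the differentials; on functions of degree zero it is the composition with a smooth
map of the reduced manifolds. -/
structure NQHom {𝕜 : Type} [RCLike 𝕜] (L' L : NQManifold 𝕜) where
  pull : ∀ n, L.Fun n →ₗ[𝕜] L'.Fun n
  pull_one : pull 0 (L.one) = L'.one
  pull_mul : ∀ {m n : ℤ} (f : L.Fun m) (g : L.Fun n),
    pull (m + n) (L.mul f g) = L'.mul (pull m f) (pull n g)
  pull_Q : ∀ {n : ℤ} (f : L.Fun n), pull (n + 1) (L.Q n f) = L'.Q n (pull n f)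
  covers : ∃ γ : L'.X → L.X, ContMDiff (𝓡 L'.dim) (𝓡 L.dim) ∞ γ ∧
    ∀ (f : L.Fun 0) (c : L.X → 𝕜), (∀ y, (f : L.Sec) y = algebraMap 𝕜 _ (c y)) →
      ∀ x, (pull 0 f : L'.Sec) x = algebraMap 𝕜 _ (c (γ x))

/-- A super-curve in `M` parameterized by `L`: a morphism of NQ-manifolds
`T[1][0,1] × L → M`. The functions on `T[1][0,1] × L` are `F + θ G`, where `F`, `G` are functions
on `[0,1] × L` and `θ` is the coordinate of degree one, and the differential is `θ ∂_t + d`, where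
`d` is the differential of `C^∞(L)`. So a super-curve is a morphism of graded algebras
`f ↦ body f + θ theta f` (the superfield of `f`), given on `C^∞(M)`, with
`body (Q f) + θ theta (Q f) = (θ ∂_t + d) (body f + θ theta f)`; on functions of degree zero it is
the composition with a smooth map of the reduced manifolds. -/
structure SuperCurve {𝕜 : Type} [RCLike 𝕜] (M L : NQManifold 𝕜) where
  body : ∀ n, M.Fun n →ₗ[𝕜] (unitInterval → L.Fun n)
  theta : ∀ n, M.Fun n →ₗ[𝕜] (unitInterval → L.Fun (n - 1))
  smooth_body : ∀ {n : ℤ} (f : M.Fun n), NManifold.IsSmoothFamily (body n f)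
  smooth_theta : ∀ {n : ℤ} (f : M.Fun n), NManifold.IsSmoothFamily (theta n f)
  body_one : ∀ t, body 0 (M.one) t = L.one
  body_mul : ∀ {m n : ℤ} (f : M.Fun m) (g : M.Fun n) (t : unitInterval),
    body (m + n) (M.mul f g) t = L.mul (body m f t) (body n g t)
  theta_mul : ∀ {m n : ℤ} (f : M.Fun m) (g : M.Fun n) (t : unitInterval),
    (theta (m + n) (M.mul f g) t : L.Sec) =
      (theta m f t : L.Sec) * (body n g t : L.Sec) +
        (m.negOnePow : ℤ) • ((body m f t : L.Sec) * (theta n g t : L.Sec))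
  body_Q : ∀ {n : ℤ} (f : M.Fun n) (t : unitInterval),
    body (n + 1) (M.Q n f) t = L.Q n (body n f t)
  theta_Q : ∀ {n : ℤ} (f : M.Fun n),
    NManifold.HasTimeDeriv (L := L.toNManifold) (fun t => (body n f t : L.Sec))
      (fun t => (theta (n + 1) (M.Q n f) t : L.Sec) + (L.Q (n - 1) (theta n f t) : L.Sec))
  covers : ∃ γ : ℝ × L.X → M.X,
    ContMDiffOn (𝓘(ℝ, ℝ).prod (𝓡 L.dim)) (𝓡 M.dim) ∞ γ (Set.Icc 0 1 ×ˢ Set.univ) ∧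
    ∀ (f : M.Fun 0) (c : M.X → 𝕜), (∀ y, (f : M.Sec) y = algebraMap 𝕜 _ (c y)) →
      ∀ (t : unitInterval) (x : L.X), (body 0 f t : L.Sec) x = algebraMap 𝕜 _ (c (γ ((t : ℝ), x)))

/-- `φ'` is the composition of `id × ψ : T[1][0,1] × L' → T[1][0,1] × L` and `φ`. -/
def SuperCurve.IsPullback {𝕜 : Type} [RCLike 𝕜] {M L L' : NQManifold 𝕜} (φ : SuperCurve M L)
    (ψ : NQHom L' L) (φ' : SuperCurve M L') : Prop :=
  ∀ (n : ℤ) (f : M.Fun n) (t : unitInterval),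
    φ'.body n f t = ψ.pull n (φ.body n f t) ∧ φ'.theta n f t = ψ.pull (n - 1) (φ.theta n f t)

/-- The functions of degree `n` on the space of super-curves in `M`, that is, on the (infinite
dimensional) NQ-manifold that represents the presheaf `L ↦ Hom(T[1][0,1] × L, M)`: the natural
transformations from this presheaf on the category of NQ-manifolds to `L ↦ C^∞(L)^n`. -/
def SuperCurveFun {𝕜 : Type} [RCLike 𝕜] (M : NQManifold 𝕜) (n : ℤ) :
    Submodule 𝕜 (∀ L : NQManifold 𝕜, SuperCurve M L → L.Fun n) where
  carrier := {F | ∀ (L L' : NQManifold 𝕜) (ψ : NQHom L' L) (φ : SuperCurve M L)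
    (φ' : SuperCurve M L'), φ.IsPullback ψ φ' → F L' φ' = ψ.pull n (F L φ)}
  add_mem' := by
    intro F G hF hG L L' ψ φ φ' h
    simp [hF L L' ψ φ φ' h, hG L L' ψ φ φ' h]
  zero_mem' := by
    intro L L' ψ φ φ' _
    simp
  smul_mem' := by
    intro a F hF L L' ψ φ φ' h
    simp [hF L L' ψ φ φ' h]

/-- The graded vector space `C^∞(S̄)` of functions on the space of super-curves in `M`. -/
abbrev SuperCurveFunctions {𝕜 : Type} [RCLike 𝕜] (M : NQManifold 𝕜) : Type 1 :=
  ⨁ n : ℤ, SuperCurveFun M n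

/-- The differential `δ_B` on functions of degree `n`; for each morphism `φ` from `L` to the space
of super-curves, the pull-back along `φ` takes `δ_B` to the differential of `C^∞(L)`. -/
def deltaBHomog {𝕜 : Type} [RCLike 𝕜] (M : NQManifold 𝕜) (n : ℤ) :
    SuperCurveFun M n →ₗ[𝕜] SuperCurveFun M (n + 1) where
  toFun F := ⟨fun L φ => L.Q n (F.1 L φ), by
    intro L L' ψ φ φ' h
    show L'.Q n (F.1 L' φ') = ψ.pull (n + 1) (L.Q n (F.1 L φ))
    rw [F.2 L L' ψ φ φ' h, ψ.pull_Q]⟩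
  map_add' F G := by
    ext1
    funext L φ
    simp
  map_smul' a F := by
    ext1
    funext L φ
    simp

/-- The BRST differential `δ_B` on `C^∞(S̄)`. -/
def deltaB {𝕜 : Type} [RCLike 𝕜] (M : NQManifold 𝕜) :
    SuperCurveFunctions M →ₗ[𝕜] SuperCurveFunctions M :=
  DirectSum.toModule 𝕜 ℤ _ fun n =>
    DirectSum.lof 𝕜 ℤ (fun n => SuperCurveFun M n) (n + 1) ∘ₗ deltaBHomog M n

/-- The iterated integral of `f_0 [f_1 | ⋯ | f_q] f_{q+1}` along the super-curve `φ`: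
`f_0(1) ∫_0^1 dt₁ ∂_θ f_1 ∫_0^{t₁} dt₂ ∂_θ f_2 ⋯ ∫_0^{t_{q-1}} dt_q ∂_θ f_q · f_{q+1}(0)`. -/
def iteratedIntegral {𝕜 : Type} [RCLike 𝕜] {M L : NQManifold 𝕜} (φ : SuperCurve M L) {q : ℕ}
    (e : Fin (q + 2) → ℤ) (f : ∀ i, M.Fun (e i)) : L.Sec :=
  (φ.body _ (f 0) 1 : L.Sec) *
    NManifold.nestedIntegral L.toNManifold
      (List.ofFn fun (i : Fin q) (t : unitInterval) =>
        (φ.theta _ (f i.succ.castSucc) t : L.Sec)) 1 *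
    (φ.body _ (f (Fin.last (q + 1))) 0 : L.Sec)

/-! ## The bar complex `B(A, A, A)` of `A = C^∞(M)` -/

namespace NQManifold

variable {𝕜 : Type} [RCLike 𝕜]

/-- The differential of `A = C^∞(M)`. -/
def QA (M : NQManifold 𝕜) : M.Functions →ₗ[𝕜] M.Functions :=
  M.lift fun n => M.of (n + 1) ∘ₗ M.Q n

/-- The map `f ↦ (-1)^f f`. -/
def sgn (M : NQManifold 𝕜) : M.Functions →ₗ[𝕜] M.Functions :=
  M.lift fun n => ((n.negOnePow : ℤ) : 𝕜) • M.of n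

/-- The part `B^{-q}` of the bar complex, `A ⊗ A^{⊗ q} ⊗ A`. The element
`f_0 [f_1 | ⋯ | f_q] f_{q+1}` is `PiTensorProduct.tprod 𝕜 f`. -/
abbrev BarPart (M : NQManifold 𝕜) (q : ℕ) : Type :=
  PiTensorProduct 𝕜 fun _ : Fin (q + 2) => M.Functions

/-- The bar complex `B(A, A, A)`. -/
abbrev Bar (M : NQManifold 𝕜) : Type := ⨁ q : ℕ, M.BarPart q

/-- The sign map on the entry at place `j`: it is `f ↦ (-1)^f f` for `j = 0` and
`f ↦ (-1)^{f+1} f` for `j > 0`. -/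
def entrySgn (M : NQManifold 𝕜) (j : ℕ) : M.Functions →ₗ[𝕜] M.Functions :=
  if j = 0 then M.sgn else -M.sgn

/-- The sign `(-1)^{f_0 + (f_1 + 1) + ⋯ + (f_{p-1} + 1)}`, distributed over the entries. -/
def signBefore (M : NQManifold 𝕜) {n : ℕ} (p : ℕ) (j : Fin n) : M.Functions →ₗ[𝕜] M.Functions :=
  if (j : ℕ) < p then M.entrySgn j else LinearMap.id

/-- `f_0 [f_1 | ⋯ | f_q] f_{q+1}` goes to the sum over the places `i` of
`± (-1)^{f_0 + (f_1 + 1) + ⋯ + (f_{i-1} + 1)} f_0 [⋯ | Q f_i | ⋯] f_{q+1}`, where the sign `±` is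
`+` for `i = 0` and for `i = q + 1`, and `-` for the places between the bars. -/
def b0Part (M : NQManifold 𝕜) (q : ℕ) : M.BarPart q →ₗ[𝕜] M.BarPart q :=
  ∑ i : Fin (q + 2), (if i = 0 ∨ i = Fin.last (q + 1) then (1 : 𝕜) else -1) •
    PiTensorProduct.lift ((PiTensorProduct.tprod 𝕜).compLinearMap fun j : Fin (q + 2) =>
      if j = i then M.QA else M.signBefore i j)

/-- The internal differential `b_0`. -/
def b0 (M : NQManifold 𝕜) : M.Bar →ₗ[𝕜] M.Bar :=
  DirectSum.toModule 𝕜 ℕ _ fun q =>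
    DirectSum.lof 𝕜 ℕ (fun q => M.BarPart q) q ∘ₗ M.b0Part q

theorem contractNth_update (M : NQManifold 𝕜) {n : ℕ} (i : Fin n)
    (f : Fin (n + 1) → M.Functions) (j : Fin (n + 1)) :
    ∃ (k : Fin n) (g : M.Functions →ₗ[𝕜] M.Functions), ∀ v,
      Fin.contractNth i.castSucc (· * ·) (Function.update f j v) =
        Function.update (Fin.contractNth i.castSucc (· * ·) f) k (g v) := by
  rcases lt_trichotomy (j : ℕ) i with h | h | h
  · refine ⟨⟨j, by omega⟩, LinearMap.id, fun v => funext fun k => ?_⟩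
    by_cases hk : k = ⟨j, by omega⟩
    · subst hk
      simp [Fin.contractNth, h]
    · have h0 : (k : ℕ) ≠ j := fun e => hk (Fin.ext e)
      have h1 : (i : ℕ) ≤ k → k.succ ≠ j := fun e e' => by
        have := congrArg Fin.val e'
        simp at this
        omega
      have h2 : k.castSucc ≠ j := fun e => h0 (congrArg Fin.val e)
      rw [Function.update_of_ne hk]
      simp only [Fin.contractNth, Fin.val_castSucc]
      split_ifs with h3 h4
      · rw [Function.update_of_ne h2]
      · rw [Function.update_of_ne h2, Function.update_of_ne (h1 (by omega))]
      · rw [Function.update_of_ne (h1 (by omega))]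
  · refine ⟨i, LinearMap.mulRight 𝕜 (f i.succ), fun v => funext fun k => ?_⟩
    have hj : j = i.castSucc := Fin.ext h
    subst hj
    by_cases hk : k = i
    · subst hk
      have : k.succ ≠ k.castSucc := fun e => by simpa using congrArg Fin.val e
      simp [Fin.contractNth, Function.update_of_ne this]
    · have h0 : (k : ℕ) ≠ i := fun e => hk (Fin.ext e)
      have h1 : (i : ℕ) ≤ k → k.succ ≠ i.castSucc := fun e e' => by
        have := congrArg Fin.val e'
        simp at this
        omega
      have h2 : k.castSucc ≠ i.castSucc := fun e => h0 (by simpa using congrArg Fin.val e)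
      rw [Function.update_of_ne hk]
      simp only [Fin.contractNth, Fin.val_castSucc]
      split_ifs with h3 h4
      · rw [Function.update_of_ne h2]
      · rw [Function.update_of_ne (h1 (by omega))]
  · rcases Nat.lt_or_ge (i + 1) j with h' | h'
    · refine ⟨⟨j - 1, by omega⟩, LinearMap.id, fun v => funext fun k => ?_⟩
      by_cases hk : k = ⟨j - 1, by omega⟩
      · have h5 : k.succ = j := Fin.ext (by simp [hk]; omega)
        have h6 : (k : ℕ) = j - 1 := congrArg Fin.val hk
        rw [← hk]
        simp only [Fin.contractNth, Fin.val_castSucc]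
        rw [if_neg (by omega), if_neg (by omega), h5]
        simp
      · have h0 : (k : ℕ) ≠ j - 1 := fun e => hk (Fin.ext e)
        have h1 : k.succ ≠ j := fun e => by
          have := congrArg Fin.val e
          simp at this
          omega
        rw [Function.update_of_ne hk]
        simp only [Fin.contractNth, Fin.val_castSucc]
        have h2 : (k : ℕ) ≤ i → k.castSucc ≠ j := fun e e' => by
          have := congrArg Fin.val e'
          simp at this
          omega
        split_ifs with h3 h4
        · rw [Function.update_of_ne (h2 (by omega))]
        · rw [Function.update_of_ne (h2 (by omega)), Function.update_of_ne h1]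
        · rw [Function.update_of_ne h1]
    · refine ⟨i, LinearMap.mulLeft 𝕜 (f i.castSucc), fun v => funext fun k => ?_⟩
      have hj : j = i.succ := Fin.ext (by simp; omega)
      subst hj
      by_cases hk : k = i
      · subst hk
        have : k.castSucc ≠ k.succ := fun e => by simpa using congrArg Fin.val e
        simp [Fin.contractNth, Function.update_of_ne this]
      · have h0 : (k : ℕ) ≠ i := fun e => hk (Fin.ext e)
        have h1 : k.succ ≠ i.succ := fun e => by
          have := congrArg Fin.val e
          simp at this
          omega
        have h2 : (k : ℕ) ≤ i → k.castSucc ≠ i.succ := fun e e' => by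
          have := congrArg Fin.val e'
          simp at this
          omega
        rw [Function.update_of_ne hk]
        simp only [Fin.contractNth, Fin.val_castSucc]
        split_ifs with h3 h4
        · rw [Function.update_of_ne (h2 (by omega))]
        · rw [Function.update_of_ne h1]

/-- The product of the entries at the places `i` and `i + 1`:
`f_0 [f_1 | ⋯] f_{q+2} ↦ f_0 [f_1 | ⋯ | f_i f_{i+1} | ⋯] f_{q+2}`. -/
def merge (M : NQManifold 𝕜) (q : ℕ) (i : Fin (q + 2)) :
    MultilinearMap 𝕜 (fun _ : Fin (q + 3) => M.Functions) (M.BarPart q) where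
  toFun f := PiTensorProduct.tprod 𝕜 (Fin.contractNth i.castSucc (· * ·) f)
  map_update_add' := by
    intro inst f j v w
    obtain rfl : inst = instDecidableEqFin _ := Subsingleton.elim _ _
    obtain ⟨k, g, h⟩ := M.contractNth_update i f j
    rw [h, h, h, map_add, MultilinearMap.map_update_add]
  map_update_smul' := by
    intro inst f j a v
    obtain rfl : inst = instDecidableEqFin _ := Subsingleton.elim _ _
    obtain ⟨k, g, h⟩ := M.contractNth_update i f j
    rw [h, h, map_smul, MultilinearMap.map_update_smul]

/-- `b_1 : B^{-(q+1)} → B^{-q}`,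
`f_0 [f_1 | ⋯ | f_{q+1}] f_{q+2} ↦
  ∑_{0 ≤ i ≤ q} (-1)^{f_0 + (f_1 + 1) + ⋯ + (f_i + 1)} f_0 [⋯ | f_i f_{i+1} | ⋯] f_{q+2}
  - (-1)^{f_0 + (f_1 + 1) + ⋯ + (f_q + 1)} f_0 [f_1 | ⋯ | f_q] f_{q+1} f_{q+2}`
(for `i = 0`, the term is `(-1)^{f_0} f_0 f_1 [f_2 | ⋯ | f_{q+1}] f_{q+2}`). -/
def b1Part (M : NQManifold 𝕜) (q : ℕ) : M.BarPart (q + 1) →ₗ[𝕜] M.BarPart q :=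
  (∑ i : Fin (q + 1), PiTensorProduct.lift
    ((M.merge q i.castSucc).compLinearMap (M.signBefore (i + 1)))) -
  PiTensorProduct.lift ((M.merge q (Fin.last (q + 1))).compLinearMap (M.signBefore (q + 1)))

/-- The differential `b_1`; it is zero on `B^0`. -/
def b1 (M : NQManifold 𝕜) : M.Bar →ₗ[𝕜] M.Bar :=
  DirectSum.toModule 𝕜 ℕ _ fun q => match q with
    | 0 => 0
    | q + 1 => DirectSum.lof 𝕜 ℕ (fun q => M.BarPart q) q ∘ₗ M.b1Part q

/-- The total differential `b = b_0 + b_1`. -/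
def bTotal (M : NQManifold 𝕜) : M.Bar →ₗ[𝕜] M.Bar := M.b0 + M.b1

/-- The insertion `S_i(f)` of a function `f` of degree zero,
`f_0 [f_1 | ⋯ | f_q] f_{q+1} ↦ f_0 [f_1 | ⋯ | f_{i-1} | f | f_i | ⋯ | f_q] f_{q+1}` for
`1 ≤ i ≤ q + 1`, and zero for the other `i`. -/
def insertion (M : NQManifold 𝕜) (i : ℕ) (f : M.Fun 0) : M.Bar →ₗ[𝕜] M.Bar :=
  DirectSum.toModule 𝕜 ℕ _ fun q =>
    if h : 1 ≤ i ∧ i ≤ q + 1 then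
      DirectSum.lof 𝕜 ℕ (fun q => M.BarPart q) (q + 1) ∘ₗ PiTensorProduct.lift
        (MultilinearMap.curryMid (⟨i, by omega⟩ : Fin (q + 3))
          (PiTensorProduct.tprod 𝕜 (s := fun _ : Fin (q + 3) => M.Functions))
          (M.of 0 f))
    else 0

/-- The subspace spanned by the images of the operators `S_i(f)` and
`{S_i(f), b} = S_i(f) b + b S_i(f)`. -/
def degenerate (M : NQManifold 𝕜) : Submodule 𝕜 M.Bar :=
  ⨆ (i : ℕ) (f : M.Fun 0), LinearMap.range (M.insertion i f) ⊔
    LinearMap.range (M.insertion i f ∘ₗ M.bTotal + M.bTotal ∘ₗ M.insertion i f)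

/-- The normalized bar complex. -/
abbrev NormalizedBar (M : NQManifold 𝕜) : Type := M.Bar ⧸ M.degenerate

/-- The class of `f_0 [f_1 | ⋯ | f_q] f_{q+1}` in the normalized bar complex, for homogeneous
functions `f_i` of degree `e i`. -/
def word (M : NQManifold 𝕜) {q : ℕ} (e : Fin (q + 2) → ℤ) (f : ∀ i, M.Fun (e i)) :
    M.NormalizedBar :=
  M.degenerate.mkQ (DirectSum.lof 𝕜 ℕ (fun q => M.BarPart q) q
    (PiTensorProduct.tprod 𝕜 fun i => M.of (e i) (f i)))

end NQManifold

end

noncomputable section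

/-! ### The graded algebra of functions and its differential -/

namespace NManifold

variable {𝕜 : Type} [RCLike 𝕜]

/-! Everything is proved by peeling off the first tensor factor. Write `T_n(w)(t)` (`tailInt`) for
the nested integral of `w = [f_1|⋯|f_n] f_{n+1}` up to the time `t`, with the constant `f_{n+1}(0)`
placed in the innermost integrand. Then `T_{n+1}(f ⊗ w)(t) = ∫_0^t f_θ T_n(w)`, and the iterated
integral of `f_0 ⊗ w` is `f_0(1) T_q(w)(1)`.

Algebra: `b_0` and `b_1` restrict to operators `tailQ` and `tailMul` on such tails. Both satisfy
short recursions in the first factor, and `b² = 0` follows from them by induction on the length. The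
space divided out is stable under `b` for formal reasons.

Chain map: apply the differential `d` of `C^∞(L)` to `∫_0^t f_θ T(w)`. A super-curve satisfies `d
f_θ = ∂_t f - (Qf)_θ`. The second term gives the `Q`-terms of `b_0`. The first is integrated by
parts (`pathIntegral_deriv_zero`, `pathIntegral_deriv_succ`). The boundary term at `t` is `f(t)
T(w)(t)`; the remaining integral of `f · g_θ` joins the boundary term `g` of the next inner
integral, and by the Leibniz rule for `θ` they form the integrand of a product of neighbouring
entries. In the innermost integral the boundary value at `0` multiplies `f_{n+1}(0)`. So `d T(w)` is
`T` of the tail differential plus a boundary term at the upper limit (`tailDiff`, `Q_tailInt`). At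
`t = 1` this boundary term combines with `f_0(1)` into the first product `f_0 f_1` of `b_1`
(`iterDiff_cons`).

Analysis: this needs that `d`, and for naturality the pull-back along a morphism, commute with `∫
dt`. Both are given only algebraically. The Leibniz rule together with cut-off functions and
Hadamard's lemma shows that at a point they depend only on the values and first derivatives of
coefficients in a local frame, and the time integral passes through such a formula
(`IsFirstOrderAt.map_primitive`). Fibres may be infinite dimensional, so integrals and derivatives
are tested with linear functionals; the paths that occur are finite sums of scalar functions times
fixed vectors (`contPaths`), for which these integrals exist.

Descent: for `f` of degree zero, `f_θ` has degree `-1` and vanishes, so the integral kills the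
images of `S_i(f)`. Being a chain map, it kills the anticommutators with `b` as well. -/

theorem lift_of (L : NManifold 𝕜) {V : Type} [AddCommMonoid V] [Module 𝕜 V]
    (g : ∀ n, L.Fun n →ₗ[𝕜] V) (n : ℤ) (f : L.Fun n) : L.lift g (L.of n f) = g n f := by
  have h := DirectSum.toModule_lof 𝕜 (φ := g) n f
  exact h

@[elab_as_elim]
theorem functions_induction {L : NManifold 𝕜} {motive : L.Functions → Prop} (f : L.Functions)
    (zero : motive 0) (of : ∀ n (f : L.Fun n), motive (L.of n f))
    (add : ∀ f g, motive f → motive g → motive (f + g)) : motive f :=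
  DirectSum.induction_on (β := fun n => L.Fun n) f zero of add

theorem of_mul_of (L : NManifold 𝕜) {m n : ℤ} (f : L.Fun m) (g : L.Fun n) :
    L.of m f * L.of n g = L.of (m + n) (L.mul f g) :=
  DirectSum.of_mul_of (A := fun n => L.Fun n) f g

theorem of_congr (L : NManifold 𝕜) {m n : ℤ} (h : m = n) {f : L.Fun m} {g : L.Fun n}
    (hfg : (f : L.Sec) = g) : L.of m f = L.of n g := by
  subst h
  rw [Subtype.ext hfg]

end NManifold

namespace NQManifold

variable {𝕜 : Type} [RCLike 𝕜] (M : NQManifold 𝕜)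

theorem QA_of (n : ℤ) (f : M.Fun n) : M.QA (M.of n f) = M.of (n + 1) (M.Q n f) :=
  M.lift_of _ n f

theorem sgn_of (n : ℤ) (f : M.Fun n) :
    M.sgn (M.of n f) = ((n.negOnePow : ℤ) : 𝕜) • M.of n f :=
  M.lift_of _ n f

theorem negOnePow_cast_mul_self (n : ℤ) :
    ((n.negOnePow : ℤ) : 𝕜) * ((n.negOnePow : ℤ) : 𝕜) = 1 := by
  rw [← Int.cast_mul, ← Units.val_mul, Int.units_mul_self]
  simp

theorem sgn_sgn (f : M.Functions) : M.sgn (M.sgn f) = f := by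
  induction f using NManifold.functions_induction with
  | zero => simp
  | of n f => rw [sgn_of, map_smul, sgn_of, smul_smul, negOnePow_cast_mul_self, one_smul]
  | add f g hf hg => rw [map_add, map_add, hf, hg]

theorem QA_QA (f : M.Functions) : M.QA (M.QA f) = 0 := by
  induction f using NManifold.functions_induction with
  | zero => simp
  | of n f => rw [QA_of, QA_of, M.Q_Q, map_zero]
  | add f g hf hg => rw [map_add, map_add, hf, hg, add_zero]

theorem QA_sgn (f : M.Functions) : M.QA (M.sgn f) = -M.sgn (M.QA f) := by
  induction f using NManifold.functions_induction with
  | zero => simp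
  | of n f =>
    rw [sgn_of, map_smul, QA_of, sgn_of, Int.negOnePow_succ]
    simp
  | add f g hf hg => rw [map_add, map_add, hf, hg, map_add, map_add, neg_add]

theorem sgn_mul (f g : M.Functions) : M.sgn (f * g) = M.sgn f * M.sgn g := by
  induction f using NManifold.functions_induction with
  | zero => simp
  | add f f' hf hf' => rw [add_mul, map_add, map_add, hf, hf', add_mul]
  | of m f =>
    induction g using NManifold.functions_induction with
    | zero => simp
    | add g g' hg hg' => rw [mul_add, map_add, map_add, hg, hg', mul_add]
    | of n g =>
      rw [M.of_mul_of, sgn_of, sgn_of, sgn_of, smul_mul_smul_comm, M.of_mul_of, Int.negOnePow_add]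
      push_cast
      rfl

theorem QA_mul (f g : M.Functions) : M.QA (f * g) = M.QA f * g + M.sgn f * M.QA g := by
  induction f using NManifold.functions_induction with
  | zero => simp
  | add f f' hf hf' => simp only [add_mul, map_add, hf, hf']; abel
  | of m f =>
    induction g using NManifold.functions_induction with
    | zero => simp
    | add g g' hg hg' => simp only [mul_add, map_add, hg, hg']; abel
    | of n g =>
      -- The two Leibniz terms have types of degree `m + 1 + n` and `m + (n + 1)`; both are moved to
      -- degree `m + n + 1`, where they can be added.
      have h1 : (M.mul (M.Q m f) g : M.Sec) ∈ M.Fun (m + n + 1) := by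
        rw [show m + n + 1 = m + 1 + n by ring]
        exact (M.mul (M.Q m f) g).2
      have h2 : (M.mul f (M.Q n g) : M.Sec) ∈ M.Fun (m + n + 1) := by
        rw [add_assoc]
        exact (M.mul f (M.Q n g)).2
      rw [M.of_mul_of, QA_of, QA_of, QA_of, sgn_of, smul_mul_assoc, M.of_mul_of, M.of_mul_of,
        M.of_congr (m := m + 1 + n) (by ring) (g := ⟨_, h1⟩) rfl,
        M.of_congr (m := m + (n + 1)) (by ring) (g := ⟨_, h2⟩) rfl, ← map_smul, ← map_add]
      congr 1
      ext1
      rw [M.Q_mul]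
      simp only [Submodule.coe_add, Submodule.coe_smul, Int.cast_smul_eq_zsmul]
      rfl

/-! ### The tensor powers of the algebra of functions -/

/-- The tensor power `A^{⊗ n}` of `A = C^∞(M)`. -/
abbrev TPow (n : ℕ) : Type := PiTensorProduct 𝕜 fun _ : Fin n => M.Functions

/-- The map `w ↦ f ⊗ w`. -/
def cons (n : ℕ) : M.Functions →ₗ[𝕜] M.TPow n →ₗ[𝕜] M.TPow (n + 1) :=
  (PiTensorProduct.lift : _ ≃ₗ[𝕜] _).toLinearMap ∘ₗ
    (PiTensorProduct.tprod 𝕜 (s := fun _ : Fin (n + 1) => M.Functions)).curryLeft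

theorem cons_tprod {n : ℕ} (f : M.Functions) (v : Fin n → M.Functions) :
    M.cons n f (PiTensorProduct.tprod 𝕜 v) = PiTensorProduct.tprod 𝕜 (Fin.cons f v) := by
  simp [cons]

theorem tPow_hom_ext {n : ℕ} {Y : Type*} [AddCommMonoid Y] [Module 𝕜 Y]
    {g h : M.TPow n →ₗ[𝕜] Y}
    (H : ∀ v, g (PiTensorProduct.tprod 𝕜 v) = h (PiTensorProduct.tprod 𝕜 v)) : g = h :=
  PiTensorProduct.ext (MultilinearMap.ext H)

/-- The elements `f ⊗ w` span `A^{⊗ (n+1)}`, so every identity below can be checked after splitting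
off one factor. -/
theorem tPow_succ_hom_ext {n : ℕ} {Y : Type*} [AddCommMonoid Y] [Module 𝕜 Y]
    {g h : M.TPow (n + 1) →ₗ[𝕜] Y} (H : ∀ f w, g (M.cons n f w) = h (M.cons n f w)) : g = h := by
  refine M.tPow_hom_ext fun v => ?_
  rw [← Fin.cons_self_tail v, ← cons_tprod, H]

/-- The map on `A^{⊗ (n + 1)}` with given values on the elements `f ⊗ w`. -/
def uncons {n : ℕ} {Y : Type*} [AddCommMonoid Y] [Module 𝕜 Y]
    (g : M.Functions →ₗ[𝕜] M.TPow n →ₗ[𝕜] Y) : M.TPow (n + 1) →ₗ[𝕜] Y :=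
  PiTensorProduct.lift (LinearMap.uncurryLeft
    ((PiTensorProduct.lift (s := fun _ : Fin n => M.Functions)).symm.toLinearMap ∘ₗ g))

theorem uncons_cons {n : ℕ} {Y : Type*} [AddCommMonoid Y] [Module 𝕜 Y]
    (g : M.Functions →ₗ[𝕜] M.TPow n →ₗ[𝕜] Y) (f : M.Functions) (w : M.TPow n) :
    M.uncons g (M.cons n f w) = g f w := by
  revert w
  refine LinearMap.congr_fun (f := M.uncons g ∘ₗ M.cons n f) (M.tPow_hom_ext fun v => ?_)
  rw [LinearMap.comp_apply, cons_tprod]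
  simp [uncons]

/-- The map `g ⊗ w ↦ a g ⊗ w`. -/
def mulHead (n : ℕ) (a : M.Functions) : M.TPow (n + 1) →ₗ[𝕜] M.TPow (n + 1) :=
  M.uncons (M.cons n ∘ₗ LinearMap.mulLeft 𝕜 a)

theorem mulHead_cons {n : ℕ} (a f : M.Functions) (w : M.TPow n) :
    M.mulHead n a (M.cons n f w) = M.cons n (a * f) w := by
  simp [mulHead, uncons_cons]

theorem mulHead_neg {n : ℕ} (a : M.Functions) (w : M.TPow (n + 1)) :
    M.mulHead n (-a) w = -M.mulHead n a w := by
  revert w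
  refine LinearMap.congr_fun (g := -M.mulHead n a) (M.tPow_succ_hom_ext fun f w => ?_)
  simp [mulHead_cons]

theorem mulHead_mulHead {n : ℕ} (a b : M.Functions) (w : M.TPow (n + 1)) :
    M.mulHead n a (M.mulHead n b w) = M.mulHead n (a * b) w := by
  revert w
  refine LinearMap.congr_fun (f := M.mulHead n a ∘ₗ M.mulHead n b)
    (M.tPow_succ_hom_ext fun f w => ?_)
  simp [mulHead_cons, mul_assoc]

/-- The product of the entries at the places `i` and `i + 1`. -/
def mergeAt (n : ℕ) (i : Fin n) :
    MultilinearMap 𝕜 (fun _ : Fin (n + 1) => M.Functions) (M.TPow n) where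
  toFun f := PiTensorProduct.tprod 𝕜 (Fin.contractNth i.castSucc (· * ·) f)
  map_update_add' := by
    intro inst f j v w
    obtain rfl : inst = instDecidableEqFin _ := Subsingleton.elim _ _
    obtain ⟨k, g, h⟩ := M.contractNth_update i f j
    rw [h, h, h, map_add, MultilinearMap.map_update_add]
  map_update_smul' := by
    intro inst f j a v
    obtain rfl : inst = instDecidableEqFin _ := Subsingleton.elim _ _
    obtain ⟨k, g, h⟩ := M.contractNth_update i f j
    rw [h, h, map_smul, MultilinearMap.map_update_smul]

theorem mergeAt_apply (n : ℕ) (i : Fin n) (v : Fin (n + 1) → M.Functions) :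
    M.mergeAt n i v = PiTensorProduct.tprod 𝕜 (Fin.contractNth i.castSucc (· * ·) v) := rfl

theorem merge_apply (q : ℕ) (i : Fin (q + 2)) (v : Fin (q + 3) → M.Functions) :
    M.merge q i v = PiTensorProduct.tprod 𝕜 (Fin.contractNth i.castSucc (· * ·) v) := rfl

theorem contractNth_zero_cons_cons {α : Type*} (op : α → α → α) {n : ℕ} (f g : α)
    (v : Fin n → α) :
    Fin.contractNth 0 op (Fin.cons f (Fin.cons g v) : Fin (n + 2) → α) =
      (Fin.cons (op f g) v : Fin (n + 1) → α) := by
  funext k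
  refine Fin.cases ?_ (fun k => ?_) k
  · rw [Fin.contractNth_apply_of_eq _ _ _ _ (by simp)]
    simp
  · rw [Fin.contractNth_apply_of_gt _ _ _ _ (by simp)]
    simp

theorem contractNth_succ_cons {α : Type*} (op : α → α → α) {n : ℕ} (i : Fin (n + 1)) (f : α)
    (v : Fin (n + 1) → α) :
    Fin.contractNth i.succ op (Fin.cons f v : Fin (n + 2) → α) =
      (Fin.cons f (Fin.contractNth i op v) : Fin (n + 1) → α) := by
  funext k
  refine Fin.cases ?_ (fun k => ?_) k
  · rw [Fin.contractNth_apply_of_lt _ _ _ _ (by simp)]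
    simp
  · rw [Fin.cons_succ]
    rcases lt_trichotomy (k : ℕ) i with h | h | h
    · rw [Fin.contractNth_apply_of_lt _ _ _ _ (by simpa using h),
        Fin.contractNth_apply_of_lt _ _ _ _ h, ← Fin.succ_castSucc, Fin.cons_succ]
    · rw [Fin.contractNth_apply_of_eq _ _ _ _ (by simpa using h),
        Fin.contractNth_apply_of_eq _ _ _ _ h, ← Fin.succ_castSucc, Fin.cons_succ, Fin.cons_succ]
    · rw [Fin.contractNth_apply_of_gt _ _ _ _ (by simpa using h),
        Fin.contractNth_apply_of_gt _ _ _ _ h, Fin.cons_succ]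

/-- The sign `(-1)^{∑_{j<p} (f_j + 1)}`, distributed over the entries. -/
def tailSign {n : ℕ} (p : ℕ) (j : Fin n) : M.Functions →ₗ[𝕜] M.Functions :=
  if (j : ℕ) < p then -M.sgn else LinearMap.id

/-- The part of `b_0` that acts on the entries `[f_1 | ⋯ | f_n] f_{n+1}`. -/
def tailQ (n : ℕ) : M.TPow (n + 1) →ₗ[𝕜] M.TPow (n + 1) :=
  ∑ i : Fin (n + 1), (if i = Fin.last n then (1 : 𝕜) else -1) •
    PiTensorProduct.lift ((PiTensorProduct.tprod 𝕜).compLinearMap fun j : Fin (n + 1) =>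
      if j = i then M.QA else M.tailSign i j)

/-- The part of `b_1` that acts on the entries `[f_1 | ⋯ | f_{n+1}] f_{n+2}`. -/
def tailMul (n : ℕ) : M.TPow (n + 2) →ₗ[𝕜] M.TPow (n + 1) :=
  (∑ i : Fin n, PiTensorProduct.lift
    ((M.mergeAt (n + 1) i.castSucc).compLinearMap (M.tailSign (i + 1)))) -
  PiTensorProduct.lift ((M.mergeAt (n + 1) (Fin.last n)).compLinearMap (M.tailSign n))

theorem tailQ_zero_cons (f : M.Functions) (w : M.TPow 0) :
    M.tailQ 0 (M.cons 0 f w) = M.cons 0 (M.QA f) w := by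
  revert w
  refine LinearMap.congr_fun (f := M.tailQ 0 ∘ₗ M.cons 0 f) (M.tPow_hom_ext fun v => ?_)
  simp only [LinearMap.comp_apply, cons_tprod, tailQ]
  simp
  congr 1
  funext j
  fin_cases j
  simp

theorem tailSign_comp_cons {n : ℕ} (p : ℕ) (f : M.Functions) (v : Fin n → M.Functions) :
    (fun j : Fin (n + 1) => M.tailSign (p + 1) j ((Fin.cons f v : Fin (n + 1) → M.Functions) j)) =
      Fin.cons (-M.sgn f) fun j => M.tailSign p j (v j) := by
  funext j
  refine Fin.cases ?_ (fun j => ?_) j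
  · simp [tailSign]
  · simp [tailSign]

theorem tailSign_zero {n : ℕ} (v : Fin n → M.Functions) :
    (fun j : Fin n => M.tailSign 0 j (v j)) = v := by
  funext j
  simp [tailSign]

/-- With the next lemmas on `tailMul`, this recursion replaces the explicit signed sums. An entry
between the bars counts with degree shifted by one, so moving past it costs `-(-1)^f`; this explains
the minus sign in both terms. -/
theorem tailQ_succ_cons {n : ℕ} (f : M.Functions) (w : M.TPow (n + 1)) :
    M.tailQ (n + 1) (M.cons (n + 1) f w) =
      -M.cons (n + 1) (M.QA f) w - M.cons (n + 1) (M.sgn f) (M.tailQ n w) := by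
  revert w
  refine LinearMap.congr_fun (f := M.tailQ (n + 1) ∘ₗ M.cons (n + 1) f)
    (g := -M.cons (n + 1) (M.QA f) - M.cons (n + 1) (M.sgn f) ∘ₗ M.tailQ n)
    (M.tPow_hom_ext fun v => ?_)
  simp only [LinearMap.comp_apply, LinearMap.sub_apply, LinearMap.neg_apply, cons_tprod]
  conv_lhs => rw [tailQ]
  simp only [LinearMap.sum_apply, LinearMap.smul_apply, PiTensorProduct.lift.tprod,
    MultilinearMap.compLinearMap_apply]
  rw [Fin.sum_univ_succ, sub_eq_add_neg]
  congr 1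
  · rw [if_neg (by simp [Fin.ext_iff]), neg_smul, one_smul]
    congr 2
    funext j
    refine Fin.cases ?_ (fun j => ?_) j
    · simp
    · simp [tailSign]
  · rw [← LinearMap.neg_apply, ← map_neg, tailQ]
    simp only [LinearMap.sum_apply, LinearMap.smul_apply, PiTensorProduct.lift.tprod,
      MultilinearMap.compLinearMap_apply, map_sum, map_smul, cons_tprod]
    refine Finset.sum_congr rfl fun i _ => ?_
    congr 1
    · simp [← Fin.succ_last]
    · congr 1
      funext j
      refine Fin.cases ?_ (fun j => ?_) j
      · simp [tailSign, (Fin.succ_ne_zero i).symm]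
      · simp [tailSign]

theorem tailMul_zero_cons (f : M.Functions) (w : M.TPow 1) :
    M.tailMul 0 (M.cons 1 f w) = -M.mulHead 0 f w := by
  revert w
  refine LinearMap.congr_fun (f := M.tailMul 0 ∘ₗ M.cons 1 f) (g := -M.mulHead 0 f)
    (M.tPow_succ_hom_ext fun g w => ?_)
  simp only [LinearMap.comp_apply, LinearMap.neg_apply, mulHead_cons]
  revert w
  refine LinearMap.congr_fun (f := M.tailMul 0 ∘ₗ M.cons 1 f ∘ₗ M.cons 0 g)
    (g := -M.cons 0 (f * g)) (M.tPow_hom_ext fun v => ?_)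
  simp only [LinearMap.comp_apply, LinearMap.neg_apply, cons_tprod, tailMul,
    Finset.univ_eq_empty, Finset.sum_empty, zero_sub,
    PiTensorProduct.lift.tprod, MultilinearMap.compLinearMap_apply, tailSign_zero, mergeAt_apply]
  congr 2
  exact contractNth_zero_cons_cons _ f g v

theorem mulHead_tprod_cons {n : ℕ} (f : M.Functions) (v : Fin (n + 1) → M.Functions) :
    M.mulHead n f (PiTensorProduct.tprod 𝕜 v) =
      M.mergeAt (n + 1) 0 (Fin.cons f v : Fin (n + 2) → M.Functions) := by
  rw [← Fin.cons_self_tail v, ← cons_tprod, mulHead_cons, cons_tprod, mergeAt_apply]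
  congr 1
  exact (contractNth_zero_cons_cons _ _ _ _).symm

theorem mergeAt_succ_cons {n : ℕ} (i : Fin (n + 1)) (f : M.Functions)
    (v : Fin (n + 2) → M.Functions) :
    M.mergeAt (n + 2) i.succ (Fin.cons f v : Fin (n + 3) → M.Functions) =
      M.cons (n + 1) f (M.mergeAt (n + 1) i v) := by
  rw [mergeAt_apply, mergeAt_apply, cons_tprod, ← Fin.succ_castSucc, contractNth_succ_cons]

/-- The first product is the only one that involves `f` nontrivially; all others act on `w` and pick
up the sign of passing `f`. -/
theorem tailMul_succ_cons {n : ℕ} (f : M.Functions) (w : M.TPow (n + 2)) :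
    M.tailMul (n + 1) (M.cons (n + 2) f w) =
      -M.mulHead (n + 1) (M.sgn f) w - M.cons (n + 1) (M.sgn f) (M.tailMul n w) := by
  revert w
  refine LinearMap.congr_fun (f := M.tailMul (n + 1) ∘ₗ M.cons (n + 2) f)
    (g := -M.mulHead (n + 1) (M.sgn f) - M.cons (n + 1) (M.sgn f) ∘ₗ M.tailMul n)
    (M.tPow_hom_ext fun v => ?_)
  simp only [LinearMap.comp_apply, LinearMap.sub_apply, LinearMap.neg_apply, cons_tprod]
  conv_lhs => rw [tailMul]
  simp only [LinearMap.sum_apply, LinearMap.sub_apply, PiTensorProduct.lift.tprod,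
    MultilinearMap.compLinearMap_apply, tailSign_comp_cons]
  rw [Fin.sum_univ_succ, add_sub_assoc, sub_eq_add_neg (-_)]
  congr 1
  · rw [← mulHead_neg, mulHead_tprod_cons]
    simp only [Fin.coe_ofNat_eq_mod, Nat.zero_mod, tailSign_zero]
    rfl
  · have h : ∀ y, -M.cons (n + 1) (M.sgn f) y = M.cons (n + 1) (-M.sgn f) y := by simp
    rw [h, tailMul]
    simp only [LinearMap.sum_apply, LinearMap.sub_apply, PiTensorProduct.lift.tprod,
      MultilinearMap.compLinearMap_apply, map_sum, map_sub, ← mergeAt_succ_cons,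
      Fin.val_succ, Fin.succ_castSucc, Fin.succ_last]

theorem tailQ_mulHead_zero (a : M.Functions) (w : M.TPow 1) :
    M.tailQ 0 (M.mulHead 0 a w) = M.mulHead 0 (M.QA a) w + M.mulHead 0 (M.sgn a) (M.tailQ 0 w) := by
  revert w
  refine LinearMap.congr_fun (f := M.tailQ 0 ∘ₗ M.mulHead 0 a)
    (g := M.mulHead 0 (M.QA a) + M.mulHead 0 (M.sgn a) ∘ₗ M.tailQ 0)
    (M.tPow_succ_hom_ext fun f w => ?_)
  simp [mulHead_cons, tailQ_zero_cons, QA_mul]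

/-- This is the Leibniz rule in the first entry. Unlike in length one, that entry now lies between
the bars, where `Q` acts with a minus sign. -/
theorem tailQ_mulHead_succ {n : ℕ} (a : M.Functions) (w : M.TPow (n + 2)) :
    M.tailQ (n + 1) (M.mulHead (n + 1) a w) =
      -M.mulHead (n + 1) (M.QA a) w + M.mulHead (n + 1) (M.sgn a) (M.tailQ (n + 1) w) := by
  revert w
  refine LinearMap.congr_fun (f := M.tailQ (n + 1) ∘ₗ M.mulHead (n + 1) a)
    (g := -M.mulHead (n + 1) (M.QA a) + M.mulHead (n + 1) (M.sgn a) ∘ₗ M.tailQ (n + 1))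
    (M.tPow_succ_hom_ext fun f w => ?_)
  simp [mulHead_cons, tailQ_succ_cons, QA_mul, sgn_mul]
  abel

/-- No sign appears, since the sign of the last product stops before the left factor of this
product. -/
theorem tailMul_mulHead_zero (a : M.Functions) (w : M.TPow 2) :
    M.tailMul 0 (M.mulHead 1 a w) = M.mulHead 0 a (M.tailMul 0 w) := by
  revert w
  refine LinearMap.congr_fun (f := M.tailMul 0 ∘ₗ M.mulHead 1 a)
    (g := M.mulHead 0 a ∘ₗ M.tailMul 0) (M.tPow_succ_hom_ext fun f w => ?_)
  simp [mulHead_cons, tailMul_zero_cons, mulHead_mulHead]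

theorem tailMul_mulHead_succ {n : ℕ} (a : M.Functions) (w : M.TPow (n + 3)) :
    M.tailMul (n + 1) (M.mulHead (n + 2) a w) =
      M.mulHead (n + 1) (M.sgn a) (M.tailMul (n + 1) w) := by
  revert w
  refine LinearMap.congr_fun (f := M.tailMul (n + 1) ∘ₗ M.mulHead (n + 2) a)
    (g := M.mulHead (n + 1) (M.sgn a) ∘ₗ M.tailMul (n + 1)) (M.tPow_succ_hom_ext fun f w => ?_)
  simp [mulHead_cons, tailMul_succ_cons, mulHead_mulHead, sgn_mul]

theorem tailQ_tailQ (n : ℕ) (w : M.TPow (n + 1)) : M.tailQ n (M.tailQ n w) = 0 := by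
  induction n with
  | zero =>
    revert w
    refine LinearMap.congr_fun (f := M.tailQ 0 ∘ₗ M.tailQ 0) (g := 0)
      (M.tPow_succ_hom_ext fun f w => ?_)
    simp [tailQ_zero_cons, QA_QA]
  | succ n ih =>
    revert w
    refine LinearMap.congr_fun (f := M.tailQ (n + 1) ∘ₗ M.tailQ (n + 1)) (g := 0)
      (M.tPow_succ_hom_ext fun f w => ?_)
    simp [tailQ_succ_cons, QA_QA, QA_sgn, ih]

theorem tailQ_tailMul (n : ℕ) (w : M.TPow (n + 2)) :
    M.tailQ n (M.tailMul n w) + M.tailMul n (M.tailQ (n + 1) w) = 0 := by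
  induction n with
  | zero =>
    revert w
    refine LinearMap.congr_fun (f := M.tailQ 0 ∘ₗ M.tailMul 0 + M.tailMul 0 ∘ₗ M.tailQ 1) (g := 0)
      (M.tPow_succ_hom_ext fun f w => ?_)
    simp [tailQ_succ_cons, tailMul_zero_cons, tailQ_mulHead_zero]
  | succ n ih =>
    revert w
    refine LinearMap.congr_fun (f := M.tailQ (n + 1) ∘ₗ M.tailMul (n + 1) +
      M.tailMul (n + 1) ∘ₗ M.tailQ (n + 2)) (g := 0) (M.tPow_succ_hom_ext fun f w => ?_)
    have h := eq_neg_of_add_eq_zero_left (ih w)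
    simp [tailQ_succ_cons (n := n), tailQ_succ_cons (n := n + 1), tailMul_succ_cons, sgn_sgn,
      tailQ_mulHead_succ, QA_sgn, mulHead_neg, h]
    abel

/-- Associativity makes the two ways of multiplying three neighbouring entries cancel, and disjoint
products cancel by the signs; the recursion reduces both to `mulHead_mulHead` and the induction
hypothesis. -/
theorem tailMul_tailMul (n : ℕ) (w : M.TPow (n + 3)) :
    M.tailMul n (M.tailMul (n + 1) w) = 0 := by
  induction n with
  | zero =>
    revert w
    refine LinearMap.congr_fun (f := M.tailMul 0 ∘ₗ M.tailMul 1) (g := 0)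
      (M.tPow_succ_hom_ext fun f w => ?_)
    simp [tailMul_succ_cons, tailMul_zero_cons, tailMul_mulHead_zero]
  | succ n ih =>
    revert w
    refine LinearMap.congr_fun (f := M.tailMul (n + 1) ∘ₗ M.tailMul (n + 2)) (g := 0)
      (M.tPow_succ_hom_ext fun f w => ?_)
    simp [tailMul_succ_cons (n := n + 1), tailMul_succ_cons (n := n), tailMul_mulHead_succ,
      sgn_sgn, ih]

/-! ### The bar differential -/

theorem signBefore_comp_cons {n : ℕ} (p : ℕ) (f : M.Functions) (v : Fin n → M.Functions) :
    (fun j : Fin (n + 1) => M.signBefore (p + 1) j ((Fin.cons f v : Fin (n + 1) → M.Functions) j)) =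
      Fin.cons (M.sgn f) fun j => M.tailSign p j (v j) := by
  funext j
  refine Fin.cases ?_ (fun j => ?_) j
  · simp [signBefore, entrySgn]
  · simp [signBefore, entrySgn, tailSign]

theorem b0Part_cons {q : ℕ} (f : M.Functions) (w : M.TPow (q + 1)) :
    M.b0Part q (M.cons (q + 1) f w) =
      M.cons (q + 1) (M.QA f) w + M.cons (q + 1) (M.sgn f) (M.tailQ q w) := by
  revert w
  refine LinearMap.congr_fun (f := M.b0Part q ∘ₗ M.cons (q + 1) f)
    (g := M.cons (q + 1) (M.QA f) + M.cons (q + 1) (M.sgn f) ∘ₗ M.tailQ q)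
    (M.tPow_hom_ext fun v => ?_)
  simp only [LinearMap.comp_apply, LinearMap.add_apply, cons_tprod]
  conv_lhs => rw [b0Part]
  simp only [LinearMap.sum_apply, LinearMap.smul_apply, PiTensorProduct.lift.tprod,
    MultilinearMap.compLinearMap_apply]
  rw [Fin.sum_univ_succ]
  congr 1
  · rw [if_pos (Or.inl rfl), one_smul]
    congr 1
    funext j
    refine Fin.cases ?_ (fun j => ?_) j
    · simp
    · simp [signBefore]
  · rw [tailQ]
    simp only [LinearMap.sum_apply, LinearMap.smul_apply, PiTensorProduct.lift.tprod,
      MultilinearMap.compLinearMap_apply, map_sum, map_smul, cons_tprod]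
    refine Finset.sum_congr rfl fun i _ => ?_
    congr 1
    · simp [← Fin.succ_last]
    · congr 1
      funext j
      refine Fin.cases ?_ (fun j => ?_) j
      · simp [signBefore, entrySgn, (Fin.succ_ne_zero i).symm]
      · simp [signBefore, entrySgn, tailSign]

theorem b1Part_cons {q : ℕ} (f : M.Functions) (w : M.TPow (q + 2)) :
    M.b1Part q (M.cons (q + 2) f w) =
      M.mulHead (q + 1) (M.sgn f) w + M.cons (q + 1) (M.sgn f) (M.tailMul q w) := by
  revert w
  refine LinearMap.congr_fun (f := M.b1Part q ∘ₗ M.cons (q + 2) f)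
    (g := M.mulHead (q + 1) (M.sgn f) + M.cons (q + 1) (M.sgn f) ∘ₗ M.tailMul q)
    (M.tPow_hom_ext fun v => ?_)
  simp only [LinearMap.comp_apply, LinearMap.add_apply, cons_tprod]
  conv_lhs => rw [b1Part]
  simp only [LinearMap.sum_apply, LinearMap.sub_apply, PiTensorProduct.lift.tprod,
    MultilinearMap.compLinearMap_apply, signBefore_comp_cons]
  rw [Fin.sum_univ_succ, add_sub_assoc]
  congr 1
  · rw [mulHead_tprod_cons]
    simp only [Fin.coe_ofNat_eq_mod, Nat.zero_mod, tailSign_zero]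
    rfl
  · rw [tailMul]
    simp only [LinearMap.sum_apply, LinearMap.sub_apply, PiTensorProduct.lift.tprod,
      MultilinearMap.compLinearMap_apply, map_sum, map_sub, ← mergeAt_succ_cons,
      Fin.val_succ, Fin.succ_castSucc, Fin.succ_last]
    rfl

/-- The entry `f_0` counts with its own degree, an entry between the bars with its degree plus one.
Treating `f_0` as one more entry between the bars therefore changes only a global sign, and `b² = 0`
is inherited from the tail operators. -/
theorem b0Part_eq (q : ℕ) : M.b0Part q = -M.tailQ (q + 1) :=
  M.tPow_succ_hom_ext fun f w => by
    rw [b0Part_cons, LinearMap.neg_apply, tailQ_succ_cons]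
    abel

theorem b1Part_eq (q : ℕ) : M.b1Part q = -M.tailMul (q + 1) :=
  M.tPow_succ_hom_ext fun f w => by
    rw [b1Part_cons, LinearMap.neg_apply, tailMul_succ_cons]
    abel

theorem bTotal_lof_zero (w : M.BarPart 0) :
    M.bTotal (DirectSum.lof 𝕜 ℕ M.BarPart 0 w) = DirectSum.lof 𝕜 ℕ M.BarPart 0 (M.b0Part 0 w) := by
  simp [bTotal, b0, b1, DirectSum.toModule_lof]

theorem bTotal_lof_succ (q : ℕ) (w : M.BarPart (q + 1)) :
    M.bTotal (DirectSum.lof 𝕜 ℕ M.BarPart (q + 1) w) =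
      DirectSum.lof 𝕜 ℕ M.BarPart (q + 1) (M.b0Part (q + 1) w) +
        DirectSum.lof 𝕜 ℕ M.BarPart q (M.b1Part q w) := by
  simp [bTotal, b0, b1, DirectSum.toModule_lof]

theorem bTotal_bTotal : M.bTotal ∘ₗ M.bTotal = 0 := by
  refine DirectSum.linearMap_ext 𝕜 fun q => LinearMap.ext fun w => ?_
  simp only [LinearMap.comp_apply, LinearMap.zero_apply]
  have h0 : ∀ q (w : M.BarPart q), M.b0Part q (M.b0Part q w) = 0 := fun q w => by
    simp [b0Part_eq, tailQ_tailQ]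
  have h01 : ∀ q (w : M.BarPart (q + 1)),
      M.b0Part q (M.b1Part q w) = - M.b1Part q (M.b0Part (q + 1) w) := fun q w => by
    simpa [b0Part_eq, b1Part_eq] using eq_neg_of_add_eq_zero_left (M.tailQ_tailMul (q + 1) w)
  have h1 : ∀ q (w : M.BarPart (q + 2)), M.b1Part q (M.b1Part (q + 1) w) = 0 := fun q w => by
    simp [b1Part_eq, tailMul_tailMul]
  rcases q with _ | _ | q
  · simp [bTotal_lof_zero, h0]
  · simp [bTotal_lof_zero, bTotal_lof_succ, h0, h01]
  · simp [bTotal_lof_succ, h0, h01, h1]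

end NQManifold

/-! ## Paths in algebras and their integrals -/

section Paths

variable (𝕜 : Type) [RCLike 𝕜] (V : Type) [Ring V] [Algebra 𝕜 V]

/-- The paths in `V` that are sums of products of continuous functions and constant vectors. -/
def contPaths : Subalgebra 𝕜 (unitInterval → V) :=
  (Submodule.span 𝕜 {g : unitInterval → V | ∃ c : unitInterval → 𝕜, Continuous c ∧
    ∃ v : V, g = fun t => c t • v}).toSubalgebra
    (Submodule.subset_span ⟨fun _ => 1, continuous_const, 1, by simp; rfl⟩) (by
      intro g h hg hh
      have H := Submodule.mul_mem_mul hg hh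
      rw [Submodule.span_mul_span] at H
      refine Submodule.span_mono ?_ H
      rintro _ ⟨_, ⟨c, hc, v, rfl⟩, _, ⟨c', hc', v', rfl⟩, rfl⟩
      exact ⟨fun t => c t * c' t, hc.mul hc', v * v', funext fun t => smul_mul_smul_comm _ _ _ _⟩)

variable {𝕜 V}

theorem smul_mem_contPaths {c : unitInterval → 𝕜} (hc : Continuous c) (v : V) :
    (fun t => c t • v) ∈ contPaths 𝕜 V :=
  Submodule.subset_span ⟨c, hc, v, rfl⟩

theorem const_mem_contPaths (v : V) : (fun _ => v) ∈ contPaths 𝕜 V := by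
  simpa using smul_mem_contPaths (𝕜 := 𝕜) (c := fun _ => 1) continuous_const v

theorem contPaths_induction {motive : (unitInterval → V) → Prop}
    (smul : ∀ (c : unitInterval → 𝕜) (_ : Continuous c) (v : V), motive fun t => c t • v)
    (add : ∀ g h, g ∈ contPaths 𝕜 V → h ∈ contPaths 𝕜 V → motive g → motive h → motive (g + h))
    {g : unitInterval → V} (hg : g ∈ contPaths 𝕜 V) : motive g := by
  -- The given closure properties do not include scalar multiples; strengthening the claim to all
  -- multiples lets the induction on the span go through.
  suffices H : ∀ a : 𝕜, motive (a • g) by simpa using H 1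
  refine Submodule.span_induction (p := fun g _ => ∀ a : 𝕜, motive (a • g)) ?_ ?_ ?_ ?_
    (show g ∈ Subalgebra.toSubmodule (contPaths 𝕜 V) from hg)
  · rintro _ ⟨c, hc, v, rfl⟩ a
    convert smul c hc (a • v) using 1
    funext t
    exact smul_comm _ _ _
  · intro a
    convert smul (fun _ => 0) continuous_const (0 : V)
    simp
  · intro g h hg hh ihg ihh a
    rw [smul_add]
    exact add _ _ (Subalgebra.smul_mem _ hg a) (Subalgebra.smul_mem _ hh a) (ihg a) (ihh a)
  · intro a g _ ih a'
    rw [smul_smul]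
    exact ih _

theorem continuous_dual_contPaths {g : unitInterval → V} (hg : g ∈ contPaths 𝕜 V)
    (l : Module.Dual 𝕜 V) : Continuous fun t => l (g t) := by
  refine contPaths_induction (motive := fun g => Continuous fun t => l (g t)) ?_ ?_ hg
  · intro c hc v
    simp only [map_smul, smul_eq_mul]
    exact hc.mul continuous_const
  · intro g h _ _ hg hh
    simp only [Pi.add_apply, map_add]
    exact hg.add hh

/-- For `c(t) v` the integral is `(∫ c) v`. It is again a continuous scalar function times a vector,
so iterating the integral stays inside `contPaths`. -/
theorem exists_integral_contPaths {g : unitInterval → V} (hg : g ∈ contPaths 𝕜 V) :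
    ∃ h ∈ contPaths 𝕜 V, ∀ (t : unitInterval) (l : Module.Dual 𝕜 V),
      l (h t) = ∫ s in (0 : ℝ)..t, l (g (Set.projIcc 0 1 zero_le_one s)) := by
  refine contPaths_induction (motive := fun g => ∃ h ∈ contPaths 𝕜 V,
    ∀ (t : unitInterval) (l : Module.Dual 𝕜 V),
      l (h t) = ∫ s in (0 : ℝ)..t, l (g (Set.projIcc 0 1 zero_le_one s))) ?_ ?_ hg
  · intro c hc v
    refine ⟨fun t => (∫ s in (0 : ℝ)..t, c (Set.projIcc 0 1 zero_le_one s)) • v,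
      smul_mem_contPaths ?_ v, fun t l => ?_⟩
    · exact (intervalIntegral.continuous_primitive (fun a b =>
        (hc.comp continuous_projIcc).intervalIntegrable a b) 0).comp continuous_subtype_val
    · simp only [map_smul, smul_eq_mul]
      rw [intervalIntegral.integral_mul_const]
  · rintro g g' hg hg' ⟨h, hh, H⟩ ⟨h', hh', H'⟩
    refine ⟨h + h', add_mem hh hh', fun t l => ?_⟩
    simp only [Pi.add_apply, map_add, H, H']
    exact (intervalIntegral.integral_add
      (((continuous_dual_contPaths hg l).comp continuous_projIcc).intervalIntegrable _ _)
      (((continuous_dual_contPaths hg' l).comp continuous_projIcc).intervalIntegrable _ _)).symm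

theorem eq_of_forall_dual {v w : V} (h : ∀ l : Module.Dual 𝕜 V, l v = l w) : v = w := by
  rw [← sub_eq_zero, ← Module.forall_dual_apply_eq_zero_iff 𝕜]
  intro l
  rw [map_sub, h, sub_self]

namespace NManifold

theorem dual_fiberIntegral {g : unitInterval → V} (hg : g ∈ contPaths 𝕜 V) (t : unitInterval)
    (l : Module.Dual 𝕜 V) :
    l (fiberIntegral 𝕜 g t) = ∫ s in (0 : ℝ)..t, l (g (Set.projIcc 0 1 zero_le_one s)) := by
  obtain ⟨h, _, H⟩ := exists_integral_contPaths hg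
  have : ∃ v : V, ∀ l : Module.Dual 𝕜 V,
      l v = ∫ s in (0 : ℝ)..t, l (g (Set.projIcc 0 1 zero_le_one s)) := ⟨h t, H t⟩
  rw [fiberIntegral, dif_pos this]
  exact this.choose_spec l

theorem fiberIntegral_eq {g : unitInterval → V} (hg : g ∈ contPaths 𝕜 V) {t : unitInterval}
    {v : V} (h : ∀ l : Module.Dual 𝕜 V,
      l v = ∫ s in (0 : ℝ)..t, l (g (Set.projIcc 0 1 zero_le_one s))) :
    fiberIntegral 𝕜 g t = v :=
  eq_of_forall_dual fun l => by rw [dual_fiberIntegral hg, h]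

theorem fiberIntegral_mem {g : unitInterval → V} (hg : g ∈ contPaths 𝕜 V) :
    fiberIntegral 𝕜 g ∈ contPaths 𝕜 V := by
  obtain ⟨h, hh, H⟩ := exists_integral_contPaths hg
  rwa [show fiberIntegral 𝕜 g = h from funext fun t => fiberIntegral_eq hg (H t)]

theorem fiberIntegral_add {g h : unitInterval → V} (hg : g ∈ contPaths 𝕜 V)
    (hh : h ∈ contPaths 𝕜 V) (t : unitInterval) :
    fiberIntegral 𝕜 (g + h) t = fiberIntegral 𝕜 g t + fiberIntegral 𝕜 h t := by
  refine fiberIntegral_eq (add_mem hg hh) fun l => ?_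
  rw [map_add, dual_fiberIntegral hg, dual_fiberIntegral hh]
  simp only [Pi.add_apply, map_add]
  exact (intervalIntegral.integral_add
      (((continuous_dual_contPaths hg l).comp continuous_projIcc).intervalIntegrable _ _)
      (((continuous_dual_contPaths hh l).comp continuous_projIcc).intervalIntegrable _ _)).symm

theorem fiberIntegral_comp {W : Type} [Ring W] [Algebra 𝕜 W] {g : unitInterval → V}
    (hg : g ∈ contPaths 𝕜 V) (p : V →ₗ[𝕜] W) (hpg : (fun t => p (g t)) ∈ contPaths 𝕜 W)
    (t : unitInterval) : fiberIntegral 𝕜 (fun t => p (g t)) t = p (fiberIntegral 𝕜 g t) :=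
  fiberIntegral_eq hpg fun l => dual_fiberIntegral hg t (l ∘ₗ p)

theorem comp_mem_contPaths {W : Type} [Ring W] [Algebra 𝕜 W] {g : unitInterval → V}
    (hg : g ∈ contPaths 𝕜 V) (p : V →ₗ[𝕜] W) : (fun t => p (g t)) ∈ contPaths 𝕜 W := by
  refine contPaths_induction (motive := fun g => (fun t => p (g t)) ∈ contPaths 𝕜 W) ?_ ?_ hg
  · intro c hc v
    simpa using smul_mem_contPaths hc (p v)
  · intro g h _ _ hg hh
    simp only [Pi.add_apply, map_add]
    exact add_mem hg hh

/-- The integral, as an operator on the continuous paths. -/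
def pathIntegral : contPaths 𝕜 V →ₗ[𝕜] contPaths 𝕜 V where
  toFun g := ⟨fiberIntegral 𝕜 g, fiberIntegral_mem g.2⟩
  map_add' g h := Subtype.ext (funext fun t => fiberIntegral_add g.2 h.2 t)
  map_smul' a g := Subtype.ext (funext fun t =>
    fiberIntegral_comp g.2 (a • LinearMap.id) (comp_mem_contPaths g.2 _) t)

theorem pathIntegral_apply (g : contPaths 𝕜 V) (t : unitInterval) :
    (pathIntegral g : unitInterval → V) t = fiberIntegral 𝕜 g t := rfl

theorem fiberIntegral_zero (g : unitInterval → V) (hg : g ∈ contPaths 𝕜 V) :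
    fiberIntegral 𝕜 g 0 = 0 :=
  fiberIntegral_eq hg fun l => by simp

/-- `b'` is the derivative of `b`, tested with the linear functionals. -/
def HasPathDeriv (𝕜 : Type) [RCLike 𝕜] {V : Type} [Ring V] [Algebra 𝕜 V]
    (b b' : unitInterval → V) : Prop :=
  ∀ (l : Module.Dual 𝕜 V) (t : unitInterval),
    HasDerivWithinAt (fun s : ℝ => l (b (Set.projIcc 0 1 zero_le_one s))) (l (b' t))
      (Set.Icc 0 1) (t : ℝ)

/-- The fundamental theorem of calculus, applied to each scalar function `l ∘ b`. -/
theorem fiberIntegral_deriv {b b' : unitInterval → V} (h : HasPathDeriv 𝕜 b b')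
    (hb' : b' ∈ contPaths 𝕜 V) (t : unitInterval) : fiberIntegral 𝕜 b' t = b t - b 0 := by
  refine fiberIntegral_eq hb' fun l => ?_
  rw [intervalIntegral.integral_eq_sub_of_hasDeriv_right_of_le
    (f := fun s : ℝ => l (b (Set.projIcc 0 1 zero_le_one s))) t.2.1]
  · simp
  · intro s hs
    exact ((h l ⟨s, hs.1, hs.2.trans t.2.2⟩).continuousWithinAt).mono
      (Set.Icc_subset_Icc_right t.2.2)
  · intro s hs
    have hs' : s ∈ Set.Icc (0 : ℝ) 1 := ⟨hs.1.le, hs.2.le.trans t.2.2⟩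
    rw [Set.projIcc_of_mem _ hs']
    exact (h l ⟨s, hs'⟩).hasDerivAt (Icc_mem_nhds hs.1 (hs.2.trans_le t.2.2)) |>.hasDerivWithinAt
  · exact ((continuous_dual_contPaths hb' l).comp continuous_projIcc).intervalIntegrable _ _

/-- Both sides are additive in `k`, so `k = c v` suffices. There `l(b · (∫ c) v) = (∫ c) · l(b v)`,
and the scalar product rule applies to the functional `l(· v)`. No product rule for general paths is
needed. -/
theorem HasPathDeriv.mul_integral {b b' k : unitInterval → V} (h : HasPathDeriv 𝕜 b b')
    (hk : k ∈ contPaths 𝕜 V) :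
    HasPathDeriv 𝕜 (b * fiberIntegral 𝕜 k) (b' * fiberIntegral 𝕜 k + b * k) := by
  refine contPaths_induction (motive := fun k => 
    HasPathDeriv 𝕜 (b * fiberIntegral 𝕜 k) (b' * fiberIntegral 𝕜 k + b * k)) ?_ ?_ hk
  · intro c hc v l t
    have hC : ∀ t : unitInterval, fiberIntegral 𝕜 (fun t => c t • v) t =
        (∫ s in (0 : ℝ)..t, c (Set.projIcc 0 1 zero_le_one s)) • v := fun t =>
      fiberIntegral_eq (smul_mem_contPaths hc v) fun l => by
        simp only [map_smul, smul_eq_mul]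
        rw [intervalIntegral.integral_mul_const]
    have h1 : HasDerivWithinAt (fun r : ℝ => ∫ s in (0 : ℝ)..r, c (Set.projIcc 0 1 zero_le_one s))
        (c t) (Set.Icc 0 1) t := by
      have h3 : Continuous fun s : ℝ => c (Set.projIcc 0 1 zero_le_one s) :=
        hc.comp continuous_projIcc
      have h4 := (h3.integral_hasStrictDerivAt 0 (t : ℝ)).hasDerivAt.hasDerivWithinAt
        (s := Set.Icc 0 1)
      simpa using h4
    have h2 := (h (l ∘ₗ LinearMap.mulRight 𝕜 v) t).mul h1
    refine (h2.congr_deriv ?_).congr_of_mem ?_ t.2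
    · simp [hC]
      ring
    · intro s hs
      simp [hC, Set.projIcc_of_mem _ hs]
      ring
  · intro k k' hk hk' H H' l t
    have : fiberIntegral 𝕜 (k + k') = fiberIntegral 𝕜 k + fiberIntegral 𝕜 k' :=
      funext fun t => fiberIntegral_add hk hk' t
    rw [this]
    refine ((H l t).add (H' l t)).congr_deriv ?_ |>.congr_of_mem ?_ t.2
    · simp [mul_add]
      ring
    · intro s hs
      simp [mul_add]

/-- There is no boundary term at `0`, because the inner integral vanishes there. -/
theorem fiberIntegral_by_parts {b b' k : unitInterval → V} (h : HasPathDeriv 𝕜 b b')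
    (hb : b ∈ contPaths 𝕜 V) (hb' : b' ∈ contPaths 𝕜 V) (hk : k ∈ contPaths 𝕜 V)
    (t : unitInterval) :
    fiberIntegral 𝕜 (b' * fiberIntegral 𝕜 k) t =
      b t * fiberIntegral 𝕜 k t - fiberIntegral 𝕜 (b * k) t := by
  have h1 := mul_mem hb' (fiberIntegral_mem hk)
  have h2 := fiberIntegral_deriv (h.mul_integral hk) (add_mem h1 (mul_mem hb hk)) t
  rw [fiberIntegral_add h1 (mul_mem hb hk)] at h2
  rw [eq_sub_iff_add_eq, h2, Pi.mul_apply, Pi.mul_apply, fiberIntegral_zero k hk, mul_zero,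
    sub_zero]

end NManifold

end Paths

/-! ## Smooth functions with parameters -/

section Parametric

variable {F : Type} [NormedAddCommGroup F] [NormedSpace ℝ F]

-- The integral is the value at `0` of the convolution of the indicator of `(0,1]` with `u ↦ χ(u)
-- g(p,-u)`. The bump function `χ` is `1` on `[-1,1]`, so it does not change the integral, and it
-- supplies the compact support under which convolutions depend smoothly on a parameter.
open MeasureTheory Convolution in
theorem ContDiff.parametric_integral {P : Type} [NormedAddCommGroup P] [NormedSpace ℝ P]
    {g : P × ℝ → F} (hg : ContDiff ℝ ∞ g) : ContDiff ℝ ∞ fun p => ∫ u in (0 : ℝ)..1, g (p, u) := by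
  let χ : ContDiffBump (0 : ℝ) := ⟨1, 2, one_pos, one_lt_two⟩
  have hχ : ContDiff ℝ ∞ (χ : ℝ → ℝ) := χ.contDiff
  have hf : LocallyIntegrable ((Set.Ioc (0 : ℝ) 1).indicator fun _ => (1 : ℝ)) volume :=
    ((integrableOn_const (by simp)).integrable_indicator measurableSet_Ioc).locallyIntegrable
  have key := contDiffOn_convolution_right_with_param_comp (μ := volume) (n := (⊤ : ℕ∞))
    (ContinuousLinearMap.lsmul ℝ ℝ : ℝ →L[ℝ] F →L[ℝ] F) (s := (Set.univ : Set P))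
    (v := fun _ => (0 : ℝ)) (g := fun p u => χ u • g (p, -u))
    (f := (Set.Ioc (0 : ℝ) 1).indicator fun _ => (1 : ℝ)) (k := Metric.closedBall (0 : ℝ) 2)
    contDiffOn_const isOpen_univ (isCompact_closedBall _ _) (fun p x _ hx => by
      rw [show χ x = 0 from χ.zero_of_le_dist (not_le.1 hx).le, zero_smul])
    hf (by
      refine ContDiff.contDiffOn ?_
      exact (hχ.comp contDiff_snd).smul (hg.comp (contDiff_fst.prodMk contDiff_snd.neg)))
  rw [contDiffOn_univ] at key
  convert key using 2 with p
  rw [convolution_def, intervalIntegral.integral_of_le zero_le_one, ← integral_indicator measurableSet_Ioc]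
  refine integral_congr_ae (Filter.Eventually.of_forall fun u => ?_)
  by_cases hu : u ∈ Set.Ioc (0 : ℝ) 1
  · have : χ (-u) = 1 := χ.one_of_mem_closedBall (by
      simpa [abs_of_pos hu.1, χ] using hu.2)
    simp [Set.indicator_of_mem hu, this]
  · simp [Set.indicator_of_notMem hu]

/-- The substitution `s = t u` turns the variable limit into the fixed interval `[0,1]`. -/
theorem ContDiff.parametric_primitive {P : Type} [NormedAddCommGroup P] [NormedSpace ℝ P]
    {c : ℝ × P → F} (hc : ContDiff ℝ ∞ c) :
    ContDiff ℝ ∞ fun p : ℝ × P => ∫ s in (0 : ℝ)..p.1, c (s, p.2) := by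
  have h : ContDiff ℝ ∞ fun q : (ℝ × P) × ℝ => c (q.1.1 * q.2, q.1.2) :=
    hc.comp (((contDiff_fst.comp contDiff_fst).mul contDiff_snd).prodMk
      (contDiff_snd.comp contDiff_fst))
  convert contDiff_fst.smul h.parametric_integral using 2 with p
  exact ((intervalIntegral.smul_integral_comp_mul_left (fun s => c (s, p.2)) p.1).trans
    (by simp)).symm

/-- Hadamard's lemma with the time as a parameter: integrate the derivative along the segment from
`x` to `y`. The coefficients are jointly smooth in time and space. -/
theorem ContDiff.exists_hadamard [CompleteSpace F] {m : ℕ} {c : ℝ × EuclideanSpace ℝ (Fin m) → F}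
    (hc : ContDiff ℝ ∞ c) (x : EuclideanSpace ℝ (Fin m)) :
    ∃ d : Fin m → ℝ × EuclideanSpace ℝ (Fin m) → F, (∀ a, ContDiff ℝ ∞ (d a)) ∧
      ∀ s y, c (s, y) = c (s, x) + ∑ a, (y a - x a) • d a (s, y) := by
  have hline : ContDiff ℝ ∞ fun q : (ℝ × EuclideanSpace ℝ (Fin m)) × ℝ =>
      (q.1.1, x + q.2 • (q.1.2 - x)) := by fun_prop
  have hD : ∀ v, ContDiff ℝ ∞ fun q : (ℝ × EuclideanSpace ℝ (Fin m)) × ℝ =>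
      fderiv ℝ c (q.1.1, x + q.2 • (q.1.2 - x)) v := fun v =>
    ((hc.fderiv_right (m := ∞) le_rfl).comp hline).clm_apply contDiff_const
  refine ⟨fun a p => ∫ u in (0 : ℝ)..1, fderiv ℝ c (p.1, x + u • (p.2 - x))
    (0, EuclideanSpace.single a 1), fun a => (hD _).parametric_integral, fun s y => ?_⟩
  have h1 : ∀ u : ℝ, HasDerivAt (fun u : ℝ => c (s, x + u • (y - x)))
      (fderiv ℝ c (s, x + u • (y - x)) (0, y - x)) u := by
    intro u
    have h2 : HasDerivAt (fun u : ℝ => (s, x + u • (y - x))) ((0 : ℝ), y - x) u := by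
      refine (hasDerivAt_const u s).prodMk ?_
      simpa using ((hasDerivAt_id u).smul_const (y - x)).const_add x
    exact ((hc.differentiable (by simp)).differentiableAt.hasFDerivAt).comp_hasDerivAt u h2
  have hcont : ∀ v, Continuous fun u : ℝ => fderiv ℝ c (s, x + u • (y - x)) v := fun v =>
    (hD v).continuous.comp (by fun_prop : Continuous fun u : ℝ => ((s, y), u))
  have h3 := intervalIntegral.integral_eq_sub_of_hasDerivAt (fun u _ => h1 u)
    ((hcont _).intervalIntegrable 0 1)
  have h4 : ((0 : ℝ), y - x) =
      ∑ a, (y a - x a) • ((0 : ℝ), EuclideanSpace.single a (1 : ℝ)) := by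
    refine Prod.ext (by simp [Prod.fst_sum]) ?_
    ext b
    simp [Prod.snd_sum, Pi.single_apply]
  simp only [← intervalIntegral.integral_smul]
  rw [← intervalIntegral.integral_finsetSum (f := fun a u => (y a - x a) •
    fderiv ℝ c (s, x + u • (y - x)) (0, EuclideanSpace.single a 1)) fun a _ =>
    ((hcont _).const_smul _).intervalIntegrable _ _]
  simp only [← map_smul, ← map_sum, ← h4]
  rw [h3]
  simp

variable {m : ℕ} {X : Type} [TopologicalSpace X] [ChartedSpace (EuclideanSpace ℝ (Fin m)) X]
  [IsManifold (𝓡 m) ∞ X]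

/-- The cut-off is applied only in the space variable, so a single neighbourhood of `x` serves for
all times. -/
theorem ContMDiffOn.exists_contDiff_eventuallyEq {c : ℝ × X → F} {U : Set X} (hU : IsOpen U)
    (hc : ContMDiffOn (𝓘(ℝ, ℝ).prod (𝓡 m)) 𝓘(ℝ, F) ∞ c (Set.univ ×ˢ U)) {x : X} (hx : x ∈ U) :
    ∃ c' : ℝ × EuclideanSpace ℝ (Fin m) → F, ContDiff ℝ ∞ c' ∧
      ∀ᶠ y in nhds x, ∀ s, c (s, y) = c' (s, extChartAt (𝓡 m) x y) := by
  set φ := extChartAt (𝓡 m) x with hφ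
  have hW : IsOpen (φ.target ∩ φ.symm ⁻¹' U) :=
    (continuousOn_extChartAt_symm x).isOpen_inter_preimage (isOpen_extChartAt_target x) hU
  have hxW : φ x ∈ φ.target ∩ φ.symm ⁻¹' U :=
    ⟨mem_extChartAt_target x, by simpa [hφ] using hx⟩
  obtain ⟨ε, hε, hεW⟩ := Metric.nhds_basis_closedBall.mem_iff.1 (hW.mem_nhds hxW)
  let χ : ContDiffBump (φ x) := ⟨ε / 2, ε, half_pos hε, half_lt_self hε⟩
  refine ⟨fun p => χ p.2 • c (p.1, φ.symm p.2), ?_, ?_⟩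
  · rw [contDiff_iff_contDiffAt]
    rintro ⟨s, z⟩
    by_cases hz : z ∈ Metric.closedBall (φ x) ε
    · have hzW := hεW hz
      refine (χ.contDiff.comp contDiff_snd).contDiffAt.smul ?_
      rw [← contMDiffAt_iff_contDiffAt]
      have h1 : ContMDiffAt (𝓘(ℝ, ℝ).prod (𝓡 m)) 𝓘(ℝ, F) ∞ c (s, φ.symm z) :=
        hc.contMDiffAt ((isOpen_univ.prod hU).mem_nhds ⟨trivial, hzW.2⟩)
      have h2 : ContMDiffAt 𝓘(ℝ, EuclideanSpace ℝ (Fin m)) (𝓡 m) ∞ φ.symm z :=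
        (contMDiffOn_extChartAt_symm x).contMDiffAt
          ((isOpen_extChartAt_target x).mem_nhds hzW.1)
      have h3 : ContMDiffAt 𝓘(ℝ, ℝ × EuclideanSpace ℝ (Fin m)) (𝓘(ℝ, ℝ).prod (𝓡 m)) ∞
          (fun p : ℝ × EuclideanSpace ℝ (Fin m) => (p.1, φ.symm p.2)) (s, z) :=
        contDiff_fst.contMDiff.contMDiffAt.prodMk
          (ContMDiffAt.comp (s, z) h2 contDiff_snd.contMDiff.contMDiffAt)
      exact ContMDiffAt.comp (s, z) h1 h3
    · refine (contDiffAt_const (c := (0 : F))).congr_of_eventuallyEq ?_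
      have : ∀ᶠ p : ℝ × EuclideanSpace ℝ (Fin m) in nhds (s, z),
          p.2 ∈ (Metric.closedBall (φ x) ε)ᶜ :=
        continuous_snd.continuousAt.eventually
          (Metric.isClosed_closedBall.isOpen_compl.mem_nhds hz)
      filter_upwards [this] with p hp
      rw [show χ p.2 = 0 from χ.zero_of_le_dist (not_le.1 (Metric.mem_closedBall.not.1 hp)).le, zero_smul]
  · have h1 : ∀ᶠ y in nhds x, y ∈ φ.source := extChartAt_source_mem_nhds x
    have h2 : ∀ᶠ y in nhds x, φ y ∈ Metric.closedBall (φ x) (ε / 2) :=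
      (continuousAt_extChartAt x).eventually (Metric.closedBall_mem_nhds _ (half_pos hε))
    filter_upwards [h1, h2] with y hy hy' s
    rw [show χ (φ y) = 1 from χ.one_of_mem_closedBall hy', one_smul, φ.left_inv hy]

theorem ContMDiffOn.parametric_primitive {c : ℝ × X → F} {U : Set X} (hU : IsOpen U)
    (hc : ContMDiffOn (𝓘(ℝ, ℝ).prod (𝓡 m)) 𝓘(ℝ, F) ∞ c (Set.univ ×ˢ U)) :
    ContMDiffOn (𝓘(ℝ, ℝ).prod (𝓡 m)) 𝓘(ℝ, F) ∞
      (fun p : ℝ × X => ∫ s in (0 : ℝ)..p.1, c (s, p.2)) (Set.univ ×ˢ U) := by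
  rintro ⟨t, x⟩ ⟨-, hx⟩
  obtain ⟨c', hc', h⟩ := hc.exists_contDiff_eventuallyEq hU hx
  refine ContMDiffAt.contMDiffWithinAt ?_
  have h1 : ContMDiffAt (𝓘(ℝ, ℝ).prod (𝓡 m)) 𝓘(ℝ, ℝ × EuclideanSpace ℝ (Fin m)) ∞
      (fun p : ℝ × X => (p.1, extChartAt (𝓡 m) x p.2)) (t, x) :=
    contMDiffAt_fst.prodMk_space
      (ContMDiffAt.comp (t, x) (contMDiffAt_extChartAt (x := x)) contMDiffAt_snd)
  have h2 := ContMDiffAt.comp (t, x) hc'.parametric_primitive.contMDiff.contMDiffAt h1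
  refine h2.congr_of_eventuallyEq ?_
  filter_upwards [continuous_snd.continuousAt.eventually h] with p hp
  simp [hp]

end Parametric

/-! ## Smooth families of sections -/

theorem SmoothInto.of_smul {𝕜 : Type} [RCLike 𝕜] {E H Y : Type} [NormedAddCommGroup E]
    [NormedSpace ℝ E] [TopologicalSpace H] {J : ModelWithCorners ℝ E H} [TopologicalSpace Y]
    [ChartedSpace H Y] {S : Type} [Ring S] [Algebra 𝕜 S] {U : Set Y} {c : Y → 𝕜}
    (hc : ContMDiffOn J 𝓘(ℝ, 𝕜) ∞ c U) (s : S) : SmoothInto 𝕜 J U fun y => c y • s :=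
  ⟨Unit, inferInstance, fun _ => c, fun _ => s, fun _ => hc, by simp⟩

theorem SmoothInto.smul {𝕜 : Type} [RCLike 𝕜] {E H Y : Type} [NormedAddCommGroup E]
    [NormedSpace ℝ E] [TopologicalSpace H] {J : ModelWithCorners ℝ E H} [TopologicalSpace Y]
    [ChartedSpace H Y] {S : Type} [Ring S] [Algebra 𝕜 S] {U : Set Y} {c : Y → 𝕜} {g : Y → S}
    (hc : ContMDiffOn J 𝓘(ℝ, 𝕜) ∞ c U) (hg : SmoothInto 𝕜 J U g) :
    SmoothInto 𝕜 J U fun y => c y • g y := by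
  simpa using (SmoothInto.of_smul hc (1 : S)).mul hg

/-- The vectors in the representation of a smooth function with values in a subspace can be chosen
in this subspace. -/
theorem SmoothInto.exists_mem {𝕜 : Type} [RCLike 𝕜] {E H Y : Type} [NormedAddCommGroup E]
    [NormedSpace ℝ E] [TopologicalSpace H] {J : ModelWithCorners ℝ E H} [TopologicalSpace Y]
    [ChartedSpace H Y] {S : Type} [Ring S] [Algebra 𝕜 S] {U : Set Y} {g : Y → S}
    (hg : SmoothInto 𝕜 J U g) (W : Submodule 𝕜 S) (hW : ∀ y ∈ U, g y ∈ W) :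
    ∃ (κ : Type) (_ : Fintype κ) (c : κ → Y → 𝕜) (s : κ → S),
      (∀ k, ContMDiffOn J 𝓘(ℝ, 𝕜) ∞ (c k) U) ∧ (∀ k, s k ∈ W) ∧
      ∀ y ∈ U, g y = ∑ k, c k y • s k := by
  obtain ⟨κ, hκ, c, s, hc, h⟩ := hg
  obtain ⟨p, hp⟩ := W.subtype.exists_leftInverse_of_injective W.ker_subtype
  refine ⟨κ, hκ, c, fun k => p (s k), hc, fun k => (p (s k)).2, fun y hy => ?_⟩
  have h1 : (p (g y) : S) = g y := congrArg Subtype.val (LinearMap.congr_fun hp ⟨g y, hW y hy⟩)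
  rw [← h1, h y hy]
  simp

namespace NManifold

variable {𝕜 : Type} [RCLike 𝕜] (L : NManifold 𝕜)

theorem algebraMap_mem_gr (x : L.X) (a : 𝕜) : algebraMap 𝕜 (L.fib x) a ∈ L.gr x 0 := by
  rw [Algebra.algebraMap_eq_smul_one]
  exact Submodule.smul_mem _ _ (L.one_mem_gr x)

/-- The function of degree zero given by a smooth function on the reduced manifold. -/
def ofSmooth (c : L.X → 𝕜) (hc : ContMDiff (𝓡 L.dim) 𝓘(ℝ, 𝕜) ∞ c) : L.Fun 0 :=
  ⟨fun x => algebraMap 𝕜 _ (c x), fun x => L.algebraMap_mem_gr x _, fun i => by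
    simpa [Algebra.algebraMap_eq_smul_one] using
      SmoothInto.of_smul hc.contMDiffOn (1 : GSym 𝕜 L.d)⟩

/-- The product of a smooth function on the reduced manifold with a function of degree `n`. -/
def smulFun {n : ℤ} (c : L.X → 𝕜) (hc : ContMDiff (𝓡 L.dim) 𝓘(ℝ, 𝕜) ∞ c) (f : L.Fun n) : L.Fun n :=
  ⟨fun x => c x • (f : L.Sec) x, fun x => Submodule.smul_mem _ _ (f.2.1 x), fun i => by
    simpa using SmoothInto.smul hc.contMDiffOn (f.2.2 i)⟩

theorem ofSmooth_mul {n : ℤ} (c : L.X → 𝕜) (hc : ContMDiff (𝓡 L.dim) 𝓘(ℝ, 𝕜) ∞ c)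
    (f : L.Fun n) : (L.mul (L.ofSmooth c hc) f : L.Sec) = L.smulFun c hc f :=
  funext fun _ => (Algebra.smul_def _ _).symm

/-- The local section of degree `n` with a constant value in the trivialization `i`, multiplied
with a cut-off function. -/
def cutoff {n : ℤ} (i : L.ι) (χ : L.X → 𝕜) (hχ : ContMDiff (𝓡 L.dim) 𝓘(ℝ, 𝕜) ∞ χ)
    (hs : tsupport χ ⊆ L.dom i) (s : GSym.homog 𝕜 L.d n) : L.Fun n :=
  ⟨fun x => χ x • (L.coord i x).symm s, fun x => by
    by_cases hx : x ∈ L.dom i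
    · refine Submodule.smul_mem _ _ ((L.coord_gr i x hx n _).2 ?_)
      simp
    · beta_reduce
      rw [show χ x = 0 from image_eq_zero_of_notMem_tsupport fun h => hx (hs h), zero_smul]
      exact zero_mem _, fun j => by
    obtain ⟨κ, hκ, c, v, hc, h⟩ := L.smooth_transition i j s
    -- The transition coefficients are smooth only on `dom i ∩ dom j`. They are extended by zero,
    -- which is harmless because `χ` vanishes near every point outside `dom i`.
    refine ⟨κ, hκ, fun k x => χ x • (L.dom i).indicator (c k) x, v, fun k x hx => ?_,
      fun x hx => ?_⟩
    · refine ContMDiffAt.contMDiffWithinAt ?_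
      by_cases hxi : x ∈ L.dom i
      · have h1 : ContMDiffAt (𝓡 L.dim) 𝓘(ℝ, 𝕜) ∞ (c k) x :=
          (hc k).contMDiffAt (((L.isOpen_dom i).inter (L.isOpen_dom j)).mem_nhds ⟨hxi, hx⟩)
        have h2 : (L.dom i).indicator (c k) =ᶠ[nhds x] c k := by
          filter_upwards [(L.isOpen_dom i).mem_nhds hxi] with y hy
          exact Set.indicator_of_mem hy _
        exact (contDiff_mul (𝕜 := ℝ) (𝔸 := 𝕜)).contMDiff.contMDiffAt.comp x
          (hχ.contMDiffAt.prodMk_space (h1.congr_of_eventuallyEq h2))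
      · refine (contMDiffAt_const (c := (0 : 𝕜))).congr_of_eventuallyEq ?_
        filter_upwards [(isClosed_tsupport χ).isOpen_compl.mem_nhds fun h => hxi (hs h)] with y hy
        rw [image_eq_zero_of_notMem_tsupport hy, zero_smul]
    · by_cases hxi : x ∈ L.dom i
      · beta_reduce
        have h' := h x ⟨hxi, hx⟩
        beta_reduce at h'
        rw [map_smul, h', Finset.smul_sum]
        simp [Set.indicator_of_mem hxi, mul_smul]
      · beta_reduce
        rw [show χ x = 0 from image_eq_zero_of_notMem_tsupport fun h => hxi (hs h)]
        simp⟩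

/-- `G` is a smooth function of degree `n` on `ℝ × L`. -/
structure SmoothFam {L : NManifold 𝕜} (n : ℤ) (G : ℝ → L.Sec) : Prop where
  gr : ∀ t x, G t x ∈ L.gr x n
  smooth : ∀ i, SmoothInto 𝕜 (𝓘(ℝ, ℝ).prod (𝓡 L.dim)) (Set.univ ×ˢ L.dom i)
    (fun p : ℝ × L.X => L.coord i p.2 (G p.1 p.2))

namespace SmoothFam

variable {L} {m n : ℤ} {G G' H : ℝ → L.Sec}

theorem mem_Fun (h : SmoothFam n G) (t : ℝ) : G t ∈ L.Fun n := by
  refine ⟨h.gr t, fun i => ?_⟩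
  obtain ⟨κ, hκ, c, s, hc, hs⟩ := h.smooth i
  refine ⟨κ, hκ, fun k x => c k (t, x), s, fun k => ?_, fun x hx => hs (t, x) ⟨trivial, hx⟩⟩
  exact (hc k).comp (contMDiffOn_const.prodMk contMDiffOn_id) fun x hx => ⟨trivial, hx⟩

theorem const {f : L.Sec} (hf : f ∈ L.Fun n) : SmoothFam n fun _ => f := by
  refine ⟨fun _ => hf.1, fun i => ?_⟩
  obtain ⟨κ, hκ, c, s, hc, hs⟩ := hf.2 i
  exact ⟨κ, hκ, fun k p => c k p.2, s, fun k => (hc k).comp contMDiffOn_snd fun p hp => hp.2,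
    fun p hp => hs p.2 hp.2⟩

theorem mul (h : SmoothFam m G) (h' : SmoothFam n G') : SmoothFam (m + n) fun t => G t * G' t :=
  ⟨fun t x => L.mul_mem_gr x (h.gr t x) (h'.gr t x), fun i => by
    simpa using (h.smooth i).mul (h'.smooth i)⟩

theorem exists_local (h : SmoothFam n G) (i : L.ι) :
    ∃ (κ : Type) (_ : Fintype κ) (c : κ → ℝ × L.X → 𝕜) (s : κ → GSym.homog 𝕜 L.d n),
      (∀ k, ContMDiffOn (𝓘(ℝ, ℝ).prod (𝓡 L.dim)) 𝓘(ℝ, 𝕜) ∞ (c k) (Set.univ ×ˢ L.dom i)) ∧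
      ∀ t, ∀ x ∈ L.dom i, G t x = ∑ k, c k (t, x) • (L.coord i x).symm (s k) := by
  obtain ⟨κ, hκ, c, s, hc, hs, hG⟩ := (h.smooth i).exists_mem (GSym.homog 𝕜 L.d n)
    fun p hp => (L.coord_gr i p.2 hp.2 n _).1 (h.gr _ _)
  refine ⟨κ, hκ, c, fun k => ⟨s k, hs k⟩, hc, fun t x hx => ?_⟩
  have := congrArg (L.coord i x).symm (hG (t, x) ⟨trivial, hx⟩)
  simpa using this

/-- `H` is the integral of `G` over `[0,t]`. -/
def IsPrimitive (G H : ℝ → L.Sec) : Prop :=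
  ∀ t x (l : Module.Dual 𝕜 (L.fib x)), l (H t x) = ∫ s in (0 : ℝ)..t, l (G s x)

theorem continuous_of_contMDiffOn {c : ℝ × L.X → 𝕜} {U : Set L.X}
    (hc : ContMDiffOn (𝓘(ℝ, ℝ).prod (𝓡 L.dim)) 𝓘(ℝ, 𝕜) ∞ c (Set.univ ×ˢ U)) {x : L.X}
    (hx : x ∈ U) : Continuous fun s => c (s, x) :=
  hc.continuousOn.comp_continuous (Continuous.prodMk_left x) fun _ => ⟨trivial, hx⟩

theorem dual_sum_integral {V : Type} [AddCommGroup V] [Module 𝕜 V] {κ : Type} [Fintype κ]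
    {c : κ → ℝ → 𝕜} (hc : ∀ k, Continuous (c k)) (v : κ → V) (l : Module.Dual 𝕜 V) (t : ℝ) :
    l (∑ k, (∫ s in (0 : ℝ)..t, c k s) • v k) = ∫ s in (0 : ℝ)..t, l (∑ k, c k s • v k) := by
  simp only [map_sum, map_smul, smul_eq_mul]
  rw [intervalIntegral.integral_finsetSum (f := fun k s => c k s * l (v k)) fun k _ =>
    ((hc k).mul continuous_const).intervalIntegrable _ _]
  simp only [intervalIntegral.integral_mul_const]

theorem IsPrimitive.eq_local (hH : IsPrimitive G H) {i : L.ι} {κ : Type} [Fintype κ]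
    {c : κ → ℝ × L.X → 𝕜} {s : κ → GSym 𝕜 L.d}
    (hc : ∀ k, ContMDiffOn (𝓘(ℝ, ℝ).prod (𝓡 L.dim)) 𝓘(ℝ, 𝕜) ∞ (c k) (Set.univ ×ˢ L.dom i))
    (hG : ∀ t, ∀ x ∈ L.dom i, G t x = ∑ k, c k (t, x) • (L.coord i x).symm (s k)) (t : ℝ) {x : L.X}
    (hx : x ∈ L.dom i) :
    H t x = ∑ k, (∫ s in (0 : ℝ)..t, c k (s, x)) • (L.coord i x).symm (s k) := by
  refine eq_of_forall_dual (𝕜 := 𝕜) fun l => ?_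
  rw [hH, dual_sum_integral fun k => continuous_of_contMDiffOn (hc k) hx]
  simp only [hG _ x hx]

/-- In a trivialization the primitive is obtained by integrating the coefficients. The description
by linear functionals determines it uniquely, so the local formulas agree on overlaps. -/
theorem exists_primitive (h : SmoothFam n G) : ∃ H, SmoothFam n H ∧ IsPrimitive G H := by
  have hex : ∀ t x, ∃ v : L.fib x, ∀ l : Module.Dual 𝕜 (L.fib x),
      l v = ∫ s in (0 : ℝ)..t, l (G s x) := by
    intro t x
    obtain ⟨i, hi⟩ := L.cover x
    obtain ⟨κ, _, c, s, hc, hG⟩ := h.exists_local i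
    refine ⟨∑ k, (∫ s in (0 : ℝ)..t, c k (s, x)) • (L.coord i x).symm (s k), fun l => ?_⟩
    rw [dual_sum_integral fun k => continuous_of_contMDiffOn (hc k) hi]
    simp only [hG _ x hi]
  choose H hH using hex
  have hH : IsPrimitive G H := hH
  refine ⟨H, ⟨fun t x => ?_, fun i => ?_⟩, hH⟩
  · obtain ⟨i, hi⟩ := L.cover x
    obtain ⟨κ, _, c, s, hc, hG⟩ := h.exists_local i
    rw [hH.eq_local hc hG t hi]
    refine Submodule.sum_mem _ fun k _ => Submodule.smul_mem _ _ ((L.coord_gr i x hi n _).2 ?_)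
    simp
  · obtain ⟨κ, hκ, c, s, hc, hG⟩ := h.exists_local i
    refine ⟨κ, hκ, fun k p => ∫ s in (0 : ℝ)..p.1, c k (s, p.2), fun k => s k,
      fun k => (hc k).parametric_primitive (L.isOpen_dom i), fun p hp => ?_⟩
    simp [hH.eq_local hc hG p.1 hp.2]

/-- Near a point `x`, a smooth family and its primitive are combinations of functions that do not
depend on the time, with coefficients that are smooth functions in a chart. -/
theorem exists_local_chart (h : SmoothFam n G) (hH : IsPrimitive G H) (x : L.X) :
    ∃ (κ : Type) (_ : Fintype κ) (c : κ → ℝ × EuclideanSpace ℝ (Fin L.dim) → 𝕜) (σ : κ → L.Fun n),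
      (∀ k, ContDiff ℝ ∞ (c k)) ∧
      (∀ᶠ y in nhds x, ∀ t, G t y = ∑ k, c k (t, extChartAt (𝓡 L.dim) x y) • (σ k : L.Sec) y) ∧
      ∀ᶠ y in nhds x, ∀ t,
        H t y = ∑ k, (∫ s in (0 : ℝ)..t, c k (s, extChartAt (𝓡 L.dim) x y)) • (σ k : L.Sec) y := by
  obtain ⟨i, hi⟩ := L.cover x
  obtain ⟨κ, hκ, c, s, hc, hG⟩ := h.exists_local i
  choose c' hc' hcc' using fun k => (hc k).exists_contDiff_eventuallyEq (L.isOpen_dom i) hi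
  -- The cut-off turns the local constant frame into global functions `σ k`, to which operators
  -- defined on global functions can be applied.
  obtain ⟨χ, -, hχ⟩ := (SmoothBumpFunction.nhds_basis_tsupport (I := 𝓡 L.dim) x).mem_iff.1
    ((L.isOpen_dom i).mem_nhds hi)
  have hχ' : ContMDiff (𝓡 L.dim) 𝓘(ℝ, 𝕜) ∞ fun y => ((χ y : ℝ) : 𝕜) :=
    (RCLike.ofRealCLM (K := 𝕜)).contDiff.contMDiff.comp χ.contMDiff
  have hs : tsupport (fun y => ((χ y : ℝ) : 𝕜)) ⊆ L.dom i := by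
    refine (closure_mono fun y hy => ?_).trans hχ
    exact fun h0 => hy (by simp [h0])
  refine ⟨κ, hκ, c', fun k => L.cutoff i _ hχ' hs (s k), hc', ?_, ?_⟩
  · filter_upwards [Filter.eventually_all.2 hcc', χ.eventuallyEq_one,
      (L.isOpen_dom i).mem_nhds hi] with y hy h1 hyi t
    rw [hG t y hyi]
    refine Finset.sum_congr rfl fun k _ => ?_
    simp [cutoff, hy, h1]
  · filter_upwards [Filter.eventually_all.2 hcc', χ.eventuallyEq_one,
      (L.isOpen_dom i).mem_nhds hi] with y hy h1 hyi t
    rw [hH.eq_local hc hG t hyi]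
    refine Finset.sum_congr rfl fun k _ => ?_
    simp [cutoff, hy, h1]

end SmoothFam

/-! ### First-order operators commute with time integrals -/

/-- `D` is a local operator at `x` that involves at most the first derivatives of the
coefficients. -/
structure IsFirstOrderAt {L : NManifold 𝕜} (x : L.X) {n : ℤ} {V : Type} [AddCommGroup V] [Module 𝕜 V]
    (D : L.Fun n →ₗ[𝕜] V) : Prop where
  map_eq_zero : ∀ f : L.Fun n, (∀ᶠ y in nhds x, (f : L.Sec) y = 0) → D f = 0
  map_hadamard : ∀ σ : L.Fun n, ∃ (v : V) (w : Fin L.dim → V),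
    ∀ (a : 𝕜) (h : Fin L.dim → EuclideanSpace ℝ (Fin L.dim) → 𝕜), (∀ j, ContDiff ℝ ∞ (h j)) →
      ∃ f : L.Fun n, (∀ᶠ y in nhds x, (f : L.Sec) y =
        (a + ∑ j, (extChartAt (𝓡 L.dim) x y j - extChartAt (𝓡 L.dim) x x j) •
          h j (extChartAt (𝓡 L.dim) x y)) • (σ : L.Sec) y) ∧
        D f = a • v + ∑ j, h j (extChartAt (𝓡 L.dim) x x) • w j

/-- The function supplied by `map_hadamard` may differ from `f` away from `x`; locality removes the
difference. The vectors `v`, `w` depend only on the frame, so the same ones serve for all times of a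
family. -/
theorem IsFirstOrderAt.exists_eq {L : NManifold 𝕜} {x : L.X} {n : ℤ} {V : Type} [AddCommGroup V]
    [Module 𝕜 V] {D : L.Fun n →ₗ[𝕜] V} (hD : IsFirstOrderAt x D) {κ : Type} [Fintype κ]
    (σ : κ → L.Fun n) :
    ∃ (v : κ → V) (w : κ → Fin L.dim → V), ∀ (a : κ → 𝕜)
      (h : κ → Fin L.dim → EuclideanSpace ℝ (Fin L.dim) → 𝕜) (f : L.Fun n),
      (∀ k j, ContDiff ℝ ∞ (h k j)) → (∀ᶠ y in nhds x, (f : L.Sec) y =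
        ∑ k, (a k + ∑ j, (extChartAt (𝓡 L.dim) x y j - extChartAt (𝓡 L.dim) x x j) •
          h k j (extChartAt (𝓡 L.dim) x y)) • (σ k : L.Sec) y) →
      D f = ∑ k, (a k • v k + ∑ j, h k j (extChartAt (𝓡 L.dim) x x) • w k j) := by
  choose v w H using fun k => hD.map_hadamard (σ k)
  refine ⟨v, w, fun a h f hh hf => ?_⟩
  choose g hg hDg using fun k => H k (a k) (h k) (hh k)
  rw [← sub_eq_zero, ← Finset.sum_congr rfl fun k _ => hDg k, ← map_sum, ← map_sub]
  refine hD.map_eq_zero _ ?_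
  filter_upwards [Filter.eventually_all.2 hg, hf] with y hy hy'
  simp [Finset.sum_apply, hy, hy']

/-- Differentiation under the integral sign. In a local frame `D (G t)` is a fixed linear expression
in the Hadamard coefficients of `G` at `x`, and those of the primitive are their time integrals. -/
theorem IsFirstOrderAt.map_primitive {L : NManifold 𝕜} {x : L.X} {n : ℤ} {V : Type} [Ring V]
    [Algebra 𝕜 V] {D : L.Fun n →ₗ[𝕜] V} (hD : IsFirstOrderAt x D) {G H : ℝ → L.Fun n}
    (hG : SmoothFam n fun t => (G t : L.Sec))
    (hH : SmoothFam.IsPrimitive (fun t => (G t : L.Sec)) fun t => (H t : L.Sec)) :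
    (fun t : unitInterval => D (G t)) ∈ contPaths 𝕜 V ∧
      ∀ t : unitInterval, D (H t) = fiberIntegral 𝕜 (fun t : unitInterval => D (G t)) t := by
  obtain ⟨κ, _, c, σ, hc, hGc, hHc⟩ := hG.exists_local_chart hH x
  set x₀ := extChartAt (𝓡 L.dim) x x
  choose d hd hcd using fun k => (hc k).exists_hadamard x₀
  obtain ⟨v, w, hvw⟩ := hD.exists_eq σ
  have h1 : ∀ t, D (G t) = ∑ k, (c k (t, x₀) • v k + ∑ j, d k j (t, x₀) • w k j) := fun t => by
    refine hvw (fun k => c k (t, x₀)) (fun k j z => d k j (t, z)) (G t)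
      (fun k j => (hd k j).comp (contDiff_const.prodMk contDiff_id)) ?_
    filter_upwards [hGc] with y hy
    rw [hy]
    exact Finset.sum_congr rfl fun k _ => by rw [hcd]
  have hcc : ∀ k z, Continuous fun s => c k (s, z) := fun k z =>
    (hc k).continuous.comp (Continuous.prodMk_left z)
  have hdc : ∀ k j z, Continuous fun s => d k j (s, z) := fun k j z =>
    (hd k j).continuous.comp (Continuous.prodMk_left z)
  -- Integrating the Hadamard expansion of `c k` in time gives one of its primitive, with
  -- coefficients `∫ d k j`; these are again smooth in space.
  have h2 : ∀ t, D (H t) = ∑ k, ((∫ s in (0 : ℝ)..t, c k (s, x₀)) • v k +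
      ∑ j, (∫ s in (0 : ℝ)..t, d k j (s, x₀)) • w k j) := fun t => by
    refine hvw (fun k => ∫ s in (0 : ℝ)..t, c k (s, x₀))
      (fun k j z => ∫ s in (0 : ℝ)..t, d k j (s, z)) (H t)
      (fun k j => (hd k j).parametric_primitive.comp (contDiff_const.prodMk contDiff_id)) ?_
    filter_upwards [hHc] with y hy
    rw [hy]
    refine Finset.sum_congr rfl fun k _ => ?_
    congr 1
    simp only [← intervalIntegral.integral_smul]
    rw [← intervalIntegral.integral_finsetSum fun j _ => ?_, ← intervalIntegral.integral_add]
    · exact intervalIntegral.integral_congr fun s _ => hcd k s _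
    · exact (hcc _ _).intervalIntegrable _ _
    · exact (continuous_finsetSum _ fun j _ => (hdc _ _ _).const_smul _).intervalIntegrable _ _
    · exact ((hdc _ _ _).const_smul _).intervalIntegrable _ _
  have h3 : (fun t : unitInterval => D (G t)) ∈ contPaths 𝕜 V := by
    have h4 : (fun t : unitInterval => D (G t)) = ∑ k, ((fun t : unitInterval => c k (t, x₀) • v k) +
        ∑ j, fun t : unitInterval => d k j (t, x₀) • w k j) := by
      funext t
      simp [h1, Finset.sum_apply]
    rw [h4]
    exact sum_mem fun k _ => add_mem
      (smul_mem_contPaths ((hcc k x₀).comp continuous_subtype_val) _)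
      (sum_mem fun j _ => smul_mem_contPaths ((hdc k j x₀).comp continuous_subtype_val) _)
  refine ⟨h3, fun t => (fiberIntegral_eq h3 fun l => ?_).symm⟩
  have h4 : ∀ s ∈ Set.uIcc (0 : ℝ) t, l (D (G (Set.projIcc (0 : ℝ) 1 zero_le_one s))) =
      ∑ k, (c k (s, x₀) * l (v k) + ∑ j, d k j (s, x₀) * l (w k j)) := fun s hs => by
    rw [Set.uIcc_of_le t.2.1] at hs
    rw [Set.projIcc_of_mem _ ⟨hs.1, hs.2.trans t.2.2⟩, h1]
    simp
  rw [intervalIntegral.integral_congr h4, h2]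
  simp only [map_sum, map_add, map_smul, smul_eq_mul]
  rw [intervalIntegral.integral_finsetSum]
  · refine Finset.sum_congr rfl fun k _ => ?_
    rw [intervalIntegral.integral_add, intervalIntegral.integral_finsetSum]
    · simp only [intervalIntegral.integral_mul_const]
    · exact fun j _ => ((hdc _ _ _).mul continuous_const).intervalIntegrable _ _
    · exact ((hcc _ _).mul continuous_const).intervalIntegrable _ _
    · exact (continuous_finsetSum _ fun j _ =>
        (hdc _ _ _).mul continuous_const).intervalIntegrable _ _
  · exact fun k _ => (((hcc _ _).mul continuous_const).add (continuous_finsetSum _ fun j _ =>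
        (hdc _ _ _).mul continuous_const)).intervalIntegrable _ _

end NManifold

/-! ### Evaluation, the homological vector field and pull-backs as first-order operators -/

namespace NManifold

variable {𝕜 : Type} [RCLike 𝕜] (L : NManifold 𝕜)

/-- A smooth function that is equal to `h` in a chart near `x`. -/
theorem exists_eq_in_chart (x : L.X) {h : EuclideanSpace ℝ (Fin L.dim) → 𝕜}
    (hh : ContDiff ℝ ∞ h) : ∃ c : L.X → 𝕜, ContMDiff (𝓡 L.dim) 𝓘(ℝ, 𝕜) ∞ c ∧
      ∀ᶠ y in nhds x, c y = h (extChartAt (𝓡 L.dim) x y) := by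
  obtain ⟨χ⟩ : Nonempty (SmoothBumpFunction (𝓡 L.dim) x) := inferInstance
  refine ⟨fun y => χ y • h (extChartAt (𝓡 L.dim) x y), χ.contMDiff_smul ?_, ?_⟩
  · exact hh.contMDiff.comp_contMDiffOn contMDiffOn_extChartAt
  · filter_upwards [χ.eventuallyEq_one] with y hy
    simp [hy]

/-- A smooth function with support in a neighbourhood of `x` and value `1` at `x`. -/
theorem exists_cutoff {x : L.X} {U : Set L.X} (hU : U ∈ nhds x) :
    ∃ c : L.X → 𝕜, ContMDiff (𝓡 L.dim) 𝓘(ℝ, 𝕜) ∞ c ∧ c x = 1 ∧ ∀ y ∉ U, c y = 0 := by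
  obtain ⟨χ, -, hχ⟩ := (SmoothBumpFunction.nhds_basis_tsupport (I := 𝓡 L.dim) x).mem_iff.1 hU
  refine ⟨fun y => ((χ y : ℝ) : 𝕜),
    (RCLike.ofRealCLM (K := 𝕜)).contDiff.contMDiff.comp χ.contMDiff, by simp, fun y hy => ?_⟩
  simp [show χ y = 0 from image_eq_zero_of_notMem_tsupport fun h => hy (hχ h)]

/-- The evaluation at a point. -/
def eval (x : L.X) (n : ℤ) : L.Fun n →ₗ[𝕜] L.fib x :=
  LinearMap.proj x ∘ₗ (L.Fun n).subtype

/-- A Leibniz rule for multiplication by smooth functions already forces locality and dependence on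
first derivatives only. This is the standard argument for derivations. -/
theorem isFirstOrderAt_of_leibniz {L : NManifold 𝕜} {x : L.X} {n : ℤ} {V : Type} [AddCommGroup V]
    [Module 𝕜 V] {D : L.Fun n →ₗ[𝕜] V}
    (δ : ∀ c : L.X → 𝕜, ContMDiff (𝓡 L.dim) 𝓘(ℝ, 𝕜) ∞ c → L.fib x →ₗ[𝕜] V)
    (hD : ∀ c hc (f : L.Fun n), D (L.smulFun c hc f) = δ c hc ((f : L.Sec) x) + c x • D f) :
    IsFirstOrderAt x D := by
  refine ⟨fun f hf => ?_, fun σ => ?_⟩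
  -- The function `c` is `1` at `x` and vanishes wherever `f` does not. So `c f = 0`, and the
  -- Leibniz rule for `c f` reads `0 = D f`.
  · obtain ⟨c, hc, hcx, hc0⟩ := L.exists_cutoff (𝕜 := 𝕜) hf
    have h0 : L.smulFun c hc f = 0 := by
      ext1
      funext y
      by_cases hy : (f : L.Sec) y = 0
      · simp [smulFun, hy]
      · simp [smulFun, hc0 y hy]
    have h1 := hD c hc f
    rw [h0, hf.self_of_nhds, hcx, map_zero, map_zero, one_smul, zero_add] at h1
    exact h1.symm
  · have hz : ∀ j, ContDiff ℝ ∞ fun z : EuclideanSpace ℝ (Fin L.dim) =>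
        ((z j - extChartAt (𝓡 L.dim) x x j : ℝ) : 𝕜) := fun j =>
      (RCLike.ofRealCLM (K := 𝕜)).contDiff.comp (by fun_prop)
    choose z hzs hz using fun j => L.exists_eq_in_chart x (hz j)
    -- As `z j` vanishes at `x`, only the `δ`-term of `D (z j · c j · σ)` survives, and it sees `c
    -- j` through its value at `x`.
    refine ⟨D σ, fun j => δ (z j) (hzs j) ((σ : L.Sec) x), fun a h hh => ?_⟩
    choose c hc hch using fun j => L.exists_eq_in_chart x (hh j)
    refine ⟨a • σ + ∑ j, L.smulFun (z j) (hzs j) (L.smulFun (c j) (hc j) σ), ?_, ?_⟩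
    · filter_upwards [Filter.eventually_all.2 hz, Filter.eventually_all.2 hch] with y hy hy'
      simp [Finset.sum_apply, smulFun, hy, hy', add_smul, Finset.sum_smul, smul_smul,
        RCLike.real_smul_eq_coe_mul]
    · rw [map_add, map_smul, map_sum]
      congr 1
      refine Finset.sum_congr rfl fun j _ => ?_
      rw [hD, (hz j).self_of_nhds, ← (hch j).self_of_nhds]
      simp [smulFun]

theorem isFirstOrderAt_eval (x : L.X) (n : ℤ) : IsFirstOrderAt x (L.eval x n) :=
  isFirstOrderAt_of_leibniz (fun _ _ => 0) fun c hc f => by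
    simp [eval, smulFun]

end NManifold

namespace NQManifold

variable {𝕜 : Type} [RCLike 𝕜] (L : NQManifold 𝕜)

theorem Q_congr {m n : ℤ} (h : m = n) {f : L.Fun m} {g : L.Fun n} (hfg : (f : L.Sec) = g) :
    (L.Q m f : L.Sec) = L.Q n g := by
  subst h
  rw [Subtype.ext hfg]

/-- Here the correction term in the Leibniz rule is multiplication by `(Q c)(x)`. -/
theorem isFirstOrderAt_Q (x : L.X) (n : ℤ) :
    NManifold.IsFirstOrderAt x (L.eval x (n + 1) ∘ₗ L.Q n) :=
  NManifold.isFirstOrderAt_of_leibniz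
    (fun c hc => LinearMap.mulLeft 𝕜 ((L.Q 0 (L.ofSmooth c hc) : L.Sec) x)) fun c hc f => by
    have h := L.Q_mul (L.ofSmooth c hc) f
    rw [L.Q_congr (zero_add n) (L.ofSmooth_mul c hc f)] at h
    have hx := congrFun h x
    simpa [NManifold.eval, NManifold.ofSmooth, Algebra.smul_def] using hx

end NQManifold

namespace NQHom

variable {𝕜 : Type} [RCLike 𝕜] {L' L : NQManifold 𝕜} (ψ : NQHom L' L)

theorem pull_congr {m n : ℤ} (h : m = n) {f : L.Fun m} {g : L.Fun n} (hfg : (f : L.Sec) = g) :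
    (ψ.pull m f : L'.Sec) = ψ.pull n g := by
  subst h
  rw [Subtype.ext hfg]

/-- The pull-back multiplies by `c ∘ γ`, so it has order zero at the image point `γ x'`. -/
theorem exists_isFirstOrderAt_pull (x' : L'.X) : ∃ x : L.X, ∀ n : ℤ,
    NManifold.IsFirstOrderAt x (L'.eval x' n ∘ₗ ψ.pull n) := by
  obtain ⟨γ, -, hγ⟩ := ψ.covers
  refine ⟨γ x', fun n => NManifold.isFirstOrderAt_of_leibniz (fun _ _ => 0) fun c hc f => ?_⟩
  have h := congrArg Subtype.val (ψ.pull_mul (L.ofSmooth c hc) f)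
  rw [ψ.pull_congr (zero_add n) (L.ofSmooth_mul c hc f)] at h
  have hx := congrFun h x'
  have hc' := hγ (L.ofSmooth c hc) c (fun _ => rfl) x'
  simp [NManifold.mul, hc'] at hx
  simp [NManifold.eval, hx, Algebra.smul_def]

end NQHom

/-! ### Paths of a super-curve in a fibre and the iterated integral -/

namespace NManifold

variable {𝕜 : Type} [RCLike 𝕜] {L : NManifold 𝕜}

theorem IsSmoothFamily.exists_smoothFam {n : ℤ} {F : unitInterval → L.Fun n}
    (hF : IsSmoothFamily F) : ∃ G : ℝ → L.Fun n, SmoothFam n (fun t => (G t : L.Sec)) ∧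
      ∀ t : unitInterval, G t = F t := by
  obtain ⟨G, hG, h⟩ := hF
  exact ⟨G, ⟨fun t x => (G t).2.1 x, hG⟩, h⟩

theorem IsFirstOrderAt.mem_contPaths {x : L.X} {n : ℤ} {V : Type} [Ring V]
    [Algebra 𝕜 V] {D : L.Fun n →ₗ[𝕜] V} (hD : IsFirstOrderAt x D) {F : unitInterval → L.Fun n}
    (hF : IsSmoothFamily F) : (fun t => D (F t)) ∈ contPaths 𝕜 V := by
  obtain ⟨G, hG, h⟩ := hF.exists_smoothFam
  obtain ⟨H, hH, hGH⟩ := hG.exists_primitive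
  simpa only [h] using (hD.map_primitive (H := fun t => ⟨H t, hH.mem_Fun t⟩) hG hGH).1

theorem IsSmoothFamily.mem_contPaths {n : ℤ} {F : unitInterval → L.Fun n}
    (hF : IsSmoothFamily F) (x : L.X) : (fun t => (F t : L.Sec) x) ∈ contPaths 𝕜 (L.fib x) :=
  (L.isFirstOrderAt_eval x n).mem_contPaths hF

variable (𝕜) in
/-- The constant paths. -/
def constPath {V : Type} [Ring V] [Algebra 𝕜 V] : V →ₗ[𝕜] contPaths 𝕜 V where
  toFun v := ⟨fun _ => v, const_mem_contPaths v⟩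
  map_add' _ _ := rfl
  map_smul' _ _ := rfl

/-- The value of a path at the time `t`. -/
def pathAt {V : Type} [Ring V] [Algebra 𝕜 V] (t : unitInterval) : contPaths 𝕜 V →ₗ[𝕜] V where
  toFun g := (g : unitInterval → V) t
  map_add' _ _ := rfl
  map_smul' _ _ := rfl

end NManifold

namespace SuperCurve

variable {𝕜 : Type} [RCLike 𝕜] {M L : NQManifold 𝕜} (φ : SuperCurve M L) (x : L.X)

/-- The path of the values of the body of the superfield at `x`. -/
def bodyPath : M.Functions →ₗ[𝕜] contPaths 𝕜 (L.fib x) :=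
  M.lift fun n =>
    { toFun := fun f => ⟨fun t => (φ.body n f t : L.Sec) x, (φ.smooth_body f).mem_contPaths x⟩
      map_add' := fun f g => by ext; simp
      map_smul' := fun a f => by ext; simp }

/-- The path of the values of the `θ`-component of the superfield at `x`. -/
def thetaPath : M.Functions →ₗ[𝕜] contPaths 𝕜 (L.fib x) :=
  M.lift fun n =>
    { toFun := fun f => ⟨fun t => (φ.theta n f t : L.Sec) x, (φ.smooth_theta f).mem_contPaths x⟩
      map_add' := fun f g => by ext; simp
      map_smul' := fun a f => by ext; simp }

theorem bodyPath_of {n : ℤ} (f : M.Fun n) (t : unitInterval) :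
    (φ.bodyPath x (M.of n f) : unitInterval → L.fib x) t = (φ.body n f t : L.Sec) x := by
  rw [bodyPath, NManifold.lift_of]
  rfl

theorem thetaPath_of {n : ℤ} (f : M.Fun n) (t : unitInterval) :
    (φ.thetaPath x (M.of n f) : unitInterval → L.fib x) t = (φ.theta n f t : L.Sec) x := by
  rw [thetaPath, NManifold.lift_of]
  rfl

theorem bodyPath_mul (f g : M.Functions) :
    φ.bodyPath x (f * g) = φ.bodyPath x f * φ.bodyPath x g := by
  induction f using NManifold.functions_induction with
  | zero => simp
  | add f f' hf hf' => simp only [add_mul, map_add, hf, hf']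
  | of m f =>
    induction g using NManifold.functions_induction with
    | zero => simp
    | add g g' hg hg' => simp only [mul_add, map_add, hg, hg']
    | of n g =>
      ext t
      rw [NManifold.of_mul_of, bodyPath_of, body_mul]
      simp only [MulMemClass.coe_mul, Pi.mul_apply, bodyPath_of]
      rfl

theorem thetaPath_mul (f g : M.Functions) : φ.thetaPath x (f * g) =
    φ.thetaPath x f * φ.bodyPath x g + φ.bodyPath x (M.sgn f) * φ.thetaPath x g := by
  induction f using NManifold.functions_induction with
  | zero => simp
  | add f f' hf hf' => simp only [add_mul, map_add, hf, hf']; abel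
  | of m f =>
    induction g using NManifold.functions_induction with
    | zero => simp
    | add g g' hg hg' => simp only [mul_add, map_add, hg, hg']; abel
    | of n g =>
      ext t
      rw [NManifold.of_mul_of, thetaPath_of, theta_mul, NQManifold.sgn_of, map_smul]
      simp only [Subalgebra.coe_add, MulMemClass.coe_mul, Subalgebra.coe_smul, Pi.add_apply,
        Pi.mul_apply, Pi.smul_apply, bodyPath_of, thetaPath_of, smul_mul_assoc,
        Int.cast_smul_eq_zsmul]

/-- The path of the values of `d (theta f)` at `x`. -/
def dThetaPath {n : ℤ} (f : M.Fun n) : contPaths 𝕜 (L.fib x) :=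
  ⟨fun t => (L.Q (n - 1) (φ.theta n f t) : L.Sec) x,
    (L.isFirstOrderAt_Q x (n - 1)).mem_contPaths (φ.smooth_theta f)⟩

/-- This is the super-curve equation `∂_t f = (Qf)_θ + d f_θ`; it is used to replace `d f_θ` by a
time derivative. -/
theorem hasPathDeriv_bodyPath {n : ℤ} (f : M.Fun n) :
    NManifold.HasPathDeriv 𝕜 (φ.bodyPath x (M.of n f) : unitInterval → L.fib x)
      (φ.thetaPath x (M.QA (M.of n f)) + φ.dThetaPath x f : contPaths 𝕜 (L.fib x)) := by
  intro l t
  have h := φ.theta_Q f x l t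
  simp only [bodyPath_of, NQManifold.QA_of, Subalgebra.coe_add, Pi.add_apply, thetaPath_of]
  exact h

/-- The integral `∫_0^t dt₁ ∂_θ f_1 ⋯ ∫_0^{t_{n-1}} dt_n ∂_θ f_n · f_{n+1}(0)` at `x`, as a function
of the upper limit. -/
def tailInt : ∀ n : ℕ, M.TPow (n + 1) →ₗ[𝕜] contPaths 𝕜 (L.fib x)
  | 0 => NManifold.constPath 𝕜 ∘ₗ NManifold.pathAt 0 ∘ₗ φ.bodyPath x ∘ₗ
      (PiTensorProduct.subsingletonEquiv (R := 𝕜) (s := fun _ : Fin 1 => M.Functions) (0 : Fin 1)).toLinearMap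
  | n + 1 => M.uncons
      (((LinearMap.mul 𝕜 (contPaths 𝕜 (L.fib x))).compl₁₂ (φ.thetaPath x) (tailInt n)).compr₂
        NManifold.pathIntegral)

theorem tailInt_zero (v : Fin 1 → M.Functions) : φ.tailInt x 0 (PiTensorProduct.tprod 𝕜 v) =
    NManifold.constPath 𝕜 ((φ.bodyPath x (v 0) : unitInterval → L.fib x) 0) := by
  simp [tailInt]
  rfl

theorem tailInt_succ {n : ℕ} (f : M.Functions) (w : M.TPow (n + 1)) :
    φ.tailInt x (n + 1) (M.cons (n + 1) f w) =
      NManifold.pathIntegral (φ.thetaPath x f * φ.tailInt x n w) := by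
  simp [tailInt, NQManifold.uncons_cons]

/-- The value of the iterated integral of `f_0 [f_1 | ⋯ | f_q] f_{q+1}` at `x`. -/
def iterInt (q : ℕ) : M.TPow (q + 2) →ₗ[𝕜] L.fib x :=
  M.uncons (((LinearMap.mul 𝕜 (contPaths 𝕜 (L.fib x))).compl₁₂ (φ.bodyPath x)
    (φ.tailInt x q)).compr₂ (NManifold.pathAt 1))

theorem iterInt_cons {q : ℕ} (f : M.Functions) (w : M.TPow (q + 1)) :
    φ.iterInt x q (M.cons (q + 1) f w) = (φ.bodyPath x f : unitInterval → L.fib x) 1 *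
      (φ.tailInt x q w : unitInterval → L.fib x) 1 := by
  simp [iterInt, NQManifold.uncons_cons]
  rfl

end SuperCurve

/-! ### Comparison with the nested integral, and smoothness -/

namespace NQManifold

variable {𝕜 : Type} [RCLike 𝕜] (M : NQManifold 𝕜)

/-- The tensor product of homogeneous functions. -/
def tens {n : ℕ} (e : Fin n → ℤ) (f : ∀ i, M.Fun (e i)) : M.TPow n :=
  PiTensorProduct.tprod 𝕜 fun i => M.of (e i) (f i)

theorem tens_succ {n : ℕ} (e : Fin (n + 1) → ℤ) (f : ∀ i, M.Fun (e i)) :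
    M.tens e f = M.cons n (M.of (e 0) (f 0)) (M.tens (fun i => e i.succ) fun i => f i.succ) := by
  rw [tens, tens, cons_tprod]
  congr 1
  funext j
  refine Fin.cases ?_ (fun j => ?_) j <;> simp

end NQManifold

namespace NManifold

variable {𝕜 : Type} [RCLike 𝕜] {L : NManifold 𝕜} (x : L.X)

theorem nestedIntegral_mem (l : List (unitInterval → L.Sec))
    (hl : ∀ g ∈ l, (fun t => g t x) ∈ contPaths 𝕜 (L.fib x)) :
    (fun t => nestedIntegral L l t x) ∈ contPaths 𝕜 (L.fib x) := by
  induction l with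
  | nil => exact const_mem_contPaths 1
  | cons g l ih =>
    have h1 := mul_mem (hl g (by simp)) (ih fun g hg => hl g (by simp [hg]))
    exact fiberIntegral_mem h1

end NManifold

namespace SuperCurve

variable {𝕜 : Type} [RCLike 𝕜] {M L : NQManifold 𝕜} (φ : SuperCurve M L) (x : L.X)

/-- Right multiplication by the constant `f_{n+1}(0)` is linear, so it can be moved out of all
integrals. -/
theorem tailInt_tens {n : ℕ} (e : Fin (n + 1) → ℤ) (f : ∀ i, M.Fun (e i)) (t : unitInterval) :
    (φ.tailInt x n (M.tens e f) : unitInterval → L.fib x) t =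
      NManifold.nestedIntegral L.toNManifold
        (List.ofFn fun (i : Fin n) (t : unitInterval) => (φ.theta _ (f i.castSucc) t : L.Sec)) t x *
      (φ.body _ (f (Fin.last n)) 0 : L.Sec) x := by
  induction n generalizing t with
  | zero =>
    rw [NQManifold.tens, tailInt_zero, bodyPath_of]
    simp [NManifold.nestedIntegral]
    rfl
  | succ n ih =>
    rw [NQManifold.tens_succ, tailInt_succ, NManifold.pathIntegral_apply, List.ofFn_succ]
    have h1 : (fun t : unitInterval => (φ.theta _ (f (0 : Fin (n + 1)).castSucc) t : L.Sec) x *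
        NManifold.nestedIntegral L.toNManifold (List.ofFn fun (i : Fin n) (t : unitInterval) =>
          (φ.theta _ (f i.succ.castSucc) t : L.Sec)) t x) ∈ contPaths 𝕜 (L.fib x) := by
      refine mul_mem ((φ.smooth_theta _).mem_contPaths x) (NManifold.nestedIntegral_mem x _ ?_)
      intro g hg
      obtain ⟨i, rfl⟩ := (List.mem_ofFn' _ _).1 hg
      exact (φ.smooth_theta _).mem_contPaths x
    have h2 := NManifold.fiberIntegral_comp h1
      (LinearMap.mulRight 𝕜 ((φ.body _ (f (Fin.last (n + 1))) 0 : L.Sec) x))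
      (NManifold.comp_mem_contPaths h1 _) t
    rw [LinearMap.mulRight_apply] at h2
    rw [NManifold.nestedIntegral]
    refine Eq.trans ?_ h2
    congr 1
    funext s
    rw [MulMemClass.coe_mul, Pi.mul_apply, ih, thetaPath_of, LinearMap.mulRight_apply, ← mul_assoc]
    rfl

theorem iterInt_tens {q : ℕ} (e : Fin (q + 2) → ℤ) (f : ∀ i, M.Fun (e i)) :
    φ.iterInt x q (M.tens e f) = iteratedIntegral φ e f x := by
  rw [NQManifold.tens_succ, iterInt_cons, tailInt_tens, bodyPath_of, ← mul_assoc]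
  rfl

/-- The integral `tailInt` depends smoothly on the upper limit and on the point. -/
theorem exists_smoothFam_tailInt {n : ℕ} (e : Fin (n + 1) → ℤ) (f : ∀ i, M.Fun (e i)) {k : ℤ}
    (hk : k = ∑ i, e i - n) :
    ∃ G : ℝ → L.Fun k, NManifold.SmoothFam k (fun t => (G t : L.Sec)) ∧
      ∀ (t : unitInterval) (x : L.X),
        (G t : L.Sec) x = (φ.tailInt x n (M.tens e f) : unitInterval → L.fib x) t := by
  induction n generalizing k with
  | zero =>
    obtain rfl : k = e 0 := by simpa using hk
    refine ⟨fun _ => φ.body _ (f 0) 0, NManifold.SmoothFam.const (φ.body _ (f 0) 0).2,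
      fun t x => ?_⟩
    rw [NQManifold.tens, tailInt_zero, bodyPath_of]
    rfl
  | succ n ih =>
    obtain ⟨G, hG, hG'⟩ := ih (fun i => e i.succ) (fun i => f i.succ) rfl
    obtain ⟨Θ, hΘ, hΘ'⟩ := (φ.smooth_theta (f 0)).exists_smoothFam
    have hm := hΘ.mul hG
    rw [show e 0 - 1 + (∑ i : Fin (n + 1), e i.succ - n) = k by
      rw [hk, Fin.sum_univ_succ e]; push_cast; ring] at hm
    obtain ⟨H, hH, hH'⟩ := hm.exists_primitive
    refine ⟨fun t => ⟨H t, hH.mem_Fun t⟩, hH, fun t x => ?_⟩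
    have h := ((L.isFirstOrderAt_eval x k).map_primitive (G := fun t => ⟨_, hm.mem_Fun t⟩)
      (H := fun t => ⟨H t, hH.mem_Fun t⟩) hm hH').2 t
    refine h.trans ?_
    rw [NQManifold.tens_succ, tailInt_succ, NManifold.pathIntegral_apply]
    congr 1
    funext s
    rw [MulMemClass.coe_mul, Pi.mul_apply, ← hG', thetaPath_of, ← hΘ']
    rfl

end SuperCurve

/-! ### The differential and the pull-back of nested integrals -/

namespace SuperCurve

open NManifold (pathIntegral pathAt)

variable {𝕜 : Type} [RCLike 𝕜] {M L : NQManifold 𝕜} (φ : SuperCurve M L) (x : L.X)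

/-- The differential of `tailInt`, expressed by the differentials of the bar complex and the
boundary term at the upper limit. -/
def tailDiff : ∀ n : ℕ, M.TPow (n + 1) →ₗ[𝕜] contPaths 𝕜 (L.fib x)
  | 0 => φ.tailInt x 0 ∘ₗ M.tailQ 0
  | n + 1 => φ.tailInt x (n + 1) ∘ₗ M.tailQ (n + 1) + φ.tailInt x n ∘ₗ M.tailMul n +
      M.uncons ((LinearMap.mul 𝕜 (contPaths 𝕜 (L.fib x))).compl₁₂ (φ.bodyPath x) (φ.tailInt x n))

theorem tailDiff_succ_cons {n : ℕ} (f : M.Functions) (w : M.TPow (n + 1)) :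
    φ.tailDiff x (n + 1) (M.cons (n + 1) f w) =
      φ.tailInt x (n + 1) (M.tailQ (n + 1) (M.cons (n + 1) f w)) +
        φ.tailInt x n (M.tailMul n (M.cons (n + 1) f w)) + φ.bodyPath x f * φ.tailInt x n w := by
  simp [tailDiff, NQManifold.uncons_cons]

/-- The innermost integral: the remaining factor is constant in time, and the boundary value at `0`
is absorbed into it because `f ↦ f(0)` is multiplicative. -/
theorem pathIntegral_deriv_zero {m : ℤ} (f : M.Fun m) (w : M.TPow 1) :
    pathIntegral ((φ.thetaPath x (M.QA (M.of m f)) + φ.dThetaPath x f) * φ.tailInt x 0 w) =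
      φ.bodyPath x (M.of m f) * φ.tailInt x 0 w - φ.tailInt x 0 (M.mulHead 0 (M.of m f) w) := by
  revert w
  refine LinearMap.congr_fun (f := pathIntegral ∘ₗ LinearMap.mulLeft 𝕜
    (φ.thetaPath x (M.QA (M.of m f)) + φ.dThetaPath x f) ∘ₗ φ.tailInt x 0)
    (g := LinearMap.mulLeft 𝕜 (φ.bodyPath x (M.of m f)) ∘ₗ φ.tailInt x 0 -
      φ.tailInt x 0 ∘ₗ M.mulHead 0 (M.of m f)) (M.tPow_hom_ext fun v => ?_)
  simp only [LinearMap.comp_apply, LinearMap.sub_apply, LinearMap.mulLeft_apply]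
  have hv : M.mulHead 0 (M.of m f) (PiTensorProduct.tprod 𝕜 v) =
      PiTensorProduct.tprod 𝕜 fun _ => M.of m f * v 0 := by
    rw [← Fin.cons_self_tail v, ← NQManifold.cons_tprod, NQManifold.mulHead_cons,
      NQManifold.cons_tprod]
    congr 1
    funext j
    fin_cases j
    rfl
  rw [hv, tailInt_zero, tailInt_zero, bodyPath_mul]
  set c := (φ.bodyPath x (v 0) : unitInterval → L.fib x) 0
  set b' := φ.thetaPath x (M.QA (M.of m f)) + φ.dThetaPath x f
  ext t
  have h := NManifold.fiberIntegral_comp b'.2 (LinearMap.mulRight 𝕜 c)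
    (NManifold.comp_mem_contPaths b'.2 _) t
  rw [NManifold.fiberIntegral_deriv (φ.hasPathDeriv_bodyPath x f) b'.2, LinearMap.mulRight_apply,
    sub_mul] at h
  exact h

theorem pathIntegral_deriv_succ {n : ℕ} {m : ℤ} (f : M.Fun m) (g : M.Functions)
    (w : M.TPow (n + 1)) :
    pathIntegral ((φ.thetaPath x (M.QA (M.of m f)) + φ.dThetaPath x f) *
        φ.tailInt x (n + 1) (M.cons (n + 1) g w)) =
      φ.bodyPath x (M.of m f) * φ.tailInt x (n + 1) (M.cons (n + 1) g w) -
        pathIntegral (φ.bodyPath x (M.of m f) * (φ.thetaPath x g * φ.tailInt x n w)) := by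
  rw [tailInt_succ]
  ext t
  exact NManifold.fiberIntegral_by_parts (φ.hasPathDeriv_bodyPath x f) (Subtype.property _)
    (Subtype.property _) (Subtype.property _) t

/-- The right-hand side is what the Leibniz rule gives for the differential of `f_θ T(w)` under the
integral. After replacing `d f_θ` and integrating by parts, the term with `f · g_θ` and the boundary
term of `tailDiff x n w` add up to `-((sgn f) g)_θ`, the first product in `tailMul`. -/
theorem tailDiff_succ_of {n : ℕ} {m : ℤ} (f : M.Fun m) (w : M.TPow (n + 1)) :
    φ.tailDiff x (n + 1) (M.cons (n + 1) (M.of m f) w) =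
      pathIntegral (φ.dThetaPath x f * φ.tailInt x n w -
        φ.thetaPath x (M.sgn (M.of m f)) * φ.tailDiff x n w) := by
  have hd : ∀ w : M.TPow (n + 1), φ.dThetaPath x f * φ.tailInt x n w =
      (φ.thetaPath x (M.QA (M.of m f)) + φ.dThetaPath x f) * φ.tailInt x n w -
        φ.thetaPath x (M.QA (M.of m f)) * φ.tailInt x n w := fun w => by rw [add_mul]; abel
  cases n with
  | zero =>
    rw [tailDiff_succ_cons, NQManifold.tailQ_succ_cons, hd, map_sub, map_sub, map_sub, map_neg,
      tailInt_succ, tailInt_succ, pathIntegral_deriv_zero, NQManifold.tailMul_zero_cons, tailDiff,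
      map_neg, LinearMap.comp_apply]
    abel
  | succ n =>
    revert w
    refine LinearMap.congr_fun (f := φ.tailDiff x (n + 2) ∘ₗ M.cons (n + 2) (M.of m f))
      (g := pathIntegral ∘ₗ (LinearMap.mulLeft 𝕜 (φ.dThetaPath x f) ∘ₗ φ.tailInt x (n + 1) -
        LinearMap.mulLeft 𝕜 (φ.thetaPath x (M.sgn (M.of m f))) ∘ₗ φ.tailDiff x (n + 1)))
      (M.tPow_succ_hom_ext fun g u => ?_)
    simp only [LinearMap.comp_apply, LinearMap.sub_apply, LinearMap.mulLeft_apply]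
    rw [tailDiff_succ_cons, tailDiff_succ_cons, NQManifold.tailQ_succ_cons _ _ (M.cons _ g u), hd,
      map_sub, map_sub, map_sub, map_neg, pathIntegral_deriv_succ,
      NQManifold.tailMul_succ_cons, map_sub, map_neg, NQManifold.mulHead_cons]
    simp only [tailInt_succ, thetaPath_mul, NQManifold.sgn_sgn, mul_add, map_add, add_mul,
      mul_assoc]
    abel

/-- The differential is moved under the integral and the graded Leibniz rule is applied to the
integrand. The claim is needed for every `t`, since the inner integrals have variable upper limits.
-/
theorem Q_tailInt {n : ℕ} (e : Fin (n + 1) → ℤ) (f : ∀ i, M.Fun (e i)) {k : ℤ}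
    (hk : k = ∑ i, e i - n) (G : unitInterval → L.Fun k)
    (hG : ∀ t x, (G t : L.Sec) x = (φ.tailInt x n (M.tens e f) : unitInterval → L.fib x) t)
    (t : unitInterval) (x : L.X) :
    (L.Q k (G t) : L.Sec) x = (φ.tailDiff x n (M.tens e f) : unitInterval → L.fib x) t := by
  induction n generalizing k t x with
  | zero =>
    obtain rfl : k = e 0 := by simpa using hk
    have h1 : G t = φ.body _ (f 0) 0 := by
      ext1
      funext y
      rw [hG, NQManifold.tens, tailInt_zero, bodyPath_of]
      rfl
    rw [h1, NQManifold.tens_succ, tailDiff, LinearMap.comp_apply, NQManifold.tailQ_zero_cons,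
      NQManifold.tens, NQManifold.cons_tprod, tailInt_zero, Fin.cons_zero, NQManifold.QA_of,
      ← body_Q, bodyPath_of]
    rfl
  | succ n ih =>
    obtain ⟨R, hR, hR'⟩ :=
      φ.exists_smoothFam_tailInt (fun i => e i.succ) (fun i => f i.succ) rfl
    obtain ⟨Θ, hΘ, hΘ'⟩ := (φ.smooth_theta (f 0)).exists_smoothFam
    have hm := hΘ.mul hR
    have hdeg : e 0 - 1 + (∑ i : Fin (n + 1), e i.succ - n) = k := by
      rw [hk, Fin.sum_univ_succ e]; push_cast; ring
    rw [hdeg] at hm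
    obtain ⟨H, hH, hH'⟩ := hm.exists_primitive
    -- Fibrewise integration agrees with the smooth primitive: evaluation at a point is itself a
    -- first-order operator.
    have hGH : G t = ⟨H t, hH.mem_Fun t⟩ := by
      ext1
      funext y
      have h := ((L.isFirstOrderAt_eval y k).map_primitive (G := fun t => ⟨_, hm.mem_Fun t⟩)
        (H := fun t => ⟨H t, hH.mem_Fun t⟩) hm hH').2 t
      refine Eq.trans ?_ h.symm
      rw [hG, NQManifold.tens_succ, tailInt_succ, NManifold.pathIntegral_apply]
      congr 1
      funext s
      rw [MulMemClass.coe_mul, Pi.mul_apply, ← hR', thetaPath_of, ← hΘ']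
      rfl
    have h := ((L.isFirstOrderAt_Q x k).map_primitive (G := fun t => ⟨_, hm.mem_Fun t⟩)
      (H := fun t => ⟨H t, hH.mem_Fun t⟩) hm hH').2 t
    rw [hGH]
    refine h.trans ?_
    rw [NQManifold.tens_succ, tailDiff_succ_of, NManifold.pathIntegral_apply]
    congr 1
    funext s
    have h1 : (L.Q k ⟨_, hm.mem_Fun s⟩ : L.Sec) = _ :=
      (L.Q_congr hdeg (f := L.mul (Θ s) (R s)) rfl).symm.trans (L.Q_mul (Θ s) (R s))
    have h2 := ih (fun i => e i.succ) (fun i => f i.succ) rfl (fun t => R t) hR' s x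
    refine (congrFun h1 x).trans ?_
    -- The `θ`-component has degree one less than `f`, which is the source of the minus sign in
    -- `tailDiff_succ_of`.
    have hs : ((e 0 - 1).negOnePow : ℤ) = -((e 0).negOnePow : ℤ) := by
      simp [Int.negOnePow_sub]
    have hθ : (φ.thetaPath x (M.sgn (M.of (e 0) (f 0))) : unitInterval → L.fib x) s =
        ((e 0).negOnePow : ℤ) • (φ.theta _ (f 0) s : L.Sec) x := by
      rw [NQManifold.sgn_of, map_smul, Subalgebra.coe_smul, Pi.smul_apply, thetaPath_of,
        Int.cast_smul_eq_zsmul]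
    simp only [Pi.add_apply, Pi.mul_apply, Pi.neg_apply, Pi.smul_apply, h2, hR', hΘ', hθ,
      Subalgebra.coe_sub, MulMemClass.coe_mul, Pi.sub_apply, hs, neg_smul, smul_mul_assoc]
    rw [sub_eq_add_neg (_ * _)]
    rfl

/-- Naturality in the parameter space: the same induction with the pull-back in place of the
differential, and multiplicativity in place of the Leibniz rule. -/
theorem pull_tailInt {L' : NQManifold 𝕜} (ψ : NQHom L' L) {φ' : SuperCurve M L'}
    (hφ : φ.IsPullback ψ φ') {n : ℕ} (e : Fin (n + 1) → ℤ) (f : ∀ i, M.Fun (e i)) {k : ℤ}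
    (hk : k = ∑ i, e i - n) (G : unitInterval → L.Fun k)
    (hG : ∀ t x, (G t : L.Sec) x = (φ.tailInt x n (M.tens e f) : unitInterval → L.fib x) t)
    (t : unitInterval) (x' : L'.X) : (ψ.pull k (G t) : L'.Sec) x' =
      (φ'.tailInt x' n (M.tens e f) : unitInterval → L'.fib x') t := by
  induction n generalizing k t x' with
  | zero =>
    obtain rfl : k = e 0 := by simpa using hk
    have h1 : G t = φ.body _ (f 0) 0 := by
      ext1
      funext y
      rw [hG, NQManifold.tens, tailInt_zero, bodyPath_of]
      rfl
    rw [h1, NQManifold.tens, tailInt_zero, bodyPath_of, ← (hφ _ _ _).1]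
    rfl
  | succ n ih =>
    obtain ⟨R, hR, hR'⟩ :=
      φ.exists_smoothFam_tailInt (fun i => e i.succ) (fun i => f i.succ) rfl
    obtain ⟨Θ, hΘ, hΘ'⟩ := (φ.smooth_theta (f 0)).exists_smoothFam
    have hm := hΘ.mul hR
    have hdeg : e 0 - 1 + (∑ i : Fin (n + 1), e i.succ - n) = k := by
      rw [hk, Fin.sum_univ_succ e]; push_cast; ring
    rw [hdeg] at hm
    obtain ⟨H, hH, hH'⟩ := hm.exists_primitive
    have hGH : G t = ⟨H t, hH.mem_Fun t⟩ := by
      ext1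
      funext y
      have h := ((L.isFirstOrderAt_eval y k).map_primitive (G := fun t => ⟨_, hm.mem_Fun t⟩)
        (H := fun t => ⟨H t, hH.mem_Fun t⟩) hm hH').2 t
      refine Eq.trans ?_ h.symm
      rw [hG, NQManifold.tens_succ, tailInt_succ, NManifold.pathIntegral_apply]
      congr 1
      funext s
      rw [MulMemClass.coe_mul, Pi.mul_apply, ← hR', thetaPath_of, ← hΘ']
      rfl
    obtain ⟨y, hy⟩ := ψ.exists_isFirstOrderAt_pull x'
    have h := ((hy k).map_primitive (G := fun t => ⟨_, hm.mem_Fun t⟩)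
      (H := fun t => ⟨H t, hH.mem_Fun t⟩) hm hH').2 t
    rw [hGH]
    refine h.trans ?_
    rw [NQManifold.tens_succ, tailInt_succ, NManifold.pathIntegral_apply]
    congr 1
    funext s
    have h1 : (ψ.pull k ⟨_, hm.mem_Fun s⟩ : L'.Sec) = _ :=
      (ψ.pull_congr hdeg (f := L.mul (Θ s) (R s)) rfl).symm.trans
        (congrArg Subtype.val (ψ.pull_mul (Θ s) (R s)))
    have h2 := ih (fun i => e i.succ) (fun i => f i.succ) rfl (fun t => R t) hR' s x'
    refine (congrFun h1 x').trans ?_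
    rw [MulMemClass.coe_mul, Pi.mul_apply, ← h2, thetaPath_of, (hφ _ _ _).2, ← hΘ']
    rfl

end SuperCurve

/-- A module over a ring has additive inverses, so the universal property of the quotient needs only
a monoid structure on the target. -/
theorem Submodule.exists_comp_mkQ_eq {R A B : Type*} [Ring R] [AddCommGroup A] [Module R A]
    [AddCommMonoid B] [Module R B] (p : Submodule R A) (f : A →ₗ[R] B) (h : ∀ a ∈ p, f a = 0) :
    ∃ g : (A ⧸ p) →ₗ[R] B, g ∘ₗ p.mkQ = f := by
  let _ : AddCommGroup B := Module.addCommMonoidToAddCommGroup R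
  exact ⟨p.liftQ f h, p.liftQ_mkQ f h⟩

/-! ### The iterated integral and its differential -/

namespace SuperCurve

variable {𝕜 : Type} [RCLike 𝕜] {M L : NQManifold 𝕜} (φ : SuperCurve M L)

/-- The differential of the iterated integral, expressed by the bar differential. -/
def iterDiff (x : L.X) : ∀ q : ℕ, M.TPow (q + 2) →ₗ[𝕜] L.fib x
  | 0 => φ.iterInt x 0 ∘ₗ M.b0Part 0
  | q + 1 => φ.iterInt x (q + 1) ∘ₗ M.b0Part (q + 1) + φ.iterInt x q ∘ₗ M.b1Part q

/-- The boundary term of `tailDiff` at the upper limit `1`, multiplied by `(sgn f)(1)`, is the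
contribution of the first product in `b_1`. -/
theorem iterDiff_cons (x : L.X) {q : ℕ} (f : M.Functions) (w : M.TPow (q + 1)) :
    φ.iterDiff x q (M.cons (q + 1) f w) =
      (φ.bodyPath x (M.QA f) : unitInterval → L.fib x) 1 *
          (φ.tailInt x q w : unitInterval → L.fib x) 1 +
        (φ.bodyPath x (M.sgn f) : unitInterval → L.fib x) 1 *
          (φ.tailDiff x q w : unitInterval → L.fib x) 1 := by
  cases q with
  | zero =>
    rw [iterDiff, LinearMap.comp_apply, NQManifold.b0Part_cons, map_add, iterInt_cons, iterInt_cons]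
    rfl
  | succ q =>
    revert w
    refine LinearMap.congr_fun (f := φ.iterDiff x (q + 1) ∘ₗ M.cons (q + 2) f)
      (g := LinearMap.mulLeft 𝕜 ((φ.bodyPath x (M.QA f) : unitInterval → L.fib x) 1) ∘ₗ
        NManifold.pathAt 1 ∘ₗ φ.tailInt x (q + 1) +
        LinearMap.mulLeft 𝕜 ((φ.bodyPath x (M.sgn f) : unitInterval → L.fib x) 1) ∘ₗ
        NManifold.pathAt 1 ∘ₗ φ.tailDiff x (q + 1)) (M.tPow_succ_hom_ext fun g w => ?_)
    have h : ∀ p : contPaths 𝕜 (L.fib x), NManifold.pathAt 1 p = (p : unitInterval → L.fib x) 1 :=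
      fun _ => rfl
    simp only [iterDiff, LinearMap.comp_apply, LinearMap.add_apply, LinearMap.mulLeft_apply,
      NQManifold.b0Part_cons, NQManifold.b1Part_cons, NQManifold.mulHead_cons, map_add,
      iterInt_cons, tailDiff_succ_cons, bodyPath_mul, h, Subalgebra.coe_add, MulMemClass.coe_mul,
      Pi.add_apply, Pi.mul_apply, mul_assoc]
    abel

/-- A product of two homogeneous functions is exhibited, to which the Leibniz rule for `Q` and the
multiplicativity of pull-backs apply. -/
theorem exists_iterInt_eq_mul {q : ℕ} (e : Fin (q + 2) → ℤ) (f : ∀ i, M.Fun (e i)) :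
    ∃ G : unitInterval → L.Fun (∑ i : Fin (q + 1), e i.succ - q),
      (∀ t x, (G t : L.Sec) x =
        (φ.tailInt x q (M.tens (fun i => e i.succ) fun i => f i.succ) :
          unitInterval → L.fib x) t) ∧
      (fun x => φ.iterInt x q (M.tens e f)) = (L.mul (φ.body _ (f 0) 1) (G 1) : L.Sec) := by
  obtain ⟨G, -, hG⟩ := φ.exists_smoothFam_tailInt (fun i => e i.succ) (fun i => f i.succ) rfl
  refine ⟨fun t => G t, hG, funext fun x => ?_⟩
  rw [NQManifold.tens_succ, iterInt_cons, ← hG, bodyPath_of]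
  rfl

theorem deg_eq {q : ℕ} (e : Fin (q + 2) → ℤ) :
    e 0 + (∑ i : Fin (q + 1), e i.succ - q) = ∑ i, e i - q := by
  rw [Fin.sum_univ_succ e]
  ring

theorem iterInt_mem {q : ℕ} (e : Fin (q + 2) → ℤ) (f : ∀ i, M.Fun (e i)) :
    (fun x => φ.iterInt x q (M.tens e f)) ∈ L.Fun (∑ i, e i - q) := by
  obtain ⟨G, -, h⟩ := φ.exists_iterInt_eq_mul e f
  rw [h, ← deg_eq e]
  exact Subtype.property _

theorem Q_iterInt {q : ℕ} (e : Fin (q + 2) → ℤ) (f : ∀ i, M.Fun (e i)) (x : L.X) :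
    (L.Q _ ⟨_, φ.iterInt_mem e f⟩ : L.Sec) x = φ.iterDiff x q (M.tens e f) := by
  obtain ⟨G, hG, h⟩ := φ.exists_iterInt_eq_mul e f
  rw [← L.Q_congr (deg_eq e) (f := L.mul (φ.body _ (f 0) 1) (G 1)) h.symm, L.Q_mul,
    NQManifold.tens_succ, iterDiff_cons, ← φ.Q_tailInt _ _ rfl G hG 1 x, ← hG, NQManifold.QA_of,
    bodyPath_of, body_Q, NQManifold.sgn_of, map_smul, Subalgebra.coe_smul, Pi.smul_apply,
    bodyPath_of, Int.cast_smul_eq_zsmul, smul_mul_assoc]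
  rfl

theorem pull_iterInt {L' : NQManifold 𝕜} (ψ : NQHom L' L) {φ' : SuperCurve M L'}
    (hφ : φ.IsPullback ψ φ') {q : ℕ} (e : Fin (q + 2) → ℤ) (f : ∀ i, M.Fun (e i)) (x' : L'.X) :
    (ψ.pull _ ⟨_, φ.iterInt_mem e f⟩ : L'.Sec) x' = φ'.iterInt x' q (M.tens e f) := by
  obtain ⟨G, hG, h⟩ := φ.exists_iterInt_eq_mul e f
  rw [← ψ.pull_congr (deg_eq e) (f := L.mul (φ.body _ (f 0) 1) (G 1)) h.symm, ψ.pull_mul,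
    NQManifold.tens_succ, iterInt_cons, ← φ.pull_tailInt ψ hφ _ _ rfl G hG 1 x', bodyPath_of,
    (hφ _ _ _).1]
  rfl

theorem theta_zero (f : M.Fun 0) (t : unitInterval) : φ.theta 0 f t = 0 := by
  ext1
  funext x
  have h := (φ.theta 0 f t).2.1 x
  obtain ⟨i, hi⟩ := L.cover x
  rw [L.coord_gr i x hi] at h
  have h0 : GSym.homog 𝕜 L.d (0 - 1) = ⊥ := by
    rw [GSym.homog, Submodule.span_eq_bot]
    rintro w ⟨l, hl, -⟩
    omega
  rw [h0, Submodule.mem_bot] at h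
  simpa using h

theorem thetaPath_of_zero (x : L.X) (f : M.Fun 0) : φ.thetaPath x (M.of 0 f) = 0 := by
  ext t
  rw [thetaPath_of, theta_zero]
  rfl

theorem tailInt_eq_zero (x : L.X) {n : ℕ} (v : Fin (n + 1) → M.Functions) {j : Fin (n + 1)}
    (hj : j ≠ Fin.last n) (hv : φ.thetaPath x (v j) = 0) :
    φ.tailInt x n (PiTensorProduct.tprod 𝕜 v) = 0 := by
  induction n with
  | zero => exact absurd (Subsingleton.elim (α := Fin 1) _ _) hj
  | succ n ih =>
    rw [← Fin.cons_self_tail v, ← NQManifold.cons_tprod, tailInt_succ]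
    induction j using Fin.cases with
    | zero => rw [hv, zero_mul, map_zero]
    | succ j =>
      rw [ih (Fin.tail v) (j := j) (fun h => hj (by rw [h, Fin.succ_last])) hv, mul_zero, map_zero]

theorem iterInt_eq_zero (x : L.X) {q : ℕ} (v : Fin (q + 2) → M.Functions) {j : Fin (q + 2)}
    (hj0 : j ≠ 0) (hj : j ≠ Fin.last (q + 1)) (hv : φ.thetaPath x (v j) = 0) :
    φ.iterInt x q (PiTensorProduct.tprod 𝕜 v) = 0 := by
  obtain ⟨j, rfl⟩ := Fin.exists_succ_eq.2 hj0
  rw [← Fin.cons_self_tail v, ← NQManifold.cons_tprod, iterInt_cons,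
    φ.tailInt_eq_zero x (Fin.tail v) (j := j) (fun h => hj (by rw [h, Fin.succ_last])) hv]
  exact mul_zero _

end SuperCurve

/-! ### The iterated integral as a chain map on the bar complex -/

namespace NQManifold

variable {𝕜 : Type} [RCLike 𝕜] (M : NQManifold 𝕜)

/-- The iterated integral as a function on the space of super-curves. -/
def iterFun {q : ℕ} (e : Fin (q + 2) → ℤ) (f : ∀ i, M.Fun (e i)) :
    SuperCurveFun M (∑ i, e i - q) :=
  ⟨fun _ φ => ⟨_, φ.iterInt_mem e f⟩, fun _ _ ψ φ _ h =>
    Subtype.ext (funext fun x => (φ.pull_iterInt ψ h e f x).symm)⟩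

theorem superCurveFun_ext {n : ℤ} {F G : SuperCurveFun M n}
    (h : ∀ (L : NQManifold 𝕜) (φ : SuperCurve M L) (x : L.X),
      (F.1 L φ : L.Sec) x = (G.1 L φ : L.Sec) x) : F = G :=
  Subtype.ext (funext fun L => funext fun φ => Subtype.ext (funext fun x => h L φ x))

theorem of_update {n : ℕ} (e : Fin n → ℤ) (f : ∀ i, M.Fun (e i)) (j : Fin n) (g : M.Fun (e j)) :
    (fun i => M.of (e i) (Function.update f j g i)) =
      Function.update (fun i => M.of (e i) (f i)) j (M.of (e j) g) := by
  funext i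
  exact Function.apply_update (fun i => M.of (e i)) f j g i

/-- The iterated integral as a multilinear map on homogeneous functions. -/
def iterMultilinear {q : ℕ} (e : Fin (q + 2) → ℤ) :
    MultilinearMap 𝕜 (fun i => M.Fun (e i)) (SuperCurveFun M (∑ i, e i - q)) where
  toFun f := M.iterFun e f
  map_update_add' := by
    intro inst f j g g'
    obtain rfl : inst = instDecidableEqFin _ := Subsingleton.elim _ _
    refine M.superCurveFun_ext fun L φ x => ?_
    change φ.iterInt x q (M.tens _ _) = φ.iterInt x q (M.tens _ _) + φ.iterInt x q (M.tens _ _)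
    rw [tens, tens, tens, of_update, of_update, of_update, map_add,
      MultilinearMap.map_update_add, map_add]
  map_update_smul' := by
    intro inst f j a g
    obtain rfl : inst = instDecidableEqFin _ := Subsingleton.elim _ _
    refine M.superCurveFun_ext fun L φ x => ?_
    change φ.iterInt x q (M.tens _ _) = a • φ.iterInt x q (M.tens _ _)
    rw [tens, tens, of_update, of_update, map_smul, MultilinearMap.map_update_smul, map_smul]

/-- The iterated integral as a multilinear map. -/
def iterMul (q : ℕ) :
    MultilinearMap 𝕜 (fun _ : Fin (q + 2) => M.Functions) (SuperCurveFunctions M) :=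
  -- A multilinear map on direct sums is the same as a family of multilinear maps on the homogeneous
  -- parts, one for each tuple of degrees.
  MultilinearMap.fromDFinsuppEquiv (fun _ : Fin (q + 2) => ℤ) 𝕜 (M := fun _ n => M.Fun n) fun e =>
    (DirectSum.lof 𝕜 ℤ (fun n => SuperCurveFun M n) (∑ i, e i - q)).compMultilinearMap
      (M.iterMultilinear e)

theorem iterMul_of {q : ℕ} (e : Fin (q + 2) → ℤ) (f : ∀ i, M.Fun (e i)) :
    M.iterMul q (fun i => M.of (e i) (f i)) =
      DirectSum.lof 𝕜 ℤ (fun n => SuperCurveFun M n) _ (M.iterFun e f) :=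
  MultilinearMap.fromDFinsuppEquiv_single (R := 𝕜) (M := fun _ n => M.Fun n) _ e f

/-- The iterated integral on `B^{-q}`. -/
def iterPart (q : ℕ) : M.BarPart q →ₗ[𝕜] SuperCurveFunctions M :=
  PiTensorProduct.lift (M.iterMul q)

theorem iterPart_tens {q : ℕ} (e : Fin (q + 2) → ℤ) (f : ∀ i, M.Fun (e i)) :
    M.iterPart q (M.tens e f) = DirectSum.lof 𝕜 ℤ (fun n => SuperCurveFun M n) _ (M.iterFun e f) := by
  rw [iterPart, tens, PiTensorProduct.lift.tprod, iterMul_of]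

theorem barPart_hom_ext {q : ℕ} {Y : Type*} [AddCommMonoid Y] [Module 𝕜 Y]
    {g h : M.BarPart q →ₗ[𝕜] Y}
    (H : ∀ (e : Fin (q + 2) → ℤ) (f : ∀ i, M.Fun (e i)), g (M.tens e f) = h (M.tens e f)) :
    g = h := by
  refine PiTensorProduct.ext ?_
  refine MultilinearMap.dfinsupp_ext (M := fun _ n => M.Fun n) (κ := fun _ => ℤ) fun e => ?_
  exact MultilinearMap.ext fun f => H e f

/-- The elements of `B^{-q}` with an iterated integral of degree `k`. -/
def homogPart (q : ℕ) (k : ℤ) : Submodule 𝕜 (M.BarPart q) where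
  carrier := {w | ∃ F : SuperCurveFun M k,
    M.iterPart q w = DirectSum.lof 𝕜 ℤ (fun n => SuperCurveFun M n) k F ∧
    ∀ (L : NQManifold 𝕜) (φ : SuperCurve M L) (x : L.X), (F.1 L φ : L.Sec) x = φ.iterInt x q w}
  add_mem' := by
    rintro w w' ⟨F, hF, hF'⟩ ⟨G, hG, hG'⟩
    refine ⟨F + G, by rw [map_add, map_add, hF, hG], fun L φ x => ?_⟩
    rw [map_add, ← hF', ← hG']
    rfl
  zero_mem' := ⟨0, by simp, fun L φ x => by rw [map_zero]; rfl⟩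
  smul_mem' := by
    rintro a w ⟨F, hF, hF'⟩
    refine ⟨a • F, by rw [map_smul, map_smul, hF], fun L φ x => ?_⟩
    rw [map_smul, ← hF']
    rfl

/-- The degree `k` is only required to equal the natural one, so summands of `b` whose degrees agree
only by arithmetic land in a common space and can be added. -/
theorem tprod_mem_homogPart {q : ℕ} {k : ℤ} (e : Fin (q + 2) → ℤ) (hk : ∑ i, e i - q = k)
    {v : Fin (q + 2) → M.Functions} (hv : ∀ i, v i ∈ LinearMap.range (M.of (e i))) :
    PiTensorProduct.tprod 𝕜 v ∈ M.homogPart q k := by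
  choose f hf using hv
  obtain rfl : (fun i => M.of (e i) (f i)) = v := funext hf
  subst hk
  exact ⟨M.iterFun e f, M.iterPart_tens e f, fun L φ x => rfl⟩

theorem sgn_mem {n : ℤ} {f : M.Functions} (hf : f ∈ LinearMap.range (M.of n)) :
    M.sgn f ∈ LinearMap.range (M.of n) := by
  obtain ⟨g, rfl⟩ := hf
  rw [sgn_of]
  exact Submodule.smul_mem _ _ ⟨g, rfl⟩

theorem signBefore_mem {m : ℕ} (p : ℕ) (j : Fin m) {n : ℤ} {f : M.Functions}
    (hf : f ∈ LinearMap.range (M.of n)) : M.signBefore p j f ∈ LinearMap.range (M.of n) := by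
  unfold signBefore entrySgn
  split_ifs
  · exact M.sgn_mem hf
  · exact neg_mem (M.sgn_mem hf)
  · exact hf

theorem b0Part_tprod {q : ℕ} (v : Fin (q + 2) → M.Functions) :
    M.b0Part q (PiTensorProduct.tprod 𝕜 v) =
      ∑ i : Fin (q + 2), (if i = 0 ∨ i = Fin.last (q + 1) then (1 : 𝕜) else -1) •
        PiTensorProduct.tprod 𝕜 fun j => (if j = i then M.QA else M.signBefore i j) (v j) := by
  simp only [b0Part, LinearMap.sum_apply, LinearMap.smul_apply, PiTensorProduct.lift.tprod,
    MultilinearMap.compLinearMap_apply]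

theorem b1Part_tprod {q : ℕ} (v : Fin (q + 3) → M.Functions) :
    M.b1Part q (PiTensorProduct.tprod 𝕜 v) =
      ∑ i : Fin (q + 1), M.merge q i.castSucc (fun j => M.signBefore (i + 1) j (v j)) -
        M.merge q (Fin.last (q + 1)) (fun j => M.signBefore (q + 1) j (v j)) := by
  simp only [b1Part, LinearMap.sum_apply, LinearMap.sub_apply, PiTensorProduct.lift.tprod,
    MultilinearMap.compLinearMap_apply]

theorem b0Part_mem {q : ℕ} (e : Fin (q + 2) → ℤ) (f : ∀ i, M.Fun (e i)) :
    M.b0Part q (M.tens e f) ∈ M.homogPart q (∑ i, e i - q + 1) := by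
  rw [tens, b0Part_tprod]
  have hk : ∀ i : Fin (q + 2), ∑ j, (e j + if j = i then 1 else 0) - q = ∑ j, e j - q + 1 := by
    intro i
    rw [Finset.sum_add_distrib, Finset.sum_ite_eq' Finset.univ i, if_pos (Finset.mem_univ i)]
    ring
  have hv : ∀ i j : Fin (q + 2), (if j = i then M.QA else M.signBefore i j) (M.of (e j) (f j)) ∈
      LinearMap.range (M.of (e j + if j = i then 1 else 0)) := by
    intro i j
    by_cases h : j = i
    · rw [if_pos h, if_pos h, QA_of]
      exact LinearMap.mem_range_self _ _
    · rw [if_neg h, if_neg h, add_zero]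
      exact M.signBefore_mem _ _ (LinearMap.mem_range_self _ _)
  have h := fun i => M.tprod_mem_homogPart _ (hk i) (hv i)
  exact Submodule.sum_mem _ fun i _ => Submodule.smul_mem _ _ (h i)

theorem sum_contractNth {n : ℕ} (i : Fin n) (e : Fin (n + 1) → ℤ) :
    ∑ k, Fin.contractNth i.castSucc (· + ·) e k = ∑ k, e k := by
  induction n with
  | zero => exact i.elim0
  | succ n ih =>
    rw [← Fin.cons_self_tail e]
    induction i using Fin.cases with
    | zero =>
      rw [← Fin.cons_self_tail (Fin.tail e)]
      have h := contractNth_zero_cons_cons (· + ·) (e 0) (Fin.tail e 0) (Fin.tail (Fin.tail e))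
      rw [Fin.castSucc_zero, h]
      simp [Fin.sum_univ_succ, add_assoc]
      rfl
    | succ i =>
      have h := contractNth_succ_cons (· + ·) i.castSucc (e 0) (Fin.tail e)
      rw [← Fin.succ_castSucc, h, Fin.sum_univ_succ, Fin.sum_univ_succ]
      simp [ih]

theorem mul_mem_range_of {m n : ℤ} {f g : M.Functions} (hf : f ∈ LinearMap.range (M.of m))
    (hg : g ∈ LinearMap.range (M.of n)) : f * g ∈ LinearMap.range (M.of (m + n)) := by
  obtain ⟨f, rfl⟩ := hf
  obtain ⟨g, rfl⟩ := hg
  rw [M.of_mul_of]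
  exact LinearMap.mem_range_self _ _

theorem contractNth_mem_range_of {n : ℕ} (i : Fin (n + 1)) (e : Fin (n + 1) → ℤ)
    {v : Fin (n + 1) → M.Functions} (hv : ∀ j, v j ∈ LinearMap.range (M.of (e j))) (j : Fin n) :
    Fin.contractNth i (· * ·) v j ∈
      LinearMap.range (M.of (Fin.contractNth i (· + ·) e j)) := by
  rcases lt_trichotomy (j : ℕ) i with h | h | h
  · rw [Fin.contractNth_apply_of_lt _ _ _ _ h, Fin.contractNth_apply_of_lt _ _ _ _ h]
    exact hv _
  · rw [Fin.contractNth_apply_of_eq _ _ _ _ h, Fin.contractNth_apply_of_eq _ _ _ _ h]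
    exact M.mul_mem_range_of (hv _) (hv _)
  · rw [Fin.contractNth_apply_of_gt _ _ _ _ h, Fin.contractNth_apply_of_gt _ _ _ _ h]
    exact hv _

theorem merge_mem {q : ℕ} (i : Fin (q + 2)) (e : Fin (q + 3) → ℤ) {v : Fin (q + 3) → M.Functions}
    (hv : ∀ j, v j ∈ LinearMap.range (M.of (e j))) :
    M.merge q i v ∈ M.homogPart q (∑ i, e i - (q + 1 : ℕ) + 1) := by
  have hk : ∑ j, Fin.contractNth i.castSucc (· + ·) e j - (q : ℤ) =
      ∑ i, e i - (q + 1 : ℕ) + 1 := by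
    rw [sum_contractNth]
    push_cast
    ring
  rw [merge_apply]
  exact M.tprod_mem_homogPart _ hk (M.contractNth_mem_range_of _ e hv)

theorem b1Part_mem {q : ℕ} (e : Fin (q + 3) → ℤ) (f : ∀ i, M.Fun (e i)) :
    M.b1Part q (M.tens e f) ∈ M.homogPart q (∑ i, e i - (q + 1 : ℕ) + 1) := by
  rw [tens, b1Part_tprod]
  have h := fun (p : ℕ) (i : Fin (q + 2)) =>
    M.merge_mem i e (v := fun j => M.signBefore p j (M.of (e j) (f j)))
      fun j => M.signBefore_mem _ _ (LinearMap.mem_range_self _ _)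
  exact Submodule.sub_mem _ (Submodule.sum_mem _ fun i _ => h _ _) (h _ _)

/-- The iterated integral on the bar complex. -/
def iter : M.Bar →ₗ[𝕜] SuperCurveFunctions M :=
  DirectSum.toModule 𝕜 ℕ _ M.iterPart

theorem iter_lof (q : ℕ) (w : M.BarPart q) :
    M.iter (DirectSum.lof 𝕜 ℕ M.BarPart q w) = M.iterPart q w :=
  DirectSum.toModule_lof 𝕜 q w

/-- On homogeneous tensors both sides lie in one degree, by `b0Part_mem` and `b1Part_mem`. There
they are compared pointwise for every super-curve, where the claim is `Q_iterInt`. -/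
theorem iter_bTotal : M.iter ∘ₗ M.bTotal = deltaB M ∘ₗ M.iter := by
  refine DirectSum.linearMap_ext 𝕜 fun q => M.barPart_hom_ext fun e f => ?_
  simp only [LinearMap.comp_apply]
  rw [iter_lof, iterPart_tens, deltaB, DirectSum.toModule_lof, LinearMap.comp_apply]
  have hQ : ∀ (L : NQManifold 𝕜) (φ : SuperCurve M L) (x : L.X),
      ((deltaBHomog M _ (M.iterFun e f)).1 L φ : L.Sec) x = φ.iterDiff x q (M.tens e f) :=
    fun L φ x => φ.Q_iterInt e f x
  obtain ⟨F, hF, hF'⟩ := M.b0Part_mem e f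
  cases q with
  | zero =>
    rw [bTotal_lof_zero, iter_lof, hF]
    congr 1
    refine M.superCurveFun_ext fun L φ x => ?_
    rw [hQ, hF']
    rfl
  | succ q =>
    obtain ⟨F₁, hF₁, hF₁'⟩ := M.b1Part_mem e f
    rw [bTotal_lof_succ, map_add, iter_lof, iter_lof, hF, hF₁, ← map_add]
    congr 1
    refine M.superCurveFun_ext fun L φ x => ?_
    rw [hQ, SuperCurve.iterDiff, LinearMap.add_apply, LinearMap.comp_apply, LinearMap.comp_apply,
      ← hF', ← hF₁']
    rfl

/-- The inserted function has degree zero, hence no `θ`-component, and it enters the integral only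
through that component. -/
theorem iter_insertion (i : ℕ) (f : M.Fun 0) : M.iter ∘ₗ M.insertion i f = 0 := by
  refine DirectSum.linearMap_ext 𝕜 fun q => M.barPart_hom_ext fun e g => ?_
  simp only [LinearMap.comp_apply]
  rw [insertion, DirectSum.toModule_lof]
  split_ifs with h
  · rw [LinearMap.comp_apply, iter_lof, tens, PiTensorProduct.lift.tprod]
    set v := (⟨i, by omega⟩ : Fin (q + 3)).insertNth (α := fun _ => M.Functions) (M.of 0 f)
      (fun i => M.of (e i) (g i)) with hv
    change M.iterPart (q + 1) (PiTensorProduct.tprod 𝕜 v) = 0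
    obtain ⟨F, hF, hF'⟩ := M.tprod_mem_homogPart (v := v)
      ((⟨i, by omega⟩ : Fin (q + 3)).insertNth (α := fun _ => ℤ) 0 e) rfl (fun j => by
        rw [hv]
        refine Fin.succAboveCases (⟨i, by omega⟩ : Fin (q + 3)) ?_ (fun j => ?_) j
        · rw [Fin.insertNth_apply_same, Fin.insertNth_apply_same]
          exact ⟨f, rfl⟩
        · rw [Fin.insertNth_apply_succAbove, Fin.insertNth_apply_succAbove]
          exact ⟨g j, rfl⟩)
    -- The bounds `1 ≤ i ≤ q + 1` put the inserted entry strictly between the two outer entries,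
    -- which are the only ones that enter through their bodies.
    have hF0 : F = 0 := M.superCurveFun_ext fun L φ x => by
      rw [hF', φ.iterInt_eq_zero x v (j := ⟨i, by omega⟩)]
      · rfl
      · simp [Fin.ext_iff]
        omega
      · simp [Fin.ext_iff]
        omega
      · simp [hv, φ.thetaPath_of_zero x f]
    rw [hF, hF0, map_zero]
  · rfl

/-- Modulo images of `S`, `b S` is the anticommutator `S b + b S`. Moreover `b (S b + b S) = b S b`
because `b² = 0`, which is of the kind just treated. -/
theorem degenerate_le_comap : M.degenerate ≤ M.degenerate.comap M.bTotal := by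
  have hbb : ∀ w, M.bTotal (M.bTotal w) = 0 := fun w => LinearMap.congr_fun M.bTotal_bTotal w
  have h1 : ∀ i f w, M.insertion i f w ∈ M.degenerate := fun i f w =>
    Submodule.mem_iSup_of_mem i (Submodule.mem_iSup_of_mem f (Submodule.mem_sup_left ⟨w, rfl⟩))
  have h2 : ∀ i f w, M.insertion i f (M.bTotal w) + M.bTotal (M.insertion i f w) ∈ M.degenerate :=
    fun i f w => Submodule.mem_iSup_of_mem i
      (Submodule.mem_iSup_of_mem f (Submodule.mem_sup_right ⟨w, rfl⟩))
  have h3 : ∀ i f w, M.bTotal (M.insertion i f w) ∈ M.degenerate := fun i f w => by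
    simpa using sub_mem (h2 i f w) (h1 i f (M.bTotal w))
  refine iSup_le fun i => iSup_le fun f => sup_le ?_ ?_
  · rintro _ ⟨w, rfl⟩
    exact h3 i f w
  · rintro _ ⟨w, rfl⟩
    simpa [hbb] using h3 i f (M.bTotal w)

theorem iter_eq_zero_of_mem {w : M.Bar} (hw : w ∈ M.degenerate) : M.iter w = 0 := by
  have h0 : ∀ i f w, M.iter (M.insertion i f w) = 0 := fun i f w =>
    LinearMap.congr_fun (M.iter_insertion i f) w
  have h1 : ∀ w, M.iter (M.bTotal w) = deltaB M (M.iter w) := fun w =>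
    LinearMap.congr_fun M.iter_bTotal w
  suffices M.degenerate ≤ LinearMap.ker M.iter from this hw
  refine iSup_le fun i => iSup_le fun f => sup_le ?_ ?_
  · rintro _ ⟨w, rfl⟩
    exact h0 i f w
  · rintro _ ⟨w, rfl⟩
    simp [h0, h1]

end NQManifold

/-! ### Descent to the normalized bar complex -/

theorem deltaB_deltaB {𝕜 : Type} [RCLike 𝕜] (M : NQManifold 𝕜) : deltaB M ∘ₗ deltaB M = 0 := by
  refine DirectSum.linearMap_ext 𝕜 fun n => LinearMap.ext fun F => ?_
  simp only [LinearMap.comp_apply, deltaB, DirectSum.toModule_lof]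
  rw [show deltaBHomog M (n + 1) (deltaBHomog M n F) = 0 from
    Subtype.ext (funext fun L => funext fun φ => L.Q_Q (F.1 L φ)), map_zero]
  rfl

/-- For an NQ-manifold `M`, the total differential `b_0 + b_1` descends to a differential `b` on
the normalized bar complex of `C^∞(M)`, and the iterated integral, with values in the functions on
the space of super-curves, is a well-defined map of degree zero on the normalized bar complex that
intertwines `b` with `δ_B`. -/
theorem mainTheorem6 (𝕜 : Type) [RCLike 𝕜] (M : NQManifold 𝕜) :
    deltaB M ∘ₗ deltaB M = 0 ∧
    ∃ b : M.NormalizedBar →ₗ[𝕜] M.NormalizedBar,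
      b ∘ₗ M.degenerate.mkQ = M.degenerate.mkQ ∘ₗ M.bTotal ∧
      b ∘ₗ b = 0 ∧
      ∃ Φ : M.NormalizedBar →ₗ[𝕜] SuperCurveFunctions M,
        (∀ (q : ℕ) (e : Fin (q + 2) → ℤ) (f : ∀ i, M.Fun (e i)),
          ∃ F : SuperCurveFun M ((∑ i, e i) - q),
            Φ (M.word e f) = DirectSum.lof 𝕜 ℤ (fun n => SuperCurveFun M n) _ F ∧
            ∀ (L : NQManifold 𝕜) (φ : SuperCurve M L),
              (F.1 L φ : L.Sec) = iteratedIntegral φ e f) ∧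
        Φ ∘ₗ b = deltaB M ∘ₗ Φ := by
  obtain ⟨b, hb⟩ : ∃ b : M.NormalizedBar →ₗ[𝕜] M.NormalizedBar,
      b ∘ₗ M.degenerate.mkQ = M.degenerate.mkQ ∘ₗ M.bTotal :=
    ⟨M.degenerate.mapQ _ M.bTotal M.degenerate_le_comap, Submodule.mapQ_mkQ _ _ _⟩
  obtain ⟨Φ, hΦ⟩ : ∃ Φ : M.NormalizedBar →ₗ[𝕜] SuperCurveFunctions M,
      Φ ∘ₗ M.degenerate.mkQ = M.iter :=
    M.degenerate.exists_comp_mkQ_eq M.iter fun w hw => M.iter_eq_zero_of_mem hw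
  have hΦ' : ∀ w, Φ (M.degenerate.mkQ w) = M.iter w := LinearMap.congr_fun hΦ
  refine ⟨deltaB_deltaB M, b, hb, ?_, Φ, fun q e f => ⟨M.iterFun e f, ?_, ?_⟩, ?_⟩
  · refine (LinearMap.cancel_right M.degenerate.mkQ_surjective).1 ?_
    rw [LinearMap.comp_assoc, hb, ← LinearMap.comp_assoc, hb, LinearMap.comp_assoc,
      M.bTotal_bTotal, LinearMap.comp_zero, LinearMap.zero_comp]
  · rw [NQManifold.word, hΦ', NQManifold.iter_lof]
    exact M.iterPart_tens e f
  · exact fun L φ => funext fun x => φ.iterInt_tens x e f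
  · refine (LinearMap.cancel_right M.degenerate.mkQ_surjective).1 ?_
    rw [LinearMap.comp_assoc, hb, ← LinearMap.comp_assoc, hΦ, M.iter_bTotal, LinearMap.comp_assoc,
      hΦ]

end
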